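/- **Setting.** Let $L_n, W_n$ ($n\in\mathbb Z$) be the modes of the $\mathcal W_3$ algebra of central charge $c$, $$[L_n,L_m]=(n-m)L_{n+m}+\tfrac{c}{12}n(n^2-1)\delta_{n+m,0},\qquad [L_n,W_m]=(2n-m)W_{n+m},$$ $$\tfrac29[W_n,W_m]=\tfrac{c\,n(n^2-1)(n^2-4)}{360}\delta_{n+m,0}+(n-m)\Big(\tfrac{(n+m+3)(n+m+2)}{15}-\tfrac{(n+2)(m+2)}{6}\Big)L_{n+m}+\tfrac{16(n-m)}{22+5c}\Lambda_{n+m},$$ $\Lambda_k=\gamma_kL_k+\sum_b{:}L_{k-b}L_b{:}$, $\gamma_{2j}=\frac{(1-j)(1+j)}5$, $\gamma_{2j+1}=\frac{(1-j)(2+j)}5$. An operator $\mathcal O_{h,w}$ of dimension $h\ne0$ and spin-3 charge $w$ is semi-degenerate if $W_{-1}\mathcal O_{h,w}=\frac{3w}{2h}L_{-1}\mathcal O_{h,w}$, where $$w^2=\Big[\tfrac{32}{22+5c}\big(h+\tfrac15\big)-\tfrac15\Big]h^2 .\qquad(1)$$ Let $\mathcal O=\mathcal O_{h,w}$ and $\mathcal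 O^*=\mathcal O_{h,-w}$ be semi-degenerate. The block of $\langle\mathcal O\mathcal O^*\mathcal O\mathcal O^*\rangle$ with intermediate operator of dimension $\tilde h$ and zero spin-3 charge is $$\mathcal B(z)=\sum_{n\ge0}B_nz^n,\qquad B_n=\sum_{|Y|=|Y'|=n}\langle h,-w|\mathcal O^*(1)Y|\tilde h,0\rangle\,Q^{-1}(Y,Y')\,\langle\tilde h,0|Y'^\dagger\mathcal O(1)|h,-w\rangle ,$$ where $Y,Y'$ run over the basis monomials $L_{-\lambda_1}\cdots L_{-\lambda_k}W_{-\mu_1}\cdots W_{-\mu_l}$ of level $n$ ($\lambda,\mu$ partitions, $|\lambda|+|\mu|=n$), $L_n^\dagger=L_{-n}$, $W_n^\dagger=-W_{-n}$, $Q(Y,Y')=\langle\tilde h,0|Y^\dagger Y'|\tilde h,0\rangle$, and the matrix elements, computed with the commutation relations of the modes with primary fields and the semi-degeneracy condition, are normalised to $1$ at $n=0$. For rational $\alpha>0$ and real $\delta,\tilde\delta\ne0$ put $h=\delta c^\alpha$, $\tilde h=\tilde\delta c^\alpha$, let $w$ satisfy (1), and expand $\log\mathcal B$ formally in decreasing rational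 powers of $c$: $$\log\mathcal B=\sum_a\mathsf f^{(\alpha)}_a(\delta,\tilde\delta|z)\,c^a .$$ Let $\mathsf S^{(\alpha)}$ (the classical block) be the sum of the terms with $a\ge0$. All statements about series in $z$ are modulo $z^4$, and the $\mathsf f^{(\alpha)}_a$ are compared as functions of $(\delta,\tilde\delta)$, $\delta,\tilde\delta\ne0$. **Proposition.** The leading term of $w^2$ at large $c$ is $-\frac{\delta^2}5c^{2\alpha}$ for $0<\alpha<1$ and $\frac{32\delta^3}5c^{3\alpha-1}$ for $\alpha>1$. Moreover: 1. Let $M\ge1$ be an integer and $\alpha\in\big(\frac{M-1}M,\frac M{M+1}\big]\cap\mathbb Q$. Then $$\mathsf S^{(\alpha)}=\sum_{m=1}^M\mathsf f^{(\alpha)}_{m\alpha-m+1}c^{m\alpha-m+1}+\mathsf f^{(\alpha)}_0,$$ and none of these $M+1$ coefficient functions vanishes identically. For each $m\ge1$ the function $\mathsf f^{(\alpha)}_{m\alpha-m+1}$ is the same for all $\alpha$ in all those intervals with $M\ge m$. The function $\mathsf f^{(\alpha)}_0$ is the same for all rational $\alpha$ in the open intervals $\big(\frac{M-1}M,\frac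 M{M+1}\big)$, $M\ge1$. At the exceptional points $\alpha=\frac M{M+1}$, $M=1,2,\dots$, the functions $\mathsf f^{(\alpha)}_0$ are pairwise different, and different from the common one. 2. Let $N\ge1$ be an integer and $\alpha\in\big[\frac{N+1}N,\frac N{N-1}\big)\cap\mathbb Q$ (with $\frac{1}{0}=\infty$ for $N=1$). Then $$\mathsf S^{(\alpha)}=\sum_{n=-1}^{N-1}\mathsf f^{(\alpha)}_{-n\alpha+n+1}c^{-n\alpha+n+1}+\mathsf f^{(\alpha)}_0,$$ and none of these $N+2$ coefficient functions vanishes identically. For each $n\ge-1$ the function $\mathsf f^{(\alpha)}_{-n\alpha+n+1}$ is the same for all $\alpha$ in all those intervals with $N-1\ge n$. The function $\mathsf f^{(\alpha)}_0$ is the same for all rational $\alpha$ in the open intervals $\big(\frac{N+1}N,\frac N{N-1}\big)$, $N\ge1$. At the exceptional points $\alpha=\frac{N+1}N$, $N=1,2,\dots$, the functions $\mathsf f^{(\alpha)}_0$ are pairwise different, and different from the common one. -/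

import Mathlib

/-! ## The `W₃` algebra acting on a Verma module

`K` is a field of characteristic zero.  Modes satisfy
`[L_n, L_m] = (n - m) L_{n+m} + c/12 n (n² - 1) δ_{n+m,0}`, `[L_n, W_m] = (2n - m) W_{n+m}`,
`(2/9) [W_n, W_m] = c n (n² - 1) (n² - 4) / 360 δ_{n+m,0}
   + (n - m) ((n+m+3)(n+m+2)/15 - (n+2)(m+2)/6) L_{n+m} + 16 (n - m)/(22 + 5c) Λ_{n+m}`,
`Λ_k = γ_k L_k + ∑_b :L_{k-b} L_b:`. -/

namespace W3

/-- The modes of the spin-2 current and of the spin-3 current. -/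
inductive Mode : Type
  | L (n : ℤ) : Mode
  | W (n : ℤ) : Mode
  deriving DecidableEq

/-- The index `n` of `L_n` or `W_n`. -/
def Mode.index : Mode → ℤ
  | .L n => n
  | .W n => n

/-- The mode of the same current with the opposite index. -/
def Mode.flip : Mode → Mode
  | .L n => .L (-n)
  | .W n => .W (-n)

/-- A word `[X₁, …, X_k]` of modes of negative index stands for the descendant
`X₁ ⋯ X_k |h̃, w̃⟩`. -/
abbrev Word := List Mode

/-- The level `|Y|` of a word. -/
def level (Y : Word) : ℤ := (Y.map fun X => -X.index).sum

/-- The number of spin-3 modes in a word. -/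
def numW : Word → ℕ
  | [] => 0
  | .L _ :: Y => numW Y
  | .W _ :: Y => numW Y + 1

section Algebra

variable {K : Type*} [Field K]

/-- Linear extension of a function on words to formal linear combinations of words. -/
noncomputable def lift {V : Type*} [AddCommGroup V] [Module K V] (f : Word → V) :
    (Word →₀ K) →ₗ[K] V :=
  Finsupp.linearCombination K f

/-- Left multiplication of linear combinations of words by a mode. -/
noncomputable def prepend (X : Mode) : (Word →₀ K) →ₗ[K] (Word →₀ K) :=
  lift fun Y => Finsupp.single (X :: Y) 1

/-- `γ_{2j} = (1 - j)(1 + j)/5` and `γ_{2j+1} = (1 - j)(2 + j)/5`. -/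
def gam (k : ℤ) : K :=
  if Even k then (1 - (k : K) / 2) * (1 + (k : K) / 2) / 5
  else (1 - ((k : K) - 1) / 2) * (2 + ((k : K) - 1) / 2) / 5

/-- `Λ_k` applied to the descendant `Y`, when `A X Y` is the mode `X` applied to `Y`.
In a normally ordered product the mode of larger index stands on the right; a mode whose index
exceeds the level of `Y` kills `Y`, which leaves finitely many terms of the sum. -/
noncomputable def lam (A : Mode → Word → (Word →₀ K)) (k : ℤ) (Y : Word) : Word →₀ K :=
  gam (K := K) k • A (.L k) Y +
    ∑ b ∈ Finset.Icc (k - level Y) (level Y),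
      lift (A (.L (min (k - b) b))) (A (.L (max (k - b) b)) Y)

/-- The commutator `[X, X']` applied to the descendant `Y`, when `A` gives the action of single
modes. -/
noncomputable def bracket (c : K) (A : Mode → Word → (Word →₀ K)) :
    Mode → Mode → Word → (Word →₀ K)
  | .L n, .L m, Y =>
      ((n : K) - m) • A (.L (n + m)) Y +
        (if n + m = 0 then c / 12 * n * ((n : K) ^ 2 - 1) else 0) • Finsupp.single Y 1
  | .L n, .W m, Y => (2 * (n : K) - m) • A (.W (n + m)) Y
  | .W n, .L m, Y => -((2 * (m : K) - n) • A (.W (n + m)) Y)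
  | .W n, .W m, Y =>
      (9 / 2 : K) •
        ((if n + m = 0 then c * n * ((n : K) ^ 2 - 1) * ((n : K) ^ 2 - 4) / 360 else 0) •
            Finsupp.single Y 1 +
          (((n : K) - m) * (((n : K) + m + 3) * ((n : K) + m + 2) / 15
            - ((n : K) + 2) * ((m : K) + 2) / 6)) • A (.L (n + m)) Y +
          (16 * ((n : K) - m) / (22 + 5 * c)) • lam A (n + m) Y)

/-- The action of a mode on a descendant of `|h̃, w̃⟩`, with the result again written through
descendants: a mode of negative index is prepended, any other mode is commuted to the right until
it reaches `|h̃, w̃⟩`.  The recursion is on a bound for the length of the word; the value for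
words of length less than `N` does not depend on `N`. -/
noncomputable def actAux (c ht wt : K) : ℕ → Mode → Word → (Word →₀ K)
  | 0, _, _ => 0
  | N + 1, X, Y =>
    if X.index < 0 then Finsupp.single (X :: Y) 1
    else
      match X, Y with
      | .L n, [] => if n = 0 then Finsupp.single [] ht else 0
      | .W n, [] => if n = 0 then Finsupp.single [] wt else 0
      | X, X' :: Y' => prepend X' (actAux c ht wt N X Y') + bracket c (actAux c ht wt N) X X' Y'

/-- The action of a mode on linear combinations of descendants of `|h̃, w̃⟩`. -/
noncomputable def act (c ht wt : K) (X : Mode) : (Word →₀ K) →ₗ[K] (Word →₀ K) :=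
  lift fun Y => actAux c ht wt (Y.length + 1) X Y

/-! ## Gram matrix and three-point matrix elements -/

/-- The inner product `⟨h̃, w̃| Y† Y' |h̃, w̃⟩` with `L_n† = L_{-n}` and `W_n† = -W_{-n}`. -/
noncomputable def gram (c ht wt : K) (Y Y' : Word) : K :=
  (-1) ^ numW Y *
    (Y.foldl (fun v X => act c ht wt X.flip v) (Finsupp.single Y' 1)) []

/-- `⟨h̃, w̃| X̄_k ⋯ X̄₁ O₃(1) |h₄, w₄⟩` for the word `[X₁, …, X_k]`, where `X̄` is the mode `X` with
the opposite index, normalised by `⟨h̃, w̃| O₃(1) |h₄, w₄⟩ = 1`.  The mode next to `O₃` is commuted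
through it by means of
`[L_n, O(z)] = z^n (z ∂ + (n+1) h) O(z)`,
`[W_n, O(z)] = z^n (z² W_{-2} + (n+2) z W_{-1} + (n+2)(n+1)/2 w) O(z)`,
`W_{-1} O₃ = 3 w₃/(2 h₃) ∂O₃`; the field `W_{-2} O₃` is eliminated through the case `n = 0`.
Since `X ↦ X̄` is an anti-automorphism of the algebra, `⟨h̃, w̃| X̄_k ⋯ X̄₂ W_0` is read off from
`W_0 X₂ ⋯ X_k |h̃, w̃⟩`.  The recursion is on a bound for the level. -/
noncomputable def rightAux (c ht wt h₃ w₃ h₄ w₄ : K) : ℕ → Word → K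
  | _, [] => 1
  | 0, _ :: _ => 0
  | N + 1, .L m :: Y =>
      (ht + level Y - m * h₃ - h₄) * rightAux c ht wt h₃ w₃ h₄ w₄ N Y
  | N + 1, .W m :: Y =>
      lift (rightAux c ht wt h₃ w₃ h₄ w₄ N) (act c ht wt (.W 0) (Finsupp.single Y 1)) +
        (-w₄ + (-m) * (3 * w₃ / (2 * h₃)) * (ht + level Y - h₃ - h₄)
          + ((m : K) ^ 2 - 3 * m) / 2 * w₃) * rightAux c ht wt h₃ w₃ h₄ w₄ N Y

/-- `Γ(Y) = ⟨h̃, w̃| Y† O₃(1) |h₄, w₄⟩` with `O₃` semi-degenerate, normalised by `Γ(∅) = 1`. -/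
noncomputable def rightElement (c ht wt h₃ w₃ h₄ w₄ : K) (Y : Word) : K :=
  (-1) ^ numW Y * rightAux c ht wt h₃ w₃ h₄ w₄ (level Y).toNat Y

/-- The recursion for `⟨h₁, -w₁| O₂(1) Y |h̃, w̃⟩`, normalised by `⟨h₁, -w₁| O₂(1) |h̃, w̃⟩ = 1`.
The leftmost mode of `Y` is commuted to the left through `O₂`, as above with
`W_{-1} O₂ = 3 w₂/(2 h₂) ∂O₂`; note `⟨h₁, -w₁| W_0 = -w₁ ⟨h₁, -w₁|`. -/
noncomputable def leftAux (c ht wt h₁ w₁ h₂ w₂ : K) : ℕ → Word → K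
  | _, [] => 1
  | 0, _ :: _ => 0
  | N + 1, .L m :: Y =>
      (ht + level Y - m * h₂ - h₁) * leftAux c ht wt h₁ w₁ h₂ w₂ N Y
  | N + 1, .W m :: Y =>
      lift (leftAux c ht wt h₁ w₁ h₂ w₂ N) (act c ht wt (.W 0) (Finsupp.single Y 1)) +
        (w₁ + (-m) * (3 * w₂ / (2 * h₂)) * (h₁ - ht - level Y - h₂)
          - ((m : K) ^ 2 + 3 * m) / 2 * w₂) * leftAux c ht wt h₁ w₁ h₂ w₂ N Y

/-- `Γ*(Y) = ⟨h₁, -w₁| O₂(1) Y |h̃, w̃⟩` with `O₂` semi-degenerate, normalised by `Γ*(∅) = 1`. -/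
noncomputable def leftElement (c ht wt h₁ w₁ h₂ w₂ : K) (Y : Word) : K :=
  leftAux c ht wt h₁ w₁ h₂ w₂ (level Y).toNat Y

end Algebra

/-! ## The conformal block -/

/-- The partitions of `n` into parts at most `m`, as weakly decreasing lists. -/
def partitionsLE : ℕ → ℕ → List (List ℕ)
  | 0, n => if n = 0 then [[]] else []
  | m + 1, n => (List.range (n / (m + 1) + 1)).flatMap fun j =>
      (partitionsLE m (n - j * (m + 1))).map (List.replicate j (m + 1) ++ ·)

/-- The basis monomials `L_{-λ₁} ⋯ L_{-λ_k} W_{-μ₁} ⋯ W_{-μ_l}` of level `n`, where `λ` and `μ`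
are partitions with `|λ| + |μ| = n`. -/
def basis (n : ℕ) : List Word :=
  (List.range (n + 1)).flatMap fun k =>
    (partitionsLE k k).flatMap fun lm =>
      (partitionsLE (n - k) (n - k)).map fun mu =>
        lm.map (fun i => Mode.L (-(i : ℤ))) ++ mu.map (fun i => Mode.W (-(i : ℤ)))

section Block

variable {K : Type*} [Field K]

/-- `∑ Γ*(Y) Q⁻¹(Y, Y') Γ(Y')` over the words `Y, Y'` of a list. -/
noncomputable def projectorSum (b : List Word) (Q : Word → Word → K) (Gs G : Word → K) : K :=
  ∑ i : Fin b.length, ∑ j : Fin b.length,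
    Gs (b.get i) * (Matrix.of fun i j : Fin b.length => Q (b.get i) (b.get j))⁻¹ i j * G (b.get j)

/-- The bare block `B(z) = ∑ B_n zⁿ` of the correlation function `⟨O O* O O*⟩` in which
`O = O_{h,w}` and `O* = O_{h,-w}` are semi-degenerate, with intermediate operator of weights
`(h̃, 0)`. -/
noncomputable def block (c h w ht : K) : PowerSeries K :=
  PowerSeries.mk fun n =>
    projectorSum (basis n) (gram c ht 0)
      (leftElement c ht 0 h w h (-w)) (rightElement c ht 0 h w h (-w))

/-- The logarithmic block `log B(z)`. -/
noncomputable def logBlock [Algebra ℚ K] (c h w ht : K) : PowerSeries K :=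
  PowerSeries.logOf (block c h w ht)

/-- The value of `w²` imposed on a semi-degenerate operator of dimension `h`. -/
noncomputable def semiDegenerateCharge (c h : K) : K :=
  (32 / (22 + 5 * c) * (h + 1 / 5) - 1 / 5) * h ^ 2

end Block

/-! ## Large central charge -/

/-- Formal series in rational powers of `c`, whose exponents are bounded above; `coeff g` is the
coefficient of `c ^ (-g)`.  This field contains all Puiseux series at `c = ∞`. -/
abbrev Puiseux := HahnSeries ℚ ℂ

/-- The power `c ^ a` of the central charge. -/
noncomputable def cPow (a : ℚ) : Puiseux := HahnSeries.single (-a) 1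

/-- The principal part: all terms with non-negative powers of `c`. -/
noncomputable def prin (x : Puiseux) : Puiseux :=
  HahnSeries.truncLT 0 x + HahnSeries.C (x.coeff 0)

/-- The logarithmic block for `h = δ c^α`, `h̃ = δ̃ c^α`, where `w α δ` is the charge of `O`. -/
noncomputable def heavyLogBlock (w : ℚ → ℝ → Puiseux) (α : ℚ) (δ δt : ℝ) : PowerSeries Puiseux :=
  logBlock (cPow 1) (HahnSeries.C (δ : ℂ) * cPow α) (w α δ) (HahnSeries.C (δt : ℂ) * cPow α)

/-- The classical block: the principal part of the logarithmic block, up to `O(z⁴)`. -/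
noncomputable def classicalBlock (w : ℚ → ℝ → Puiseux) (α : ℚ) (δ δt : ℝ) :
    Polynomial Puiseux :=
  PowerSeries.trunc 4 (PowerSeries.mk fun n => prin (PowerSeries.coeff n (heavyLogBlock w α δ δt)))

/-- The coefficient function of `c ^ a` in the logarithmic block, up to `O(z⁴)`. -/
noncomputable def coeffFun (w : ℚ → ℝ → Puiseux) (α a : ℚ) (δ δt : ℝ) : Polynomial ℂ :=
  PowerSeries.trunc 4
    (PowerSeries.mk fun n => (PowerSeries.coeff n (heavyLogBlock w α δ δt)).coeff (-a))

/-- The term `f(z) c ^ a` of a Puiseux polynomial. -/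
noncomputable def term (f : Polynomial ℂ) (a : ℚ) : Polynomial Puiseux :=
  Polynomial.C (cPow a) * f.map HahnSeries.C

/-- Two functions of the classical dimensions `δ, δ̃ ≠ 0` coincide. -/
def SameFun (f g : ℝ → ℝ → Polynomial ℂ) : Prop :=
  ∀ δ δt : ℝ, δ ≠ 0 → δt ≠ 0 → f δ δt = g δ δt

/-- The half-open interval `((M-1)/M, M/(M+1)]`. -/
def lowerInterval (M : ℕ) : Set ℚ := {α | ((M : ℚ) - 1) / M < α ∧ α ≤ M / (M + 1)}

/-- The open interval `((M-1)/M, M/(M+1))`. -/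
def lowerRegular (M : ℕ) : Set ℚ := {α | ((M : ℚ) - 1) / M < α ∧ α < M / (M + 1)}

/-- The half-open interval `[(N+1)/N, N/(N-1))`, which is `[2, ∞)` for `N = 1`. -/
def upperInterval (N : ℕ) : Set ℚ := {α | ((N : ℚ) + 1) / N ≤ α ∧ ((N : ℚ) - 1) * α < N}

/-- The open interval `((N+1)/N, N/(N-1))`, which is `(2, ∞)` for `N = 1`. -/
def upperRegular (N : ℕ) : Set ℚ := {α | ((N : ℚ) + 1) / N < α ∧ ((N : ℚ) - 1) * α < N}

end W3

/-! Modulo `z⁴` only the levels `n ≤ 3` matter, and there the block is a finite computation. Because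
the intermediate state has zero spin-3 charge, words with an even and with an odd number of spin-3
modes are orthogonal, so each Gram matrix splits into two blocks. In each block the linear system `Q
v = Γ` is solved explicitly and its kernel is shown to be trivial, which yields `Γ* Q⁻¹ Γ` without
inverting `Q` (`projectorSum_eq_of_solution`). With `u = w / h`, a matrix element of an odd word is
odd in `u` and one of an even word is even in `u`, so the charge enters only through `(22 + 5c) u² =
32 h + 2 - c`.

In the variable `x = z / √(1 - z)` the result is `(1 - z)^(h̃/2) B = exp(ℓ₁ x + ℓ₂ x² + ℓ₃ x³)`
modulo `z⁴`, where even words produce the even powers of `x` and odd words the odd ones. The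
functions `ℓᵢ` are `logOne`, `logTwo`, `logThree`; their denominators are products of `linDet`,
`evenDet` and `oddDet` (`coeff_logBlock`).

After homogenisation these functions have degree one under a common rescaling of `h`, `h̃`, `t` and
degree zero under a second rescaling (`logCoeff_scale`). At `h = δ c^α`, `h̃ = δ̃ c^α` every
coefficient of the logarithm is therefore `c^α E(s, t)` with `t = c^(-α)` and `s = c^(-σ)`, where `σ
= 1 - α` for `α < 1` and `σ = α - 1` for `α > 1`. The denominators do not vanish at `s = t = 0`
(`isRegular_lower`, `isRegular_upper`), so `E` is a power series in `s` and `t`, and it does not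
depend on `α` within a regime. This is the source of all the universality statements.

The monomial `c^α s^i t^j` has exponent `α - iσ - jα`. It is non-negative only for `j = 0`, `iσ ≤
α`, and for `j = 1`, `i = 0`. The first family gives the listed powers; the second gives one
universal contribution to `c^0`. At the exceptional points `iσ = α` a member of the first family
also lands on `c^0` and changes that coefficient (`HasExpansion.classicalBlock_eq`,
`HasExpansion.coeffFun_zero_of_eq`, `HasExpansion.coeffFun_zero_of_ne`).

Non-vanishing and distinctness are read off at `δ = 2`, `δ̃ = 1`, where the coefficient of `z` at `t
= 0` is a Möbius function of `s`, hence has geometric Taylor coefficients. In the range `α < 1` the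
universal part of `c^0` starts only at order `z²`. The leading term of `w²` is a separate
computation of orders (`order_semiDegenerateCharge`). -/

namespace W3

/-! ### Commutation relations for the action on the Verma module. -/

section Action

variable {K : Type*} [Field K]

/-- The descendant `Y` as a basis vector of the Verma module. -/
noncomputable def ket (Y : Word) : Word →₀ K := Finsupp.single Y 1

@[simp]
theorem lift_ket {V : Type*} [AddCommGroup V] [Module K V] (f : Word → V) (Y : Word) :
    lift f (ket Y : Word →₀ K) = f Y := by
  simp [lift, ket]

@[simp]
theorem prepend_ket (X : Mode) (Y : Word) : prepend X (ket Y : Word →₀ K) = ket (X :: Y) := by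
  simp only [prepend, lift_ket]; rfl

/-- Linear combinations of words of length at most `n`. -/
noncomputable def short (K : Type*) [Field K] (n : ℕ) : Submodule K (Word →₀ K) :=
  Finsupp.supported K K {Y | Y.length ≤ n}

theorem short_mono {m n : ℕ} (h : m ≤ n) : short K m ≤ short K n :=
  Finsupp.supported_mono fun _ hY => le_trans hY h

theorem single_mem_short {n : ℕ} {Y : Word} (h : Y.length ≤ n) (r : K) :
    Finsupp.single Y r ∈ short K n :=
  Finsupp.single_mem_supported K r h

theorem lift_mem_of_short {V : Type*} [AddCommGroup V] [Module K V] {f : Word → V} {n : ℕ}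
    {M : Submodule K V} (hf : ∀ Z : Word, Z.length ≤ n → f Z ∈ M) {v : Word →₀ K}
    (hv : v ∈ short K n) : lift f v ∈ M := by
  rw [lift, Finsupp.linearCombination_apply]
  exact M.sum_mem fun Z hZ => M.smul_mem _ (hf Z (hv hZ))

theorem lift_congr_of_short {V : Type*} [AddCommGroup V] [Module K V] {f g : Word → V} {n : ℕ}
    (hf : ∀ Z : Word, Z.length ≤ n → f Z = g Z) {v : Word →₀ K}
    (hv : v ∈ short K n) : lift f v = lift g v := by
  simp only [lift, Finsupp.linearCombination_apply]
  exact Finsupp.sum_congr fun Z hZ => by rw [hf Z (hv hZ)]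

theorem prepend_mem_short (X : Mode) {n : ℕ} {v : Word →₀ K} (hv : v ∈ short K n) :
    prepend X v ∈ short K (n + 1) :=
  lift_mem_of_short (fun Z hZ => single_mem_short (by simpa using hZ) 1) hv

theorem actAux_neg (c ht wt : K) (N : ℕ) {X : Mode} (hX : X.index < 0) (Y : Word) :
    actAux c ht wt (N + 1) X Y = ket (X :: Y) := by
  simp [actAux, hX, ket]

theorem actAux_cons (c ht wt : K) (N : ℕ) {X : Mode} (hX : 0 ≤ X.index) (X' : Mode) (Y : Word) :
    actAux c ht wt (N + 1) X (X' :: Y) =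
      prepend X' (actAux c ht wt N X Y) + bracket c (actAux c ht wt N) X X' Y := by
  rw [actAux, if_neg (not_lt.2 hX)]

theorem lam_mem_short {A : Mode → Word → (Word →₀ K)}
    (hA : ∀ X Y, A X Y ∈ short K (Y.length + 1)) (k : ℤ) (Y : Word) :
    lam A k Y ∈ short K (Y.length + 2) := by
  refine add_mem (Submodule.smul_mem _ _ (short_mono (by lia) (hA _ _)))
    (sum_mem fun b _ => lift_mem_of_short (n := Y.length + 1) (fun Z hZ => ?_) (hA _ _))
  exact short_mono (by lia) (hA _ _)

/-- Commuting a spin-2 mode of non-negative index through a word replaces a letter or deletes it,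
while the quadratic term in `[W, W]` can add one letter. Both bounds are needed at once, since `[L,
W]` produces spin-3 modes and `[W, W]` produces spin-2 modes. -/
theorem actAux_mem_short (c ht wt : K) (N : ℕ) :
    (∀ n Y, 0 ≤ n → actAux c ht wt N (.L n) Y ∈ short K Y.length) ∧
      ∀ X Y, actAux c ht wt N X Y ∈ short K (Y.length + 1) := by
  induction N with
  | zero => exact ⟨fun _ _ _ => zero_mem _, fun _ _ => zero_mem _⟩
  | succ N ih =>
    obtain ⟨hL, hA⟩ := ih
    have h1 : ∀ n Y, 0 ≤ n → actAux c ht wt (N + 1) (.L n) Y ∈ short K Y.length := by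
      intro n Y hn
      cases Y with
      | nil =>
        rw [actAux, if_neg (by simpa [Mode.index] using hn)]
        split_ifs
        · exact single_mem_short le_rfl _
        · exact zero_mem _
      | cons X' Y =>
        rw [actAux_cons _ _ _ _ (by simpa [Mode.index] using hn)]
        refine add_mem (prepend_mem_short _ (hL n Y hn)) ?_
        cases X' with
        | L m =>
          exact add_mem (Submodule.smul_mem _ _ (hA _ _))
            (Submodule.smul_mem _ _ (single_mem_short (by simp) _))
        | W m => exact Submodule.smul_mem _ _ (hA _ _)
    refine ⟨h1, fun X Y => ?_⟩
    by_cases hX : X.index < 0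
    · rw [actAux_neg _ _ _ _ hX]
      exact single_mem_short (by simp) _
    cases X with
    | L n => exact short_mono (by lia) (h1 n Y (by simpa [Mode.index] using hX))
    | W n =>
      cases Y with
      | nil =>
        rw [actAux, if_neg hX]
        split_ifs
        · exact single_mem_short (by simp) _
        · exact zero_mem _
      | cons X' Y =>
        rw [actAux_cons _ _ _ _ (not_lt.1 hX)]
        refine add_mem (prepend_mem_short _ (hA _ Y)) ?_
        cases X' with
        | L m =>
          exact neg_mem (Submodule.smul_mem _ _ (short_mono (by simp) (hA _ _)))
        | W m =>
          refine Submodule.smul_mem _ _ (add_mem (add_mem ?_ ?_) ?_)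
          · exact Submodule.smul_mem _ _ (single_mem_short (by simp; lia) _)
          · exact Submodule.smul_mem _ _ (short_mono (by simp) (hA _ _))
          · exact Submodule.smul_mem _ _ (lam_mem_short hA _ _)

/-- In a normally ordered product `:LL:` the right factor acts first. If its index is non-negative
it does not lengthen the word, so the left factor meets only words on which the two actions are
assumed to agree. If its index is negative, so is that of the left factor, and agreement on negative
modes suffices. This is why normal ordering makes the recursion on word length well founded. -/
theorem lam_congr {A B : Mode → Word → (Word →₀ K)} {Y : Word}
    (h : ∀ X Z, Z.length ≤ Y.length → A X Z = B X Z)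
    (hneg : ∀ X Z, X.index < 0 → A X Z = B X Z)
    (hL : ∀ n Z, 0 ≤ n → A (.L n) Z ∈ short K Z.length) (k : ℤ) :
    lam A k Y = lam B k Y := by
  unfold lam
  rw [h _ _ le_rfl]
  congr 1
  refine Finset.sum_congr rfl fun b _ => ?_
  rw [← h _ _ le_rfl]
  by_cases hm : max (k - b) b < 0
  · have : ∀ Z, A (.L (min (k - b) b)) Z = B (.L (min (k - b) b)) Z := fun Z =>
      hneg _ _ (lt_of_le_of_lt min_le_max hm)
    rw [funext this]
  · exact lift_congr_of_short (fun Z hZ => h _ _ hZ) (hL _ _ (not_lt.1 hm))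

theorem bracket_congr {A B : Mode → Word → (Word →₀ K)} {Y : Word} (c : K)
    (h : ∀ X Z, Z.length ≤ Y.length → A X Z = B X Z)
    (hneg : ∀ X Z, X.index < 0 → A X Z = B X Z)
    (hL : ∀ n Z, 0 ≤ n → A (.L n) Z ∈ short K Z.length) (X X' : Mode) :
    bracket c A X X' Y = bracket c B X X' Y := by
  cases X <;> cases X' <;> simp only [bracket, h _ Y le_rfl, lam_congr h hneg hL]

/-- The recursion bound is immaterial once it exceeds the length of the word. This turns the
recursive definition into commutation relations for `act`, in which no bound appears. -/
theorem actAux_stable (c ht wt : K) (N : ℕ) : ∀ (M : ℕ) (X : Mode) (Y : Word),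
    Y.length ≤ N → Y.length ≤ M →
      actAux c ht wt (N + 1) X Y = actAux c ht wt (M + 1) X Y := by
  induction N with
  | zero =>
    intro M X Y hY _
    obtain rfl : Y = [] := List.length_eq_zero_iff.1 (by lia)
    cases X <;> simp [actAux]
  | succ N ih =>
    intro M X Y hN hM
    by_cases hX : X.index < 0
    · rw [actAux_neg _ _ _ _ hX, actAux_neg _ _ _ _ hX]
    cases Y with
    | nil => cases X <;> simp [actAux]
    | cons X' Y =>
      obtain ⟨M, rfl⟩ : ∃ M', M = M' + 1 := ⟨M - 1, by simp at hM; lia⟩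
      simp only [List.length_cons, Nat.add_le_add_iff_right] at hN hM
      rw [actAux_cons _ _ _ _ (not_lt.1 hX), actAux_cons _ _ _ _ (not_lt.1 hX), ih M X Y hN hM]
      congr 1
      refine bracket_congr c (fun X Z hZ => ih M X Z (hZ.trans hN) (hZ.trans hM)) ?_
        (actAux_mem_short c ht wt _).1 X X'
      intro X Z hX
      rw [actAux_neg _ _ _ _ hX, actAux_neg _ _ _ _ hX]

variable (c ht wt : K)

theorem actAux_eq_act {N : ℕ} (X : Mode) {Y : Word} (h : Y.length ≤ N) :
    actAux c ht wt (N + 1) X Y = act c ht wt X (ket Y) := by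
  rw [act, lift_ket]
  exact actAux_stable c ht wt N _ X Y h le_rfl

theorem act_of_neg {X : Mode} (hX : X.index < 0) (Y : Word) :
    act c ht wt X (ket Y) = ket (X :: Y) := by
  rw [act, lift_ket, actAux_neg _ _ _ _ hX]

/-- The mode `Λ_k` acting on the descendant `Y`. -/
noncomputable def lamAct (k : ℤ) (Y : Word) : Word →₀ K :=
  gam (K := K) k • act c ht wt (.L k) (ket Y) +
    ∑ b ∈ Finset.Icc (k - level Y) (level Y),
      act c ht wt (.L (min (k - b) b)) (act c ht wt (.L (max (k - b) b)) (ket Y))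

theorem lam_actAux (k : ℤ) (Y : Word) :
    lam (actAux c ht wt (Y.length + 1)) k Y = lamAct c ht wt k Y := by
  have key : lam (actAux c ht wt (Y.length + 1)) k Y
      = lam (fun X Z => act c ht wt X (ket Z)) k Y := by
    refine lam_congr (fun X Z hZ => actAux_eq_act c ht wt X hZ) (fun X Z hX => ?_)
      (actAux_mem_short c ht wt _).1 k
    rw [actAux_neg _ _ _ _ hX, act_of_neg _ _ _ hX]
  rw [key]
  unfold lam lamAct
  congr 1
  refine Finset.sum_congr rfl fun b _ => ?_
  have : ∀ X, lift (fun Z => act c ht wt X (ket Z)) = act c ht wt X := fun X => by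
    unfold lift; ext Z; simp [ket]
  rw [this]

theorem act_cons {X : Mode} (hX : 0 ≤ X.index) (X' : Mode) (Y : Word) :
    act c ht wt X (ket (X' :: Y)) =
      prepend X' (act c ht wt X (ket Y)) + bracket c (actAux c ht wt (Y.length + 1)) X X' Y := by
  rw [← actAux_eq_act c ht wt X (Y := Y) le_rfl, ← actAux_cons _ _ _ _ hX,
    ← actAux_eq_act c ht wt X (Y := X' :: Y) le_rfl]
  rfl

theorem act_L_nil {n : ℤ} (hn : 0 ≤ n) :
    act c ht wt (.L n) (ket []) = if n = 0 then ht • ket [] else 0 := by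
  rw [act, lift_ket, actAux, if_neg (by simpa [Mode.index] using hn)]
  simp [ket]

theorem act_W_nil {n : ℤ} (hn : 0 ≤ n) :
    act c ht wt (.W n) (ket []) = if n = 0 then wt • ket [] else 0 := by
  rw [act, lift_ket, actAux, if_neg (by simpa [Mode.index] using hn)]
  simp [ket]

theorem act_L_L {n : ℤ} (hn : 0 ≤ n) (m : ℤ) (Y : Word) :
    act c ht wt (.L n) (ket (.L m :: Y)) = prepend (.L m) (act c ht wt (.L n) (ket Y)) +
      (((n : K) - m) • act c ht wt (.L (n + m)) (ket Y) +
        (if n + m = 0 then c / 12 * n * ((n : K) ^ 2 - 1) else 0) • ket Y) := by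
  rw [act_cons c ht wt (by simpa [Mode.index] using hn), bracket,
    actAux_eq_act c ht wt _ le_rfl]
  rfl

theorem act_L_W {n : ℤ} (hn : 0 ≤ n) (m : ℤ) (Y : Word) :
    act c ht wt (.L n) (ket (.W m :: Y)) = prepend (.W m) (act c ht wt (.L n) (ket Y)) +
      (2 * (n : K) - m) • act c ht wt (.W (n + m)) (ket Y) := by
  rw [act_cons c ht wt (by simpa [Mode.index] using hn), bracket,
    actAux_eq_act c ht wt _ le_rfl]

theorem act_W_L {n : ℤ} (hn : 0 ≤ n) (m : ℤ) (Y : Word) :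
    act c ht wt (.W n) (ket (.L m :: Y)) = prepend (.L m) (act c ht wt (.W n) (ket Y)) -
      (2 * (m : K) - n) • act c ht wt (.W (n + m)) (ket Y) := by
  rw [act_cons c ht wt (by simpa [Mode.index] using hn), bracket,
    actAux_eq_act c ht wt _ le_rfl]
  exact (sub_eq_add_neg _ _).symm

/-- The inverse of `22 + 5 c`. -/
noncomputable def kappa (c : K) : K := (22 + 5 * c)⁻¹

theorem act_W_W {n : ℤ} (hn : 0 ≤ n) (m : ℤ) (Y : Word) :
    act c ht wt (.W n) (ket (.W m :: Y)) = prepend (.W m) (act c ht wt (.W n) (ket Y)) +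
      (9 / 2 : K) •
        ((if n + m = 0 then c * n * ((n : K) ^ 2 - 1) * ((n : K) ^ 2 - 4) / 360 else 0) • ket Y +
          (((n : K) - m) * (((n : K) + m + 3) * ((n : K) + m + 2) / 15
            - ((n : K) + 2) * ((m : K) + 2) / 6)) • act c ht wt (.L (n + m)) (ket Y) +
          (16 * ((n : K) - m) * kappa c) • lamAct c ht wt (n + m) Y) := by
  rw [act_cons c ht wt (by simpa [Mode.index] using hn), bracket,
    actAux_eq_act c ht wt _ le_rfl, lam_actAux, kappa, ← div_eq_mul_inv]
  rfl

end Action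

/-! ### Modes acting on descendants of level at most three, at zero internal charge. -/

section Table

set_option linter.unusedSectionVars false

variable {K : Type*} [Field K]

@[simp]
theorem act_L_neg_one (c ht wt : K) (Y : Word) :
    act c ht wt (.L (-1)) (ket Y) = ket (.L (-1) :: Y) :=
  act_of_neg c ht wt (by simp [Mode.index]) Y

@[simp]
theorem act_L_neg_two (c ht wt : K) (Y : Word) :
    act c ht wt (.L (-2)) (ket Y) = ket (.L (-2) :: Y) :=
  act_of_neg c ht wt (by simp [Mode.index]) Y

@[simp]
theorem act_W_neg_one (c ht wt : K) (Y : Word) :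
    act c ht wt (.W (-1)) (ket Y) = ket (.W (-1) :: Y) :=
  act_of_neg c ht wt (by simp [Mode.index]) Y

@[simp]
theorem act_W_neg_two (c ht wt : K) (Y : Word) :
    act c ht wt (.W (-2)) (ket Y) = ket (.W (-2) :: Y) :=
  act_of_neg c ht wt (by simp [Mode.index]) Y

@[simp]
theorem act_L_zero_nil (c ht wt : K) : act c ht wt (.L 0) (ket []) = ht • ket [] := by
  simp [act_L_nil]

@[simp]
theorem act_W_zero_nil (c ht : K) : act c ht 0 (.W 0) (ket []) = 0 := by
  simp [act_W_nil]

@[simp]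
theorem act_L_one_nil (c ht wt : K) : act c ht wt (.L 1) (ket []) = 0 := by
  simp [act_L_nil]

@[simp]
theorem act_L_two_nil (c ht wt : K) : act c ht wt (.L 2) (ket []) = 0 := by
  simp [act_L_nil]

@[simp]
theorem act_L_three_nil (c ht wt : K) : act c ht wt (.L 3) (ket []) = 0 := by
  simp [act_L_nil]

@[simp]
theorem act_W_one_nil (c ht wt : K) : act c ht wt (.W 1) (ket []) = 0 := by
  simp [act_W_nil]

@[simp]
theorem act_W_two_nil (c ht wt : K) : act c ht wt (.W 2) (ket []) = 0 := by
  simp [act_W_nil]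

@[simp]
theorem act_W_three_nil (c ht wt : K) : act c ht wt (.W 3) (ket []) = 0 := by
  simp [act_W_nil]

variable [CharZero K] (c H : K)

local notation "κ" => kappa c

-- From here on, the first mode in a name has the written index, and the modes after it are the
-- letters of the word, written with the sign dropped: `act_W1_L2_W1` is `W₁` on `L₋₂ W₋₁`. Each
-- entry peels off one letter by a commutation relation and leaves the rest to earlier entries. The
-- entries for `lamAct` enumerate the finite range of `b` outside which the normally ordered product
-- annihilates the word.
@[simp]
theorem lamAct_0_nil :
    lamAct c H 0 0 [] = (H ^ 2 + 1 / 5 * H) • ket [] := by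
  rw [lamAct, show Finset.Icc (0 - level []) (level []) = {0} by decide]
  norm_num [gam, show Even (0 : ℤ) by decide]
  module

@[simp]
theorem act_W1_W1 :
    act c H 0 (.W 1) (ket [.W (-1)]) = (144 * κ * H ^ 2 + 144 / 5 * κ * H - 9 / 10 * H) • ket [] := by
  rw [act_W_W _ _ _ (by norm_num)]
  norm_num
  module

@[simp]
theorem act_W1_L1 :
    act c H 0 (.W 1) (ket [.L (-1)]) = 0 := by
  rw [act_W_L _ _ _ (by norm_num)]
  norm_num

@[simp]
theorem act_L1_W1 :
    act c H 0 (.L 1) (ket [.W (-1)]) = 0 := by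
  rw [act_L_W _ _ _ (by norm_num)]
  norm_num

@[simp]
theorem act_L1_L1 :
    act c H 0 (.L 1) (ket [.L (-1)]) = (2 * H) • ket [] := by
  rw [act_L_L _ _ _ (by norm_num)]
  norm_num
  module

@[simp]
theorem lamAct_neg1_nil :
    lamAct c H 0 (-1) [] = (2 * H + 2 / 5) • ket [.L (-1)] := by
  rw [lamAct, show Finset.Icc ((-1) - level []) (level []) = {-1, 0} by decide]
  norm_num [gam, show ¬ Even (-1 : ℤ) by decide]
  module

@[simp]
theorem act_W0_W1 :
    act c H 0 (.W 0) (ket [.W (-1)]) = (144 * κ * H + 144 / 5 * κ - 9 / 10) • ket [.L (-1)] := by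
  rw [act_W_W _ _ _ (by norm_num)]
  norm_num
  module

@[simp]
theorem act_L0_W1 :
    act c H 0 (.L 0) (ket [.W (-1)]) = (H + 1) • ket [.W (-1)] := by
  rw [act_L_W _ _ _ (by norm_num)]
  norm_num
  module

@[simp]
theorem lamAct_0_W1 :
    lamAct c H 0 0 [.W (-1)] = (H ^ 2 + 11 / 5 * H + 6 / 5) • ket [.W (-1)] := by
  rw [lamAct, show Finset.Icc (0 - level [.W (-1)]) (level [.W (-1)]) = {-1, 0, 1} by decide]
  norm_num [gam, show Even (0 : ℤ) by decide]
  module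

@[simp]
theorem act_W1_W1_W1 :
    act c H 0 (.W 1) (ket [.W (-1), .W (-1)]) = (288 * κ * H ^ 2 + 1728 / 5 * κ * H + 864 / 5 * κ
      - 9 / 5 * H - 9 / 10) • ket [.W (-1)] := by
  rw [act_W_W _ _ _ (by norm_num)]
  norm_num
  module

@[simp]
theorem act_W1_W2 :
    act c H 0 (.W 1) (ket [.W (-2)]) = (432 * κ * H + 432 / 5 * κ + 9 / 5) • ket [.L (-1)] := by
  rw [act_W_W _ _ _ (by norm_num)]
  norm_num
  module

@[simp]
theorem act_W1_L1_W1 :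
    act c H 0 (.W 1) (ket [.L (-1), .W (-1)]) = (144 * κ * H ^ 2 + 2304 / 5 * κ * H + 432 / 5 * κ
      - 9 / 10 * H - 27 / 10) • ket [.L (-1)] := by
  rw [act_W_L _ _ _ (by norm_num)]
  norm_num
  module

@[simp]
theorem act_W0_L1 :
    act c H 0 (.W 0) (ket [.L (-1)]) = (2) • ket [.W (-1)] := by
  rw [act_W_L _ _ _ (by norm_num)]
  norm_num
  module

@[simp]
theorem act_W1_L1_L1 :
    act c H 0 (.W 1) (ket [.L (-1), .L (-1)]) = (6) • ket [.W (-1)] := by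
  rw [act_W_L _ _ _ (by norm_num)]
  norm_num
  module

@[simp]
theorem act_W1_L2 :
    act c H 0 (.W 1) (ket [.L (-2)]) = (5) • ket [.W (-1)] := by
  rw [act_W_L _ _ _ (by norm_num)]
  norm_num
  module

@[simp]
theorem lamAct_1_nil :
    lamAct c H 0 1 [] = 0 := by
  rw [lamAct, show Finset.Icc (1 - level []) (level []) = {} by decide]
  norm_num [gam, show ¬ Even (1 : ℤ) by decide]

@[simp]
theorem act_W2_W1 :
    act c H 0 (.W 2) (ket [.W (-1)]) = 0 := by
  rw [act_W_W _ _ _ (by norm_num)]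
  norm_num

@[simp]
theorem lamAct_1_W1 :
    lamAct c H 0 1 [.W (-1)] = 0 := by
  rw [lamAct, show Finset.Icc (1 - level [.W (-1)]) (level [.W (-1)]) = {0, 1} by decide]
  norm_num [gam, show ¬ Even (1 : ℤ) by decide]

@[simp]
theorem act_W2_W1_W1 :
    act c H 0 (.W 2) (ket [.W (-1), .W (-1)]) = 0 := by
  rw [act_W_W _ _ _ (by norm_num)]
  norm_num

@[simp]
theorem act_W2_W2 :
    act c H 0 (.W 2) (ket [.W (-2)]) = (288 * κ * H ^ 2 + 288 / 5 * κ * H + 36 / 5 * H) • ket [] := by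
  rw [act_W_W _ _ _ (by norm_num)]
  norm_num
  module

@[simp]
theorem act_W2_L1_W1 :
    act c H 0 (.W 2) (ket [.L (-1), .W (-1)]) = (576 * κ * H ^ 2 + 576 / 5 * κ * H - 18 / 5 * H) •
      ket [] := by
  rw [act_W_L _ _ _ (by norm_num)]
  norm_num
  module

@[simp]
theorem act_W2_L1 :
    act c H 0 (.W 2) (ket [.L (-1)]) = 0 := by
  rw [act_W_L _ _ _ (by norm_num)]
  norm_num

@[simp]
theorem act_W2_L1_L1 :
    act c H 0 (.W 2) (ket [.L (-1), .L (-1)]) = 0 := by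
  rw [act_W_L _ _ _ (by norm_num)]
  norm_num

@[simp]
theorem act_W2_L2 :
    act c H 0 (.W 2) (ket [.L (-2)]) = 0 := by
  rw [act_W_L _ _ _ (by norm_num)]
  norm_num

@[simp]
theorem act_L1_W1_W1 :
    act c H 0 (.L 1) (ket [.W (-1), .W (-1)]) = (432 * κ * H + 432 / 5 * κ - 27 / 10) • ket [.L
      (-1)] := by
  rw [act_L_W _ _ _ (by norm_num)]
  norm_num
  module

@[simp]
theorem act_L1_W2 :
    act c H 0 (.L 1) (ket [.W (-2)]) = (4) • ket [.W (-1)] := by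
  rw [act_L_W _ _ _ (by norm_num)]
  norm_num
  module

@[simp]
theorem act_L1_L1_W1 :
    act c H 0 (.L 1) (ket [.L (-1), .W (-1)]) = (2 * H + 2) • ket [.W (-1)] := by
  rw [act_L_L _ _ _ (by norm_num)]
  norm_num
  module

@[simp]
theorem act_L0_L1 :
    act c H 0 (.L 0) (ket [.L (-1)]) = (H + 1) • ket [.L (-1)] := by
  rw [act_L_L _ _ _ (by norm_num)]
  norm_num
  module

@[simp]
theorem act_L1_L1_L1 :
    act c H 0 (.L 1) (ket [.L (-1), .L (-1)]) = (4 * H + 2) • ket [.L (-1)] := by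
  rw [act_L_L _ _ _ (by norm_num)]
  norm_num
  module

@[simp]
theorem act_L1_L2 :
    act c H 0 (.L 1) (ket [.L (-2)]) = (3) • ket [.L (-1)] := by
  rw [act_L_L _ _ _ (by norm_num)]
  norm_num
  module

@[simp]
theorem act_L2_W1 :
    act c H 0 (.L 2) (ket [.W (-1)]) = 0 := by
  rw [act_L_W _ _ _ (by norm_num)]
  norm_num

@[simp]
theorem act_L2_W1_W1 :
    act c H 0 (.L 2) (ket [.W (-1), .W (-1)]) = (720 * κ * H ^ 2 + 144 * κ * H - 9 / 2 * H) • ket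
      [] := by
  rw [act_L_W _ _ _ (by norm_num)]
  norm_num
  module

@[simp]
theorem act_L2_W2 :
    act c H 0 (.L 2) (ket [.W (-2)]) = 0 := by
  rw [act_L_W _ _ _ (by norm_num)]
  norm_num

@[simp]
theorem act_L2_L1_W1 :
    act c H 0 (.L 2) (ket [.L (-1), .W (-1)]) = 0 := by
  rw [act_L_L _ _ _ (by norm_num)]
  norm_num

@[simp]
theorem act_L2_L1 :
    act c H 0 (.L 2) (ket [.L (-1)]) = 0 := by
  rw [act_L_L _ _ _ (by norm_num)]
  norm_num

@[simp]
theorem act_L2_L1_L1 :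
    act c H 0 (.L 2) (ket [.L (-1), .L (-1)]) = (6 * H) • ket [] := by
  rw [act_L_L _ _ _ (by norm_num)]
  norm_num
  module

@[simp]
theorem act_L2_L2 :
    act c H 0 (.L 2) (ket [.L (-2)]) = (1 / 2 * c + 4 * H) • ket [] := by
  rw [act_L_L _ _ _ (by norm_num)]
  norm_num
  module

@[simp]
theorem lamAct_neg1_W1 :
    lamAct c H 0 (-1) [.W (-1)] = (2 * H + 12 / 5) • ket [.L (-1), .W (-1)] := by
  rw [lamAct, show Finset.Icc ((-1) - level [.W (-1)]) (level [.W (-1)]) = {-2, -1, 0, 1} by decide]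
  norm_num [gam, show ¬ Even (-1 : ℤ) by decide]
  module

@[simp]
theorem act_W0_W1_W1 :
    act c H 0 (.W 0) (ket [.W (-1), .W (-1)]) = (144 * κ * H + 144 / 5 * κ - 9 / 10) • ket [.W
      (-1), .L (-1)] + (144 * κ * H + 864 / 5 * κ - 9 / 10) • ket [.L (-1), .W (-1)] := by
  rw [act_W_W _ _ _ (by norm_num)]
  norm_num
  module

@[simp]
theorem act_L0_W1_W1 :
    act c H 0 (.L 0) (ket [.W (-1), .W (-1)]) = (H + 2) • ket [.W (-1), .W (-1)] := by
  rw [act_L_W _ _ _ (by norm_num)]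
  norm_num
  module

@[simp]
theorem lamAct_0_W1_W1 :
    lamAct c H 0 0 [.W (-1), .W (-1)] = (H ^ 2 + 21 / 5 * H + 22 / 5) • ket [.W (-1), .W (-1)] +
      (1440 * κ * H ^ 2 + 288 * κ * H - 9 * H) • ket [.L (-2)] + (864 * κ * H + 864 / 5 * κ - 27 /
      5) • ket [.L (-1), .L (-1)] := by
  rw [lamAct, show Finset.Icc (0 - level [.W (-1), .W (-1)]) (level [.W (-1), .W (-1)]) = {-2, -1, 0, 1, 2} by decide]
  norm_num [gam, show Even (0 : ℤ) by decide]
  module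

@[simp]
theorem act_W1_W1_W1_W1 :
    act c H 0 (.W 1) (ket [.W (-1), .W (-1), .W (-1)]) = (432 * κ * H ^ 2 + 4752 / 5 * κ * H +
      4032 / 5 * κ - 27 / 10 * H - 27 / 10) • ket [.W (-1), .W (-1)] + (207360 * κ ^ 2 * H ^ 2 +
      41472 * κ ^ 2 * H - 1296 * κ * H) • ket [.L (-2)] + (124416 * κ ^ 2 * H + 124416 / 5 * κ ^ 2
      - 3888 / 5 * κ) • ket [.L (-1), .L (-1)] := by
  rw [act_W_W _ _ _ (by norm_num)]
  norm_num
  module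

@[simp]
theorem act_W1_W2_W1 :
    act c H 0 (.W 1) (ket [.W (-2), .W (-1)]) = (144 * κ * H ^ 2 + 144 / 5 * κ * H - 9 / 10 * H) •
      ket [.W (-2)] + (432 * κ * H + 2592 / 5 * κ + 9 / 5) • ket [.L (-1), .W (-1)] := by
  rw [act_W_W _ _ _ (by norm_num)]
  norm_num
  module

@[simp]
theorem lamAct_neg2_nil :
    lamAct c H 0 (-2) [] = (2 * H) • ket [.L (-2)] + (1) • ket [.L (-1), .L (-1)] := by
  rw [lamAct, show Finset.Icc ((-2) - level []) (level []) = {-2, -1, 0} by decide]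
  norm_num [gam, show Even (-2 : ℤ) by decide]
  module

@[simp]
theorem act_W1_W3 :
    act c H 0 (.W 1) (ket [.W (-3)]) = (576 * κ * H + 9) • ket [.L (-2)] + (288 * κ) • ket [.L
      (-1), .L (-1)] := by
  rw [act_W_W _ _ _ (by norm_num)]
  norm_num
  module

@[simp]
theorem act_W1_L1_W1_W1 :
    act c H 0 (.W 1) (ket [.L (-1), .W (-1), .W (-1)]) = (288 * κ * H ^ 2 + 3888 / 5 * κ * H +
      3456 / 5 * κ - 9 / 5 * H - 18 / 5) • ket [.L (-1), .W (-1)] + (432 * κ * H + 432 / 5 * κ -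
      27 / 10) • ket [.W (-1), .L (-1)] := by
  rw [act_W_L _ _ _ (by norm_num)]
  norm_num
  module

@[simp]
theorem lamAct_0_L1 :
    lamAct c H 0 0 [.L (-1)] = (H ^ 2 + 31 / 5 * H + 6 / 5) • ket [.L (-1)] := by
  rw [lamAct, show Finset.Icc (0 - level [.L (-1)]) (level [.L (-1)]) = {-1, 0, 1} by decide]
  norm_num [gam, show Even (0 : ℤ) by decide]
  module

@[simp]
theorem act_W1_W1_L1 :
    act c H 0 (.W 1) (ket [.W (-1), .L (-1)]) = (144 * κ * H ^ 2 + 4464 / 5 * κ * H + 864 / 5 * κ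
      - 9 / 10 * H - 9 / 10) • ket [.L (-1)] := by
  rw [act_W_W _ _ _ (by norm_num)]
  norm_num
  module

@[simp]
theorem act_W0_W2 :
    act c H 0 (.W 0) (ket [.W (-2)]) = (288 * κ * H) • ket [.L (-2)] + (144 * κ) • ket [.L (-1),
      .L (-1)] := by
  rw [act_W_W _ _ _ (by norm_num)]
  norm_num
  module

@[simp]
theorem act_W1_L1_W2 :
    act c H 0 (.W 1) (ket [.L (-1), .W (-2)]) = (432 * κ * H + 2592 / 5 * κ + 9 / 5) • ket [.L
      (-1), .L (-1)] + (864 * κ * H) • ket [.L (-2)] := by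
  rw [act_W_L _ _ _ (by norm_num)]
  norm_num
  module

@[simp]
theorem act_W0_L1_W1 :
    act c H 0 (.W 0) (ket [.L (-1), .W (-1)]) = (144 * κ * H + 144 / 5 * κ - 9 / 10) • ket [.L
      (-1), .L (-1)] + (2) • ket [.W (-1), .W (-1)] := by
  rw [act_W_L _ _ _ (by norm_num)]
  norm_num
  module

@[simp]
theorem act_W1_L1_L1_W1 :
    act c H 0 (.W 1) (ket [.L (-1), .L (-1), .W (-1)]) = (144 * κ * H ^ 2 + 4464 / 5 * κ * H + 864
      / 5 * κ - 9 / 10 * H - 27 / 5) • ket [.L (-1), .L (-1)] + (6) • ket [.W (-1), .W (-1)] := by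
  rw [act_W_L _ _ _ (by norm_num)]
  norm_num
  module

@[simp]
theorem act_W1_L2_W1 :
    act c H 0 (.W 1) (ket [.L (-2), .W (-1)]) = (144 * κ * H ^ 2 + 144 / 5 * κ * H - 9 / 10 * H) •
      ket [.L (-2)] + (5) • ket [.W (-1), .W (-1)] := by
  rw [act_W_L _ _ _ (by norm_num)]
  norm_num
  module

@[simp]
theorem act_W0_L1_L1 :
    act c H 0 (.W 0) (ket [.L (-1), .L (-1)]) = (2) • ket [.L (-1), .W (-1)] + (2) • ket [.W (-1),
      .L (-1)] := by
  rw [act_W_L _ _ _ (by norm_num)]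
  norm_num
  module

@[simp]
theorem act_W1_L1_L1_L1 :
    act c H 0 (.W 1) (ket [.L (-1), .L (-1), .L (-1)]) = (12) • ket [.L (-1), .W (-1)] + (6) • ket
      [.W (-1), .L (-1)] := by
  rw [act_W_L _ _ _ (by norm_num)]
  norm_num
  module

@[simp]
theorem act_W1_L2_L1 :
    act c H 0 (.W 1) (ket [.L (-2), .L (-1)]) = (5) • ket [.W (-1), .L (-1)] := by
  rw [act_W_L _ _ _ (by norm_num)]
  norm_num
  module

@[simp]
theorem act_W1_L3 :
    act c H 0 (.W 1) (ket [.L (-3)]) = (7) • ket [.W (-2)] := by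
  rw [act_W_L _ _ _ (by norm_num)]
  norm_num
  module

@[simp]
theorem lamAct_1_W1_W1 :
    lamAct c H 0 1 [.W (-1), .W (-1)] = (2304 * κ * H ^ 2 + 7488 / 5 * κ * H + 5184 / 25 * κ - 72
      / 5 * H - 162 / 25) • ket [.L (-1)] := by
  rw [lamAct, show Finset.Icc (1 - level [.W (-1), .W (-1)]) (level [.W (-1), .W (-1)]) = {-1, 0, 1, 2} by decide]
  norm_num [gam, show ¬ Even (1 : ℤ) by decide]
  module

@[simp]
theorem act_W2_W1_W1_W1 :
    act c H 0 (.W 2) (ket [.W (-1), .W (-1), .W (-1)]) = (497664 * κ ^ 2 * H ^ 2 + 1617408 / 5 * κ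
      ^ 2 * H + 1119744 / 25 * κ ^ 2 - 11664 / 5 * κ * H - 31104 / 25 * κ - 243 / 50) • ket [.L
      (-1)] := by
  rw [act_W_W _ _ _ (by norm_num)]
  norm_num
  module

@[simp]
theorem act_W2_W2_W1 :
    act c H 0 (.W 2) (ket [.W (-2), .W (-1)]) = (288 * κ * H ^ 2 + 3168 / 5 * κ * H + 1728 / 5 * κ
      + 36 / 5 * H + 36 / 5) • ket [.W (-1)] := by
  rw [act_W_W _ _ _ (by norm_num)]
  norm_num
  module

@[simp]
theorem act_W2_W3 :
    act c H 0 (.W 2) (ket [.W (-3)]) = (720 * κ * H + 144 * κ + 18) • ket [.L (-1)] := by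
  rw [act_W_W _ _ _ (by norm_num)]
  norm_num
  module

@[simp]
theorem act_W2_L1_W1_W1 :
    act c H 0 (.W 2) (ket [.L (-1), .W (-1), .W (-1)]) = (1152 * κ * H ^ 2 + 6912 / 5 * κ * H +
      3456 / 5 * κ - 36 / 5 * H - 18 / 5) • ket [.W (-1)] := by
  rw [act_W_L _ _ _ (by norm_num)]
  norm_num
  module

@[simp]
theorem act_W2_L1_W2 :
    act c H 0 (.W 2) (ket [.L (-1), .W (-2)]) = (288 * κ * H ^ 2 + 8928 / 5 * κ * H + 1728 / 5 * κ
      + 36 / 5 * H + 36 / 5) • ket [.L (-1)] := by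
  rw [act_W_L _ _ _ (by norm_num)]
  norm_num
  module

@[simp]
theorem act_W2_L1_L1_W1 :
    act c H 0 (.W 2) (ket [.L (-1), .L (-1), .W (-1)]) = (1152 * κ * H ^ 2 + 9792 / 5 * κ * H +
      1728 / 5 * κ - 36 / 5 * H - 54 / 5) • ket [.L (-1)] := by
  rw [act_W_L _ _ _ (by norm_num)]
  norm_num
  module

@[simp]
theorem act_W2_L2_W1 :
    act c H 0 (.W 2) (ket [.L (-2), .W (-1)]) = (864 * κ * H + 864 / 5 * κ - 27 / 5) • ket [.L
      (-1)] := by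
  rw [act_W_L _ _ _ (by norm_num)]
  norm_num
  module

@[simp]
theorem act_W2_L1_L1_L1 :
    act c H 0 (.W 2) (ket [.L (-1), .L (-1), .L (-1)]) = (24) • ket [.W (-1)] := by
  rw [act_W_L _ _ _ (by norm_num)]
  norm_num
  module

@[simp]
theorem act_W2_L2_L1 :
    act c H 0 (.W 2) (ket [.L (-2), .L (-1)]) = (12) • ket [.W (-1)] := by
  rw [act_W_L _ _ _ (by norm_num)]
  norm_num
  module

@[simp]
theorem act_W2_L3 :
    act c H 0 (.W 2) (ket [.L (-3)]) = (8) • ket [.W (-1)] := by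
  rw [act_W_L _ _ _ (by norm_num)]
  norm_num
  module

@[simp]
theorem lamAct_2_nil :
    lamAct c H 0 2 [] = 0 := by
  rw [lamAct, show Finset.Icc (2 - level []) (level []) = {} by decide]
  norm_num [gam, show Even (2 : ℤ) by decide]

@[simp]
theorem act_W3_W1 :
    act c H 0 (.W 3) (ket [.W (-1)]) = 0 := by
  rw [act_W_W _ _ _ (by norm_num)]
  norm_num

@[simp]
theorem lamAct_2_W1 :
    lamAct c H 0 2 [.W (-1)] = 0 := by
  rw [lamAct, show Finset.Icc (2 - level [.W (-1)]) (level [.W (-1)]) = {1} by decide]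
  norm_num [gam, show Even (2 : ℤ) by decide]

@[simp]
theorem act_W3_W1_W1 :
    act c H 0 (.W 3) (ket [.W (-1), .W (-1)]) = 0 := by
  rw [act_W_W _ _ _ (by norm_num)]
  norm_num

@[simp]
theorem lamAct_2_W1_W1 :
    lamAct c H 0 2 [.W (-1), .W (-1)] = (1440 * κ * H ^ 3 + 1152 * κ * H ^ 2 + 864 / 5 * κ * H - 9
      * H ^ 2 - 27 / 5 * H) • ket [] := by
  rw [lamAct, show Finset.Icc (2 - level [.W (-1), .W (-1)]) (level [.W (-1), .W (-1)]) = {0, 1, 2} by decide]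
  norm_num [gam, show Even (2 : ℤ) by decide]
  module

@[simp]
theorem act_W3_W1_W1_W1 :
    act c H 0 (.W 3) (ket [.W (-1), .W (-1), .W (-1)]) = (414720 * κ ^ 2 * H ^ 3 + 331776 * κ ^ 2
      * H ^ 2 + 248832 / 5 * κ ^ 2 * H + 3888 * κ * H ^ 2 - 1296 / 5 * κ * H - 81 / 2 * H) • ket
      [] := by
  rw [act_W_W _ _ _ (by norm_num)]
  norm_num
  module

@[simp]
theorem act_W3_W2_W1 :
    act c H 0 (.W 3) (ket [.W (-2), .W (-1)]) = 0 := by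
  rw [act_W_W _ _ _ (by norm_num)]
  norm_num

@[simp]
theorem act_W3_W3 :
    act c H 0 (.W 3) (ket [.W (-3)]) = (3 / 2 * c + 432 * κ * H ^ 2 + 432 / 5 * κ * H + 333 / 10 *
      H) • ket [] := by
  rw [act_W_W _ _ _ (by norm_num)]
  norm_num
  module

@[simp]
theorem act_W3_L1_W1_W1 :
    act c H 0 (.W 3) (ket [.L (-1), .W (-1), .W (-1)]) = 0 := by
  rw [act_W_L _ _ _ (by norm_num)]
  norm_num

@[simp]
theorem act_W3_W2 :
    act c H 0 (.W 3) (ket [.W (-2)]) = 0 := by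
  rw [act_W_W _ _ _ (by norm_num)]
  norm_num

@[simp]
theorem act_W3_L1_W2 :
    act c H 0 (.W 3) (ket [.L (-1), .W (-2)]) = (1440 * κ * H ^ 2 + 288 * κ * H + 36 * H) • ket [] := by
  rw [act_W_L _ _ _ (by norm_num)]
  norm_num
  module

@[simp]
theorem act_W3_L1_W1 :
    act c H 0 (.W 3) (ket [.L (-1), .W (-1)]) = 0 := by
  rw [act_W_L _ _ _ (by norm_num)]
  norm_num

@[simp]
theorem act_W3_L1_L1_W1 :
    act c H 0 (.W 3) (ket [.L (-1), .L (-1), .W (-1)]) = (2880 * κ * H ^ 2 + 576 * κ * H - 18 * H)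
      • ket [] := by
  rw [act_W_L _ _ _ (by norm_num)]
  norm_num
  module

@[simp]
theorem act_W3_L2_W1 :
    act c H 0 (.W 3) (ket [.L (-2), .W (-1)]) = (1008 * κ * H ^ 2 + 1008 / 5 * κ * H - 63 / 10 *
      H) • ket [] := by
  rw [act_W_L _ _ _ (by norm_num)]
  norm_num
  module

@[simp]
theorem act_W3_L1 :
    act c H 0 (.W 3) (ket [.L (-1)]) = 0 := by
  rw [act_W_L _ _ _ (by norm_num)]
  norm_num

@[simp]
theorem act_W3_L1_L1 :
    act c H 0 (.W 3) (ket [.L (-1), .L (-1)]) = 0 := by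
  rw [act_W_L _ _ _ (by norm_num)]
  norm_num

@[simp]
theorem act_W3_L1_L1_L1 :
    act c H 0 (.W 3) (ket [.L (-1), .L (-1), .L (-1)]) = 0 := by
  rw [act_W_L _ _ _ (by norm_num)]
  norm_num

@[simp]
theorem act_W3_L2_L1 :
    act c H 0 (.W 3) (ket [.L (-2), .L (-1)]) = 0 := by
  rw [act_W_L _ _ _ (by norm_num)]
  norm_num

@[simp]
theorem act_W3_L3 :
    act c H 0 (.W 3) (ket [.L (-3)]) = 0 := by
  rw [act_W_L _ _ _ (by norm_num)]
  norm_num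

@[simp]
theorem act_L1_W1_W1_W1 :
    act c H 0 (.L 1) (ket [.W (-1), .W (-1), .W (-1)]) = (864 * κ * H + 864 / 5 * κ - 27 / 5) •
      ket [.W (-1), .L (-1)] + (432 * κ * H + 2592 / 5 * κ - 27 / 10) • ket [.L (-1), .W (-1)] := by
  rw [act_L_W _ _ _ (by norm_num)]
  norm_num
  module

@[simp]
theorem act_L1_W2_W1 :
    act c H 0 (.L 1) (ket [.W (-2), .W (-1)]) = (4) • ket [.W (-1), .W (-1)] := by
  rw [act_L_W _ _ _ (by norm_num)]
  norm_num
  module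

@[simp]
theorem act_L1_W3 :
    act c H 0 (.L 1) (ket [.W (-3)]) = (5) • ket [.W (-2)] := by
  rw [act_L_W _ _ _ (by norm_num)]
  norm_num
  module

@[simp]
theorem act_L1_L1_W1_W1 :
    act c H 0 (.L 1) (ket [.L (-1), .W (-1), .W (-1)]) = (432 * κ * H + 432 / 5 * κ - 27 / 10) •
      ket [.L (-1), .L (-1)] + (2 * H + 4) • ket [.W (-1), .W (-1)] := by
  rw [act_L_L _ _ _ (by norm_num)]
  norm_num
  module

@[simp]
theorem act_L0_W2 :
    act c H 0 (.L 0) (ket [.W (-2)]) = (H + 2) • ket [.W (-2)] := by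
  rw [act_L_W _ _ _ (by norm_num)]
  norm_num
  module

@[simp]
theorem act_L1_L1_W2 :
    act c H 0 (.L 1) (ket [.L (-1), .W (-2)]) = (4) • ket [.L (-1), .W (-1)] + (2 * H + 4) • ket
      [.W (-2)] := by
  rw [act_L_L _ _ _ (by norm_num)]
  norm_num
  module

@[simp]
theorem act_L0_L1_W1 :
    act c H 0 (.L 0) (ket [.L (-1), .W (-1)]) = (H + 2) • ket [.L (-1), .W (-1)] := by
  rw [act_L_L _ _ _ (by norm_num)]
  norm_num
  module

@[simp]
theorem act_L1_L1_L1_W1 :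
    act c H 0 (.L 1) (ket [.L (-1), .L (-1), .W (-1)]) = (4 * H + 6) • ket [.L (-1), .W (-1)] := by
  rw [act_L_L _ _ _ (by norm_num)]
  norm_num
  module

@[simp]
theorem act_L1_L2_W1 :
    act c H 0 (.L 1) (ket [.L (-2), .W (-1)]) = (3) • ket [.L (-1), .W (-1)] := by
  rw [act_L_L _ _ _ (by norm_num)]
  norm_num
  module

@[simp]
theorem act_L0_L1_L1 :
    act c H 0 (.L 0) (ket [.L (-1), .L (-1)]) = (H + 2) • ket [.L (-1), .L (-1)] := by
  rw [act_L_L _ _ _ (by norm_num)]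
  norm_num
  module

@[simp]
theorem act_L1_L1_L1_L1 :
    act c H 0 (.L 1) (ket [.L (-1), .L (-1), .L (-1)]) = (6 * H + 6) • ket [.L (-1), .L (-1)] := by
  rw [act_L_L _ _ _ (by norm_num)]
  norm_num
  module

@[simp]
theorem act_L1_L2_L1 :
    act c H 0 (.L 1) (ket [.L (-2), .L (-1)]) = (2 * H) • ket [.L (-2)] + (3) • ket [.L (-1), .L
      (-1)] := by
  rw [act_L_L _ _ _ (by norm_num)]
  norm_num
  module

@[simp]
theorem act_L1_L3 :
    act c H 0 (.L 1) (ket [.L (-3)]) = (4) • ket [.L (-2)] := by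
  rw [act_L_L _ _ _ (by norm_num)]
  norm_num
  module

@[simp]
theorem lamAct_1_L1 :
    lamAct c H 0 1 [.L (-1)] = (4 * H ^ 2 + 4 / 5 * H) • ket [] := by
  rw [lamAct, show Finset.Icc (1 - level [.L (-1)]) (level [.L (-1)]) = {0, 1} by decide]
  norm_num [gam, show ¬ Even (1 : ℤ) by decide]
  module

@[simp]
theorem act_W2_W1_L1 :
    act c H 0 (.W 2) (ket [.W (-1), .L (-1)]) = (864 * κ * H ^ 2 + 864 / 5 * κ * H + 18 / 5 * H) •
      ket [] := by
  rw [act_W_W _ _ _ (by norm_num)]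
  norm_num
  module

@[simp]
theorem act_L1_W1_L1 :
    act c H 0 (.L 1) (ket [.W (-1), .L (-1)]) = (2 * H + 6) • ket [.W (-1)] := by
  rw [act_L_W _ _ _ (by norm_num)]
  norm_num
  module

@[simp]
theorem act_L2_W1_W1_W1 :
    act c H 0 (.L 2) (ket [.W (-1), .W (-1), .W (-1)]) = (2160 * κ * H ^ 2 + 1872 * κ * H + 864 *
      κ - 27 / 2 * H - 9 / 2) • ket [.W (-1)] := by
  rw [act_L_W _ _ _ (by norm_num)]
  norm_num
  module

@[simp]
theorem act_L2_W2_W1 :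
    act c H 0 (.L 2) (ket [.W (-2), .W (-1)]) = (864 * κ * H + 864 / 5 * κ - 27 / 5) • ket [.L
      (-1)] := by
  rw [act_L_W _ _ _ (by norm_num)]
  norm_num
  module

@[simp]
theorem act_L2_W3 :
    act c H 0 (.L 2) (ket [.W (-3)]) = (7) • ket [.W (-1)] := by
  rw [act_L_W _ _ _ (by norm_num)]
  norm_num
  module

@[simp]
theorem act_L2_L1_W1_W1 :
    act c H 0 (.L 2) (ket [.L (-1), .W (-1), .W (-1)]) = (720 * κ * H ^ 2 + 1440 * κ * H + 1296 /
      5 * κ - 9 / 2 * H - 81 / 10) • ket [.L (-1)] := by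
  rw [act_L_L _ _ _ (by norm_num)]
  norm_num
  module

@[simp]
theorem act_L2_L1_W2 :
    act c H 0 (.L 2) (ket [.L (-1), .W (-2)]) = (12) • ket [.W (-1)] := by
  rw [act_L_L _ _ _ (by norm_num)]
  norm_num
  module

@[simp]
theorem act_L2_L1_L1_W1 :
    act c H 0 (.L 2) (ket [.L (-1), .L (-1), .W (-1)]) = (6 * H + 6) • ket [.W (-1)] := by
  rw [act_L_L _ _ _ (by norm_num)]
  norm_num
  module

@[simp]
theorem act_L2_L2_W1 :
    act c H 0 (.L 2) (ket [.L (-2), .W (-1)]) = (1 / 2 * c + 4 * H + 4) • ket [.W (-1)] := by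
  rw [act_L_L _ _ _ (by norm_num)]
  norm_num
  module

@[simp]
theorem act_L2_L1_L1_L1 :
    act c H 0 (.L 2) (ket [.L (-1), .L (-1), .L (-1)]) = (18 * H + 6) • ket [.L (-1)] := by
  rw [act_L_L _ _ _ (by norm_num)]
  norm_num
  module

@[simp]
theorem act_L2_L2_L1 :
    act c H 0 (.L 2) (ket [.L (-2), .L (-1)]) = (1 / 2 * c + 4 * H + 4) • ket [.L (-1)] := by
  rw [act_L_L _ _ _ (by norm_num)]
  norm_num
  module

@[simp]
theorem act_L2_L3 :
    act c H 0 (.L 2) (ket [.L (-3)]) = (5) • ket [.L (-1)] := by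
  rw [act_L_L _ _ _ (by norm_num)]
  norm_num
  module

@[simp]
theorem act_L3_W1 :
    act c H 0 (.L 3) (ket [.W (-1)]) = 0 := by
  rw [act_L_W _ _ _ (by norm_num)]
  norm_num

@[simp]
theorem act_L3_W1_W1 :
    act c H 0 (.L 3) (ket [.W (-1), .W (-1)]) = 0 := by
  rw [act_L_W _ _ _ (by norm_num)]
  norm_num

@[simp]
theorem act_L3_W1_W1_W1 :
    act c H 0 (.L 3) (ket [.W (-1), .W (-1), .W (-1)]) = 0 := by
  rw [act_L_W _ _ _ (by norm_num)]
  norm_num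

@[simp]
theorem act_L3_W2_W1 :
    act c H 0 (.L 3) (ket [.W (-2), .W (-1)]) = (1152 * κ * H ^ 2 + 1152 / 5 * κ * H - 36 / 5 * H)
      • ket [] := by
  rw [act_L_W _ _ _ (by norm_num)]
  norm_num
  module

@[simp]
theorem act_L3_W3 :
    act c H 0 (.L 3) (ket [.W (-3)]) = 0 := by
  rw [act_L_W _ _ _ (by norm_num)]
  norm_num

@[simp]
theorem act_L3_L1_W1_W1 :
    act c H 0 (.L 3) (ket [.L (-1), .W (-1), .W (-1)]) = (2880 * κ * H ^ 2 + 576 * κ * H - 18 * H)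
      • ket [] := by
  rw [act_L_L _ _ _ (by norm_num)]
  norm_num
  module

@[simp]
theorem act_L3_W2 :
    act c H 0 (.L 3) (ket [.W (-2)]) = 0 := by
  rw [act_L_W _ _ _ (by norm_num)]
  norm_num

@[simp]
theorem act_L3_L1_W2 :
    act c H 0 (.L 3) (ket [.L (-1), .W (-2)]) = 0 := by
  rw [act_L_L _ _ _ (by norm_num)]
  norm_num

@[simp]
theorem act_L3_L1_W1 :
    act c H 0 (.L 3) (ket [.L (-1), .W (-1)]) = 0 := by
  rw [act_L_L _ _ _ (by norm_num)]
  norm_num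

@[simp]
theorem act_L3_L1_L1_W1 :
    act c H 0 (.L 3) (ket [.L (-1), .L (-1), .W (-1)]) = 0 := by
  rw [act_L_L _ _ _ (by norm_num)]
  norm_num

@[simp]
theorem act_L3_L2_W1 :
    act c H 0 (.L 3) (ket [.L (-2), .W (-1)]) = 0 := by
  rw [act_L_L _ _ _ (by norm_num)]
  norm_num

@[simp]
theorem act_L3_L1 :
    act c H 0 (.L 3) (ket [.L (-1)]) = 0 := by
  rw [act_L_L _ _ _ (by norm_num)]
  norm_num

@[simp]
theorem act_L3_L1_L1 :
    act c H 0 (.L 3) (ket [.L (-1), .L (-1)]) = 0 := by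
  rw [act_L_L _ _ _ (by norm_num)]
  norm_num

@[simp]
theorem act_L3_L1_L1_L1 :
    act c H 0 (.L 3) (ket [.L (-1), .L (-1), .L (-1)]) = (24 * H) • ket [] := by
  rw [act_L_L _ _ _ (by norm_num)]
  norm_num
  module

@[simp]
theorem act_L3_L2_L1 :
    act c H 0 (.L 3) (ket [.L (-2), .L (-1)]) = (10 * H) • ket [] := by
  rw [act_L_L _ _ _ (by norm_num)]
  norm_num
  module

@[simp]
theorem act_L3_L3 :
    act c H 0 (.L 3) (ket [.L (-3)]) = (2 * c + 6 * H) • ket [] := by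
  rw [act_L_L _ _ _ (by norm_num)]
  norm_num
  module

end Table

/-! ### Gram matrices and three-point matrix elements up to level three. -/

section Elements

set_option linter.unusedSectionVars false
set_option linter.unnecessarySeqFocus false
set_option linter.unreachableTactic false
set_option linter.unusedTactic false

variable {K : Type*} [Field K] [CharZero K] (c H h u : K)

local notation "κ" => kappa c

theorem level_toNat_of {Y : Word} {n : ℕ} (hY : level Y = n) : (level Y).toNat = n := by
  simp [hY]

@[simp]
theorem ket_nil_apply_nil : (ket [] : Word →₀ K) [] = 1 := by
  simp [ket]

theorem gram_eq (ht wt : K) (Y Y' : Word) :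
    gram c ht wt Y Y' =
      (-1) ^ numW Y * (Y.foldl (fun v X => act c ht wt X.flip v) (ket Y')) [] :=
  rfl

theorem rightAux_L (ht wt h₃ w₃ h₄ w₄ : K) (N : ℕ) (m : ℤ) (Y : Word) :
    rightAux c ht wt h₃ w₃ h₄ w₄ (N + 1) (.L m :: Y) =
      (ht + level Y - m * h₃ - h₄) * rightAux c ht wt h₃ w₃ h₄ w₄ N Y :=
  rfl

theorem rightAux_W (ht wt h₃ w₃ h₄ w₄ : K) (N : ℕ) (m : ℤ) (Y : Word) :
    rightAux c ht wt h₃ w₃ h₄ w₄ (N + 1) (.W m :: Y) =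
      lift (rightAux c ht wt h₃ w₃ h₄ w₄ N) (act c ht wt (.W 0) (ket Y)) +
        (-w₄ + (-m) * (3 * w₃ / (2 * h₃)) * (ht + level Y - h₃ - h₄)
          + ((m : K) ^ 2 - 3 * m) / 2 * w₃) * rightAux c ht wt h₃ w₃ h₄ w₄ N Y :=
  rfl

theorem leftAux_L (ht wt h₁ w₁ h₂ w₂ : K) (N : ℕ) (m : ℤ) (Y : Word) :
    leftAux c ht wt h₁ w₁ h₂ w₂ (N + 1) (.L m :: Y) =
      (ht + level Y - m * h₂ - h₁) * leftAux c ht wt h₁ w₁ h₂ w₂ N Y :=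
  rfl

theorem leftAux_W (ht wt h₁ w₁ h₂ w₂ : K) (N : ℕ) (m : ℤ) (Y : Word) :
    leftAux c ht wt h₁ w₁ h₂ w₂ (N + 1) (.W m :: Y) =
      lift (leftAux c ht wt h₁ w₁ h₂ w₂ N) (act c ht wt (.W 0) (ket Y)) +
        (w₁ + (-m) * (3 * w₂ / (2 * h₂)) * (h₁ - ht - level Y - h₂)
          - ((m : K) ^ 2 + 3 * m) / 2 * w₂) * leftAux c ht wt h₁ w₁ h₂ w₂ N Y :=
  rfl

@[simp]
theorem rightAux_nil (ht wt h₃ w₃ h₄ w₄ : K) (N : ℕ) :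
    rightAux c ht wt h₃ w₃ h₄ w₄ N [] = 1 := by
  cases N <;> rfl

@[simp]
theorem leftAux_nil (ht wt h₁ w₁ h₂ w₂ : K) (N : ℕ) :
    leftAux c ht wt h₁ w₁ h₂ w₂ N [] = 1 := by
  cases N <;> rfl

-- Each of these conjunctions is one row of a Gram matrix, in the order of the basis. The entries
-- between words of different spin-3 parity vanish because `w̃ = 0`; the sign `(-1) ^ numW` comes
-- from `W_n† = -W_{-n}`.
@[simp]
theorem gram_W1 :
    gram c H 0 [.W (-1)] [.W (-1)] = -144 * κ * H ^ 2 - 144 / 5 * κ * H + 9 / 10 * H ∧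
    gram c H 0 [.W (-1)] [.L (-1)] = 0 := by
  refine ⟨?_, ?_⟩ <;>
    norm_num [gram_eq, numW, Mode.flip] <;> ring

@[simp]
theorem gram_L1 :
    gram c H 0 [.L (-1)] [.W (-1)] = 0 ∧
    gram c H 0 [.L (-1)] [.L (-1)] = 2 * H := by
  refine ⟨?_, ?_⟩ <;>
    norm_num [gram_eq, numW, Mode.flip] <;> ring

@[simp]
theorem gram_W1_W1 :
    gram c H 0 [.W (-1), .W (-1)] [.W (-1), .W (-1)] = 41472 * κ ^ 2 * H ^ 4 + 290304 / 5 * κ ^ 2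
      * H ^ 3 + 870912 / 25 * κ ^ 2 * H ^ 2 + 124416 / 25 * κ ^ 2 * H - 2592 / 5 * κ * H ^ 3 -
      12312 / 25 * κ * H ^ 2 - 4536 / 25 * κ * H + 81 / 50 * H ^ 2 + 81 / 100 * H ∧
    gram c H 0 [.W (-1), .W (-1)] [.W (-2)] = 0 ∧
    gram c H 0 [.W (-1), .W (-1)] [.L (-1), .W (-1)] = 0 ∧
    gram c H 0 [.W (-1), .W (-1)] [.L (-1), .L (-1)] = 864 * κ * H ^ 2 + 864 / 5 * κ * H - 27 / 5
      * H ∧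
    gram c H 0 [.W (-1), .W (-1)] [.L (-2)] = 720 * κ * H ^ 2 + 144 * κ * H - 9 / 2 * H := by
  refine ⟨?_, ?_, ?_, ?_, ?_⟩ <;>
    norm_num [gram_eq, numW, Mode.flip] <;> ring

@[simp]
theorem gram_W2 :
    gram c H 0 [.W (-2)] [.W (-1), .W (-1)] = 0 ∧
    gram c H 0 [.W (-2)] [.W (-2)] = -288 * κ * H ^ 2 - 288 / 5 * κ * H - 36 / 5 * H ∧
    gram c H 0 [.W (-2)] [.L (-1), .W (-1)] = -576 * κ * H ^ 2 - 576 / 5 * κ * H + 18 / 5 * H ∧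
    gram c H 0 [.W (-2)] [.L (-1), .L (-1)] = 0 ∧
    gram c H 0 [.W (-2)] [.L (-2)] = 0 := by
  refine ⟨?_, ?_, ?_, ?_, ?_⟩ <;>
    norm_num [gram_eq, numW, Mode.flip] <;> ring

@[simp]
theorem gram_L1_W1 :
    gram c H 0 [.L (-1), .W (-1)] [.W (-1), .W (-1)] = 0 ∧
    gram c H 0 [.L (-1), .W (-1)] [.W (-2)] = -576 * κ * H ^ 2 - 576 / 5 * κ * H + 18 / 5 * H ∧
    gram c H 0 [.L (-1), .W (-1)] [.L (-1), .W (-1)] = -288 * κ * H ^ 3 - 1728 / 5 * κ * H ^ 2 -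
      288 / 5 * κ * H + 9 / 5 * H ^ 2 + 9 / 5 * H ∧
    gram c H 0 [.L (-1), .W (-1)] [.L (-1), .L (-1)] = 0 ∧
    gram c H 0 [.L (-1), .W (-1)] [.L (-2)] = 0 := by
  refine ⟨?_, ?_, ?_, ?_, ?_⟩ <;>
    norm_num [gram_eq, numW, Mode.flip] <;> ring

@[simp]
theorem gram_L1_L1 :
    gram c H 0 [.L (-1), .L (-1)] [.W (-1), .W (-1)] = 864 * κ * H ^ 2 + 864 / 5 * κ * H - 27 / 5
      * H ∧
    gram c H 0 [.L (-1), .L (-1)] [.W (-2)] = 0 ∧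
    gram c H 0 [.L (-1), .L (-1)] [.L (-1), .W (-1)] = 0 ∧
    gram c H 0 [.L (-1), .L (-1)] [.L (-1), .L (-1)] = 8 * H ^ 2 + 4 * H ∧
    gram c H 0 [.L (-1), .L (-1)] [.L (-2)] = 6 * H := by
  refine ⟨?_, ?_, ?_, ?_, ?_⟩ <;>
    norm_num [gram_eq, numW, Mode.flip] <;> ring

@[simp]
theorem gram_L2 :
    gram c H 0 [.L (-2)] [.W (-1), .W (-1)] = 720 * κ * H ^ 2 + 144 * κ * H - 9 / 2 * H ∧
    gram c H 0 [.L (-2)] [.W (-2)] = 0 ∧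
    gram c H 0 [.L (-2)] [.L (-1), .W (-1)] = 0 ∧
    gram c H 0 [.L (-2)] [.L (-1), .L (-1)] = 6 * H ∧
    gram c H 0 [.L (-2)] [.L (-2)] = 1 / 2 * c + 4 * H := by
  refine ⟨?_, ?_, ?_, ?_, ?_⟩ <;>
    norm_num [gram_eq, numW, Mode.flip] <;> ring

@[simp]
theorem gram_W1_W1_W1 :
    gram c H 0 [.W (-1), .W (-1), .W (-1)] [.W (-1), .W (-1), .W (-1)] = -17915904 * κ ^ 3 * H ^ 6
      - 322486272 / 5 * κ ^ 3 * H ^ 5 - 6324314112 / 25 * κ ^ 3 * H ^ 4 - 31161729024 / 125 * κ ^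
      3 * H ^ 3 - 10224009216 / 125 * κ ^ 3 * H ^ 2 - 1039122432 / 125 * κ ^ 3 * H + 1679616 / 5 *
      κ ^ 2 * H ^ 5 + 24354432 / 25 * κ ^ 2 * H ^ 4 + 385191936 / 125 * κ ^ 2 * H ^ 3 + 299251584
      / 125 * κ ^ 2 * H ^ 2 + 53561088 / 125 * κ ^ 2 * H - 52488 / 25 * κ * H ^ 4 - 577368 / 125 *
      κ * H ^ 3 - 1215972 / 125 * κ * H ^ 2 - 667764 / 125 * κ * H + 2187 / 500 * H ^ 3 + 6561 /
      1000 * H ^ 2 + 2187 / 1000 * H ∧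
    gram c H 0 [.W (-1), .W (-1), .W (-1)] [.W (-2), .W (-1)] = 0 ∧
    gram c H 0 [.W (-1), .W (-1), .W (-1)] [.W (-3)] = -414720 * κ ^ 2 * H ^ 3 - 331776 * κ ^ 2 *
      H ^ 2 - 248832 / 5 * κ ^ 2 * H - 3888 * κ * H ^ 2 + 1296 / 5 * κ * H + 81 / 2 * H ∧
    gram c H 0 [.W (-1), .W (-1), .W (-1)] [.L (-1), .W (-1), .W (-1)] = 0 ∧
    gram c H 0 [.W (-1), .W (-1), .W (-1)] [.L (-1), .W (-2)] = -995328 * κ ^ 2 * H ^ 3 - 3234816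
      / 5 * κ ^ 2 * H ^ 2 - 2239488 / 25 * κ ^ 2 * H + 23328 / 5 * κ * H ^ 2 + 62208 / 25 * κ * H
      + 243 / 25 * H ∧
    gram c H 0 [.W (-1), .W (-1), .W (-1)] [.L (-1), .L (-1), .W (-1)] = -373248 * κ ^ 2 * H ^ 4 -
      5723136 / 5 * κ ^ 2 * H ^ 3 - 12814848 / 25 * κ ^ 2 * H ^ 2 - 1492992 / 25 * κ ^ 2 * H +
      23328 / 5 * κ * H ^ 3 + 314928 / 25 * κ * H ^ 2 + 73872 / 25 * κ * H - 729 / 50 * H ^ 2 -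
      1701 / 50 * H ∧
    gram c H 0 [.W (-1), .W (-1), .W (-1)] [.L (-2), .W (-1)] = -311040 * κ ^ 2 * H ^ 4 - 331776 *
      κ ^ 2 * H ^ 3 - 891648 / 5 * κ ^ 2 * H ^ 2 - 124416 / 5 * κ ^ 2 * H + 3888 * κ * H ^ 3 +
      13608 / 5 * κ * H ^ 2 + 4536 / 5 * κ * H - 243 / 20 * H ^ 2 - 81 / 20 * H ∧
    gram c H 0 [.W (-1), .W (-1), .W (-1)] [.L (-1), .L (-1), .L (-1)] = 0 ∧
    gram c H 0 [.W (-1), .W (-1), .W (-1)] [.L (-2), .L (-1)] = 0 ∧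
    gram c H 0 [.W (-1), .W (-1), .W (-1)] [.L (-3)] = 0 := by
  refine ⟨?_, ?_, ?_, ?_, ?_, ?_, ?_, ?_, ?_, ?_⟩ <;>
    norm_num [gram_eq, numW, Mode.flip] <;> ring

@[simp]
theorem gram_W2_W1 :
    gram c H 0 [.W (-2), .W (-1)] [.W (-1), .W (-1), .W (-1)] = 0 ∧
    gram c H 0 [.W (-2), .W (-1)] [.W (-2), .W (-1)] = 41472 * κ ^ 2 * H ^ 4 + 497664 / 5 * κ ^ 2
      * H ^ 3 + 1700352 / 25 * κ ^ 2 * H ^ 2 + 248832 / 25 * κ ^ 2 * H + 3888 / 5 * κ * H ^ 3 +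
      16848 / 25 * κ * H ^ 2 - 2592 / 25 * κ * H - 162 / 25 * H ^ 2 - 162 / 25 * H ∧
    gram c H 0 [.W (-2), .W (-1)] [.W (-3)] = 0 ∧
    gram c H 0 [.W (-2), .W (-1)] [.L (-1), .W (-1), .W (-1)] = 165888 * κ ^ 2 * H ^ 4 + 1161216 /
      5 * κ ^ 2 * H ^ 3 + 3483648 / 25 * κ ^ 2 * H ^ 2 + 497664 / 25 * κ ^ 2 * H - 10368 / 5 * κ *
      H ^ 3 - 49248 / 25 * κ * H ^ 2 - 18144 / 25 * κ * H + 162 / 25 * H ^ 2 + 81 / 25 * H ∧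
    gram c H 0 [.W (-2), .W (-1)] [.L (-1), .W (-2)] = 0 ∧
    gram c H 0 [.W (-2), .W (-1)] [.L (-1), .L (-1), .W (-1)] = 0 ∧
    gram c H 0 [.W (-2), .W (-1)] [.L (-2), .W (-1)] = 0 ∧
    gram c H 0 [.W (-2), .W (-1)] [.L (-1), .L (-1), .L (-1)] = 3456 * κ * H ^ 2 + 3456 / 5 * κ *
      H - 108 / 5 * H ∧
    gram c H 0 [.W (-2), .W (-1)] [.L (-2), .L (-1)] = 1728 * κ * H ^ 2 + 1728 / 5 * κ * H - 54 /
      5 * H ∧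
    gram c H 0 [.W (-2), .W (-1)] [.L (-3)] = 1152 * κ * H ^ 2 + 1152 / 5 * κ * H - 36 / 5 * H := by
  refine ⟨?_, ?_, ?_, ?_, ?_, ?_, ?_, ?_, ?_, ?_⟩ <;>
    norm_num [gram_eq, numW, Mode.flip] <;> ring

@[simp]
theorem gram_W3 :
    gram c H 0 [.W (-3)] [.W (-1), .W (-1), .W (-1)] = -414720 * κ ^ 2 * H ^ 3 - 331776 * κ ^ 2 *
      H ^ 2 - 248832 / 5 * κ ^ 2 * H - 3888 * κ * H ^ 2 + 1296 / 5 * κ * H + 81 / 2 * H ∧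
    gram c H 0 [.W (-3)] [.W (-2), .W (-1)] = 0 ∧
    gram c H 0 [.W (-3)] [.W (-3)] = -3 / 2 * c - 432 * κ * H ^ 2 - 432 / 5 * κ * H - 333 / 10 * H ∧
    gram c H 0 [.W (-3)] [.L (-1), .W (-1), .W (-1)] = 0 ∧
    gram c H 0 [.W (-3)] [.L (-1), .W (-2)] = -1440 * κ * H ^ 2 - 288 * κ * H - 36 * H ∧
    gram c H 0 [.W (-3)] [.L (-1), .L (-1), .W (-1)] = -2880 * κ * H ^ 2 - 576 * κ * H + 18 * H ∧
    gram c H 0 [.W (-3)] [.L (-2), .W (-1)] = -1008 * κ * H ^ 2 - 1008 / 5 * κ * H + 63 / 10 * H ∧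
    gram c H 0 [.W (-3)] [.L (-1), .L (-1), .L (-1)] = 0 ∧
    gram c H 0 [.W (-3)] [.L (-2), .L (-1)] = 0 ∧
    gram c H 0 [.W (-3)] [.L (-3)] = 0 := by
  refine ⟨?_, ?_, ?_, ?_, ?_, ?_, ?_, ?_, ?_, ?_⟩ <;>
    norm_num [gram_eq, numW, Mode.flip] <;> ring

@[simp]
theorem gram_L1_W1_W1 :
    gram c H 0 [.L (-1), .W (-1), .W (-1)] [.W (-1), .W (-1), .W (-1)] = 0 ∧
    gram c H 0 [.L (-1), .W (-1), .W (-1)] [.W (-2), .W (-1)] = 165888 * κ ^ 2 * H ^ 4 + 1161216 /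
      5 * κ ^ 2 * H ^ 3 + 3483648 / 25 * κ ^ 2 * H ^ 2 + 497664 / 25 * κ ^ 2 * H - 10368 / 5 * κ *
      H ^ 3 - 49248 / 25 * κ * H ^ 2 - 18144 / 25 * κ * H + 162 / 25 * H ^ 2 + 81 / 25 * H ∧
    gram c H 0 [.L (-1), .W (-1), .W (-1)] [.W (-3)] = 0 ∧
    gram c H 0 [.L (-1), .W (-1), .W (-1)] [.L (-1), .W (-1), .W (-1)] = 82944 * κ ^ 2 * H ^ 5 +
      1410048 / 5 * κ ^ 2 * H ^ 4 + 16879104 / 25 * κ ^ 2 * H ^ 3 + 1492992 / 5 * κ ^ 2 * H ^ 2 +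
      870912 / 25 * κ ^ 2 * H - 5184 / 5 * κ * H ^ 4 - 76464 / 25 * κ * H ^ 3 - 34992 / 5 * κ * H
      ^ 2 - 41472 / 25 * κ * H + 81 / 25 * H ^ 3 + 81 / 10 * H ^ 2 + 891 / 50 * H ∧
    gram c H 0 [.L (-1), .W (-1), .W (-1)] [.L (-1), .W (-2)] = 0 ∧
    gram c H 0 [.L (-1), .W (-1), .W (-1)] [.L (-1), .L (-1), .W (-1)] = 0 ∧
    gram c H 0 [.L (-1), .W (-1), .W (-1)] [.L (-2), .W (-1)] = 0 ∧
    gram c H 0 [.L (-1), .W (-1), .W (-1)] [.L (-1), .L (-1), .L (-1)] = 5184 * κ * H ^ 3 + 31104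
      / 5 * κ * H ^ 2 + 5184 / 5 * κ * H - 162 / 5 * H ^ 2 - 162 / 5 * H ∧
    gram c H 0 [.L (-1), .W (-1), .W (-1)] [.L (-2), .L (-1)] = 1440 * κ * H ^ 3 + 2880 * κ * H ^
      2 + 2592 / 5 * κ * H - 9 * H ^ 2 - 81 / 5 * H ∧
    gram c H 0 [.L (-1), .W (-1), .W (-1)] [.L (-3)] = 2880 * κ * H ^ 2 + 576 * κ * H - 18 * H := by
  refine ⟨?_, ?_, ?_, ?_, ?_, ?_, ?_, ?_, ?_, ?_⟩ <;>
    norm_num [gram_eq, numW, Mode.flip] <;> ring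

@[simp]
theorem gram_L1_W2 :
    gram c H 0 [.L (-1), .W (-2)] [.W (-1), .W (-1), .W (-1)] = -995328 * κ ^ 2 * H ^ 3 - 3234816
      / 5 * κ ^ 2 * H ^ 2 - 2239488 / 25 * κ ^ 2 * H + 23328 / 5 * κ * H ^ 2 + 62208 / 25 * κ * H
      + 243 / 25 * H ∧
    gram c H 0 [.L (-1), .W (-2)] [.W (-2), .W (-1)] = 0 ∧
    gram c H 0 [.L (-1), .W (-2)] [.W (-3)] = -1440 * κ * H ^ 2 - 288 * κ * H - 36 * H ∧
    gram c H 0 [.L (-1), .W (-2)] [.L (-1), .W (-1), .W (-1)] = 0 ∧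
    gram c H 0 [.L (-1), .W (-2)] [.L (-1), .W (-2)] = -576 * κ * H ^ 3 - 17856 / 5 * κ * H ^ 2 -
      3456 / 5 * κ * H - 72 / 5 * H ^ 2 - 72 / 5 * H ∧
    gram c H 0 [.L (-1), .W (-2)] [.L (-1), .L (-1), .W (-1)] = -2304 * κ * H ^ 3 - 19584 / 5 * κ
      * H ^ 2 - 3456 / 5 * κ * H + 72 / 5 * H ^ 2 + 108 / 5 * H ∧
    gram c H 0 [.L (-1), .W (-2)] [.L (-2), .W (-1)] = -1728 * κ * H ^ 2 - 1728 / 5 * κ * H + 54 /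
      5 * H ∧
    gram c H 0 [.L (-1), .W (-2)] [.L (-1), .L (-1), .L (-1)] = 0 ∧
    gram c H 0 [.L (-1), .W (-2)] [.L (-2), .L (-1)] = 0 ∧
    gram c H 0 [.L (-1), .W (-2)] [.L (-3)] = 0 := by
  refine ⟨?_, ?_, ?_, ?_, ?_, ?_, ?_, ?_, ?_, ?_⟩ <;>
    norm_num [gram_eq, numW, Mode.flip] <;> ring

@[simp]
theorem gram_L1_L1_W1 :
    gram c H 0 [.L (-1), .L (-1), .W (-1)] [.W (-1), .W (-1), .W (-1)] = -373248 * κ ^ 2 * H ^ 4 -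
      5723136 / 5 * κ ^ 2 * H ^ 3 - 12814848 / 25 * κ ^ 2 * H ^ 2 - 1492992 / 25 * κ ^ 2 * H +
      23328 / 5 * κ * H ^ 3 + 314928 / 25 * κ * H ^ 2 + 73872 / 25 * κ * H - 729 / 50 * H ^ 2 -
      1701 / 50 * H ∧
    gram c H 0 [.L (-1), .L (-1), .W (-1)] [.W (-2), .W (-1)] = 0 ∧
    gram c H 0 [.L (-1), .L (-1), .W (-1)] [.W (-3)] = -2880 * κ * H ^ 2 - 576 * κ * H + 18 * H ∧
    gram c H 0 [.L (-1), .L (-1), .W (-1)] [.L (-1), .W (-1), .W (-1)] = 0 ∧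
    gram c H 0 [.L (-1), .L (-1), .W (-1)] [.L (-1), .W (-2)] = -2304 * κ * H ^ 3 - 19584 / 5 * κ
      * H ^ 2 - 3456 / 5 * κ * H + 72 / 5 * H ^ 2 + 108 / 5 * H ∧
    gram c H 0 [.L (-1), .L (-1), .W (-1)] [.L (-1), .L (-1), .W (-1)] = -1152 * κ * H ^ 4 - 15552
      / 5 * κ * H ^ 3 - 2304 * κ * H ^ 2 - 1728 / 5 * κ * H + 36 / 5 * H ^ 3 + 18 * H ^ 2 + 54 / 5
      * H ∧
    gram c H 0 [.L (-1), .L (-1), .W (-1)] [.L (-2), .W (-1)] = -864 * κ * H ^ 3 - 5184 / 5 * κ *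
      H ^ 2 - 864 / 5 * κ * H + 27 / 5 * H ^ 2 + 27 / 5 * H ∧
    gram c H 0 [.L (-1), .L (-1), .W (-1)] [.L (-1), .L (-1), .L (-1)] = 0 ∧
    gram c H 0 [.L (-1), .L (-1), .W (-1)] [.L (-2), .L (-1)] = 0 ∧
    gram c H 0 [.L (-1), .L (-1), .W (-1)] [.L (-3)] = 0 := by
  refine ⟨?_, ?_, ?_, ?_, ?_, ?_, ?_, ?_, ?_, ?_⟩ <;>
    norm_num [gram_eq, numW, Mode.flip] <;> ring

@[simp]
theorem gram_L2_W1 :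
    gram c H 0 [.L (-2), .W (-1)] [.W (-1), .W (-1), .W (-1)] = -311040 * κ ^ 2 * H ^ 4 - 331776 *
      κ ^ 2 * H ^ 3 - 891648 / 5 * κ ^ 2 * H ^ 2 - 124416 / 5 * κ ^ 2 * H + 3888 * κ * H ^ 3 +
      13608 / 5 * κ * H ^ 2 + 4536 / 5 * κ * H - 243 / 20 * H ^ 2 - 81 / 20 * H ∧
    gram c H 0 [.L (-2), .W (-1)] [.W (-2), .W (-1)] = 0 ∧
    gram c H 0 [.L (-2), .W (-1)] [.W (-3)] = -1008 * κ * H ^ 2 - 1008 / 5 * κ * H + 63 / 10 * H ∧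
    gram c H 0 [.L (-2), .W (-1)] [.L (-1), .W (-1), .W (-1)] = 0 ∧
    gram c H 0 [.L (-2), .W (-1)] [.L (-1), .W (-2)] = -1728 * κ * H ^ 2 - 1728 / 5 * κ * H + 54 /
      5 * H ∧
    gram c H 0 [.L (-2), .W (-1)] [.L (-1), .L (-1), .W (-1)] = -864 * κ * H ^ 3 - 5184 / 5 * κ *
      H ^ 2 - 864 / 5 * κ * H + 27 / 5 * H ^ 2 + 27 / 5 * H ∧
    gram c H 0 [.L (-2), .W (-1)] [.L (-2), .W (-1)] = -72 * c * κ * H ^ 2 - 72 / 5 * c * κ * H +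
      9 / 20 * c * H - 576 * κ * H ^ 3 - 3456 / 5 * κ * H ^ 2 - 576 / 5 * κ * H + 18 / 5 * H ^ 2 +
      18 / 5 * H ∧
    gram c H 0 [.L (-2), .W (-1)] [.L (-1), .L (-1), .L (-1)] = 0 ∧
    gram c H 0 [.L (-2), .W (-1)] [.L (-2), .L (-1)] = 0 ∧
    gram c H 0 [.L (-2), .W (-1)] [.L (-3)] = 0 := by
  refine ⟨?_, ?_, ?_, ?_, ?_, ?_, ?_, ?_, ?_, ?_⟩ <;>
    norm_num [gram_eq, numW, Mode.flip] <;> ring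

@[simp]
theorem gram_L1_L1_L1 :
    gram c H 0 [.L (-1), .L (-1), .L (-1)] [.W (-1), .W (-1), .W (-1)] = 0 ∧
    gram c H 0 [.L (-1), .L (-1), .L (-1)] [.W (-2), .W (-1)] = 3456 * κ * H ^ 2 + 3456 / 5 * κ *
      H - 108 / 5 * H ∧
    gram c H 0 [.L (-1), .L (-1), .L (-1)] [.W (-3)] = 0 ∧
    gram c H 0 [.L (-1), .L (-1), .L (-1)] [.L (-1), .W (-1), .W (-1)] = 5184 * κ * H ^ 3 + 31104
      / 5 * κ * H ^ 2 + 5184 / 5 * κ * H - 162 / 5 * H ^ 2 - 162 / 5 * H ∧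
    gram c H 0 [.L (-1), .L (-1), .L (-1)] [.L (-1), .W (-2)] = 0 ∧
    gram c H 0 [.L (-1), .L (-1), .L (-1)] [.L (-1), .L (-1), .W (-1)] = 0 ∧
    gram c H 0 [.L (-1), .L (-1), .L (-1)] [.L (-2), .W (-1)] = 0 ∧
    gram c H 0 [.L (-1), .L (-1), .L (-1)] [.L (-1), .L (-1), .L (-1)] = 48 * H ^ 3 + 72 * H ^ 2 +
      24 * H ∧
    gram c H 0 [.L (-1), .L (-1), .L (-1)] [.L (-2), .L (-1)] = 36 * H ^ 2 + 12 * H ∧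
    gram c H 0 [.L (-1), .L (-1), .L (-1)] [.L (-3)] = 24 * H := by
  refine ⟨?_, ?_, ?_, ?_, ?_, ?_, ?_, ?_, ?_, ?_⟩ <;>
    norm_num [gram_eq, numW, Mode.flip] <;> ring

@[simp]
theorem gram_L2_L1 :
    gram c H 0 [.L (-2), .L (-1)] [.W (-1), .W (-1), .W (-1)] = 0 ∧
    gram c H 0 [.L (-2), .L (-1)] [.W (-2), .W (-1)] = 1728 * κ * H ^ 2 + 1728 / 5 * κ * H - 54 /
      5 * H ∧
    gram c H 0 [.L (-2), .L (-1)] [.W (-3)] = 0 ∧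
    gram c H 0 [.L (-2), .L (-1)] [.L (-1), .W (-1), .W (-1)] = 1440 * κ * H ^ 3 + 2880 * κ * H ^
      2 + 2592 / 5 * κ * H - 9 * H ^ 2 - 81 / 5 * H ∧
    gram c H 0 [.L (-2), .L (-1)] [.L (-1), .W (-2)] = 0 ∧
    gram c H 0 [.L (-2), .L (-1)] [.L (-1), .L (-1), .W (-1)] = 0 ∧
    gram c H 0 [.L (-2), .L (-1)] [.L (-2), .W (-1)] = 0 ∧
    gram c H 0 [.L (-2), .L (-1)] [.L (-1), .L (-1), .L (-1)] = 36 * H ^ 2 + 12 * H ∧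
    gram c H 0 [.L (-2), .L (-1)] [.L (-2), .L (-1)] = c * H + 8 * H ^ 2 + 8 * H ∧
    gram c H 0 [.L (-2), .L (-1)] [.L (-3)] = 10 * H := by
  refine ⟨?_, ?_, ?_, ?_, ?_, ?_, ?_, ?_, ?_, ?_⟩ <;>
    norm_num [gram_eq, numW, Mode.flip] <;> ring

@[simp]
theorem gram_L3 :
    gram c H 0 [.L (-3)] [.W (-1), .W (-1), .W (-1)] = 0 ∧
    gram c H 0 [.L (-3)] [.W (-2), .W (-1)] = 1152 * κ * H ^ 2 + 1152 / 5 * κ * H - 36 / 5 * H ∧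
    gram c H 0 [.L (-3)] [.W (-3)] = 0 ∧
    gram c H 0 [.L (-3)] [.L (-1), .W (-1), .W (-1)] = 2880 * κ * H ^ 2 + 576 * κ * H - 18 * H ∧
    gram c H 0 [.L (-3)] [.L (-1), .W (-2)] = 0 ∧
    gram c H 0 [.L (-3)] [.L (-1), .L (-1), .W (-1)] = 0 ∧
    gram c H 0 [.L (-3)] [.L (-2), .W (-1)] = 0 ∧
    gram c H 0 [.L (-3)] [.L (-1), .L (-1), .L (-1)] = 24 * H ∧
    gram c H 0 [.L (-3)] [.L (-2), .L (-1)] = 10 * H ∧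
    gram c H 0 [.L (-3)] [.L (-3)] = 2 * c + 6 * H := by
  refine ⟨?_, ?_, ?_, ?_, ?_, ?_, ?_, ?_, ?_, ?_⟩ <;>
    norm_num [gram_eq, numW, Mode.flip] <;> ring

-- Writing the external charge as `u * h` turns the ratio `3 w / (2 h)` of the semi-degeneracy
-- condition into `3 u / 2`, so that all matrix elements become polynomials in `u`, `h`, `H` and
-- `κ`. Left and right elements agree on even words and are opposite on odd ones.
@[simp]
theorem rightElement_W1 (hh : h ≠ 0) :
    rightElement c H 0 h (u * h) h (-(u * h)) [.W (-1)] = -3 / 2 * H * u := by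
  rw [rightElement, level_toNat_of (n := 1) (by decide)]
  simp [rightAux_L, rightAux_W, level, Mode.index, numW] <;> field_simp <;> ring

@[simp]
theorem leftElement_W1 (hh : h ≠ 0) :
    leftElement c H 0 h (u * h) h (-(u * h)) [.W (-1)] = 3 / 2 * H * u := by
  rw [leftElement, level_toNat_of (n := 1) (by decide)]
  simp [leftAux_L, leftAux_W, level, Mode.index, numW] <;> field_simp <;> ring

@[simp]
theorem rightElement_L1 (hh : h ≠ 0) :
    rightElement c H 0 h (u * h) h (-(u * h)) [.L (-1)] = H := by
  rw [rightElement, level_toNat_of (n := 1) (by decide)]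
  simp [rightAux_L, rightAux_W, level, Mode.index, numW] <;> field_simp <;> ring

@[simp]
theorem leftElement_L1 (hh : h ≠ 0) :
    leftElement c H 0 h (u * h) h (-(u * h)) [.L (-1)] = H := by
  rw [leftElement, level_toNat_of (n := 1) (by decide)]
  simp [leftAux_L, leftAux_W, level, Mode.index, numW] <;> field_simp <;> ring

@[simp]
theorem rightElement_W1_W1 (hh : h ≠ 0) :
    rightElement c H 0 h (u * h) h (-(u * h)) [.W (-1), .W (-1)] = 144 * κ * H ^ 2 + 144 / 5 * κ *
      H + 9 / 4 * H ^ 2 * u ^ 2 + 9 / 4 * H * u ^ 2 - 9 / 10 * H := by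
  rw [rightElement, level_toNat_of (n := 2) (by decide)]
  simp [rightAux_L, rightAux_W, level, Mode.index, numW] <;> field_simp <;> ring

@[simp]
theorem leftElement_W1_W1 (hh : h ≠ 0) :
    leftElement c H 0 h (u * h) h (-(u * h)) [.W (-1), .W (-1)] = 144 * κ * H ^ 2 + 144 / 5 * κ *
      H + 9 / 4 * H ^ 2 * u ^ 2 + 9 / 4 * H * u ^ 2 - 9 / 10 * H := by
  rw [leftElement, level_toNat_of (n := 2) (by decide)]
  simp [leftAux_L, leftAux_W, level, Mode.index, numW] <;> field_simp <;> ring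

@[simp]
theorem rightElement_W2 (hh : h ≠ 0) :
    rightElement c H 0 h (u * h) h (-(u * h)) [.W (-2)] = -3 * H * u := by
  rw [rightElement, level_toNat_of (n := 2) (by decide)]
  simp [rightAux_L, rightAux_W, level, Mode.index, numW] <;> field_simp <;> ring

@[simp]
theorem leftElement_W2 (hh : h ≠ 0) :
    leftElement c H 0 h (u * h) h (-(u * h)) [.W (-2)] = 3 * H * u := by
  rw [leftElement, level_toNat_of (n := 2) (by decide)]
  simp [leftAux_L, leftAux_W, level, Mode.index, numW] <;> field_simp <;> ring

@[simp]
theorem rightElement_L1_W1 (hh : h ≠ 0) :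
    rightElement c H 0 h (u * h) h (-(u * h)) [.L (-1), .W (-1)] = -3 / 2 * H ^ 2 * u - 3 / 2 * H
      * u := by
  rw [rightElement, level_toNat_of (n := 2) (by decide)]
  simp [rightAux_L, rightAux_W, level, Mode.index, numW] <;> field_simp <;> ring

@[simp]
theorem leftElement_L1_W1 (hh : h ≠ 0) :
    leftElement c H 0 h (u * h) h (-(u * h)) [.L (-1), .W (-1)] = 3 / 2 * H ^ 2 * u + 3 / 2 * H *
      u := by
  rw [leftElement, level_toNat_of (n := 2) (by decide)]
  simp [leftAux_L, leftAux_W, level, Mode.index, numW] <;> field_simp <;> ring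

@[simp]
theorem rightElement_L1_L1 (hh : h ≠ 0) :
    rightElement c H 0 h (u * h) h (-(u * h)) [.L (-1), .L (-1)] = H ^ 2 + H := by
  rw [rightElement, level_toNat_of (n := 2) (by decide)]
  simp [rightAux_L, rightAux_W, level, Mode.index, numW] <;> field_simp <;> ring

@[simp]
theorem leftElement_L1_L1 (hh : h ≠ 0) :
    leftElement c H 0 h (u * h) h (-(u * h)) [.L (-1), .L (-1)] = H ^ 2 + H := by
  rw [leftElement, level_toNat_of (n := 2) (by decide)]
  simp [leftAux_L, leftAux_W, level, Mode.index, numW] <;> field_simp <;> ring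

@[simp]
theorem rightElement_L2 (hh : h ≠ 0) :
    rightElement c H 0 h (u * h) h (-(u * h)) [.L (-2)] = H + h := by
  rw [rightElement, level_toNat_of (n := 2) (by decide)]
  simp [rightAux_L, rightAux_W, level, Mode.index, numW] <;> field_simp <;> ring

@[simp]
theorem leftElement_L2 (hh : h ≠ 0) :
    leftElement c H 0 h (u * h) h (-(u * h)) [.L (-2)] = H + h := by
  rw [leftElement, level_toNat_of (n := 2) (by decide)]
  simp [leftAux_L, leftAux_W, level, Mode.index, numW] <;> field_simp <;> ring

@[simp]
theorem rightElement_W1_W1_W1 (hh : h ≠ 0) :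
    rightElement c H 0 h (u * h) h (-(u * h)) [.W (-1), .W (-1), .W (-1)] = -648 * κ * H ^ 3 * u -
      8208 / 5 * κ * H ^ 2 * u - 2376 / 5 * κ * H * u - 27 / 8 * H ^ 3 * u ^ 3 - 81 / 8 * H ^ 2 *
      u ^ 3 + 81 / 20 * H ^ 2 * u - 27 / 4 * H * u ^ 3 + 81 / 10 * H * u := by
  rw [rightElement, level_toNat_of (n := 3) (by decide)]
  simp [rightAux_L, rightAux_W, level, Mode.index, numW] <;> field_simp <;> ring

@[simp]
theorem leftElement_W1_W1_W1 (hh : h ≠ 0) :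
    leftElement c H 0 h (u * h) h (-(u * h)) [.W (-1), .W (-1), .W (-1)] = 648 * κ * H ^ 3 * u +
      8208 / 5 * κ * H ^ 2 * u + 2376 / 5 * κ * H * u + 27 / 8 * H ^ 3 * u ^ 3 + 81 / 8 * H ^ 2 *
      u ^ 3 - 81 / 20 * H ^ 2 * u + 27 / 4 * H * u ^ 3 - 81 / 10 * H * u := by
  rw [leftElement, level_toNat_of (n := 3) (by decide)]
  simp [leftAux_L, leftAux_W, level, Mode.index, numW] <;> field_simp <;> ring

@[simp]
theorem rightElement_W2_W1 (hh : h ≠ 0) :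
    rightElement c H 0 h (u * h) h (-(u * h)) [.W (-2), .W (-1)] = 144 * κ * H ^ 2 + 144 / 5 * κ *
      H + 9 / 2 * H ^ 2 * u ^ 2 + 9 / 2 * H * u ^ 2 - 9 / 10 * H := by
  rw [rightElement, level_toNat_of (n := 3) (by decide)]
  simp [rightAux_L, rightAux_W, level, Mode.index, numW] <;> field_simp <;> ring

@[simp]
theorem leftElement_W2_W1 (hh : h ≠ 0) :
    leftElement c H 0 h (u * h) h (-(u * h)) [.W (-2), .W (-1)] = 144 * κ * H ^ 2 + 144 / 5 * κ *
      H + 9 / 2 * H ^ 2 * u ^ 2 + 9 / 2 * H * u ^ 2 - 9 / 10 * H := by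
  rw [leftElement, level_toNat_of (n := 3) (by decide)]
  simp [leftAux_L, leftAux_W, level, Mode.index, numW] <;> field_simp <;> ring

@[simp]
theorem rightElement_W3 (hh : h ≠ 0) :
    rightElement c H 0 h (u * h) h (-(u * h)) [.W (-3)] = -9 / 2 * H * u - h * u := by
  rw [rightElement, level_toNat_of (n := 3) (by decide)]
  simp [rightAux_L, rightAux_W, level, Mode.index, numW] <;> field_simp <;> ring

@[simp]
theorem leftElement_W3 (hh : h ≠ 0) :
    leftElement c H 0 h (u * h) h (-(u * h)) [.W (-3)] = 9 / 2 * H * u + h * u := by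
  rw [leftElement, level_toNat_of (n := 3) (by decide)]
  simp [leftAux_L, leftAux_W, level, Mode.index, numW] <;> field_simp <;> ring

@[simp]
theorem rightElement_L1_W1_W1 (hh : h ≠ 0) :
    rightElement c H 0 h (u * h) h (-(u * h)) [.L (-1), .W (-1), .W (-1)] = 144 * κ * H ^ 3 + 1584
      / 5 * κ * H ^ 2 + 288 / 5 * κ * H + 9 / 4 * H ^ 3 * u ^ 2 + 27 / 4 * H ^ 2 * u ^ 2 - 9 / 10
      * H ^ 2 + 9 / 2 * H * u ^ 2 - 9 / 5 * H := by
  rw [rightElement, level_toNat_of (n := 3) (by decide)]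
  simp [rightAux_L, rightAux_W, level, Mode.index, numW] <;> field_simp <;> ring

@[simp]
theorem leftElement_L1_W1_W1 (hh : h ≠ 0) :
    leftElement c H 0 h (u * h) h (-(u * h)) [.L (-1), .W (-1), .W (-1)] = 144 * κ * H ^ 3 + 1584
      / 5 * κ * H ^ 2 + 288 / 5 * κ * H + 9 / 4 * H ^ 3 * u ^ 2 + 27 / 4 * H ^ 2 * u ^ 2 - 9 / 10
      * H ^ 2 + 9 / 2 * H * u ^ 2 - 9 / 5 * H := by
  rw [leftElement, level_toNat_of (n := 3) (by decide)]
  simp [leftAux_L, leftAux_W, level, Mode.index, numW] <;> field_simp <;> ring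

@[simp]
theorem rightElement_L1_W2 (hh : h ≠ 0) :
    rightElement c H 0 h (u * h) h (-(u * h)) [.L (-1), .W (-2)] = -3 * H ^ 2 * u - 6 * H * u := by
  rw [rightElement, level_toNat_of (n := 3) (by decide)]
  simp [rightAux_L, rightAux_W, level, Mode.index, numW] <;> field_simp <;> ring

@[simp]
theorem leftElement_L1_W2 (hh : h ≠ 0) :
    leftElement c H 0 h (u * h) h (-(u * h)) [.L (-1), .W (-2)] = 3 * H ^ 2 * u + 6 * H * u := by
  rw [leftElement, level_toNat_of (n := 3) (by decide)]
  simp [leftAux_L, leftAux_W, level, Mode.index, numW] <;> field_simp <;> ring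

@[simp]
theorem rightElement_L1_L1_W1 (hh : h ≠ 0) :
    rightElement c H 0 h (u * h) h (-(u * h)) [.L (-1), .L (-1), .W (-1)] = -3 / 2 * H ^ 3 * u - 9
      / 2 * H ^ 2 * u - 3 * H * u := by
  rw [rightElement, level_toNat_of (n := 3) (by decide)]
  simp [rightAux_L, rightAux_W, level, Mode.index, numW] <;> field_simp <;> ring

@[simp]
theorem leftElement_L1_L1_W1 (hh : h ≠ 0) :
    leftElement c H 0 h (u * h) h (-(u * h)) [.L (-1), .L (-1), .W (-1)] = 3 / 2 * H ^ 3 * u + 9 /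
      2 * H ^ 2 * u + 3 * H * u := by
  rw [leftElement, level_toNat_of (n := 3) (by decide)]
  simp [leftAux_L, leftAux_W, level, Mode.index, numW] <;> field_simp <;> ring

@[simp]
theorem rightElement_L2_W1 (hh : h ≠ 0) :
    rightElement c H 0 h (u * h) h (-(u * h)) [.L (-2), .W (-1)] = -3 / 2 * H ^ 2 * u - 3 / 2 * H
      * h * u - 3 / 2 * H * u := by
  rw [rightElement, level_toNat_of (n := 3) (by decide)]
  simp [rightAux_L, rightAux_W, level, Mode.index, numW] <;> field_simp <;> ring

@[simp]
theorem leftElement_L2_W1 (hh : h ≠ 0) :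
    leftElement c H 0 h (u * h) h (-(u * h)) [.L (-2), .W (-1)] = 3 / 2 * H ^ 2 * u + 3 / 2 * H *
      h * u + 3 / 2 * H * u := by
  rw [leftElement, level_toNat_of (n := 3) (by decide)]
  simp [leftAux_L, leftAux_W, level, Mode.index, numW] <;> field_simp <;> ring

@[simp]
theorem rightElement_L1_L1_L1 (hh : h ≠ 0) :
    rightElement c H 0 h (u * h) h (-(u * h)) [.L (-1), .L (-1), .L (-1)] = H ^ 3 + 3 * H ^ 2 + 2
      * H := by
  rw [rightElement, level_toNat_of (n := 3) (by decide)]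
  simp [rightAux_L, rightAux_W, level, Mode.index, numW] <;> field_simp <;> ring

@[simp]
theorem leftElement_L1_L1_L1 (hh : h ≠ 0) :
    leftElement c H 0 h (u * h) h (-(u * h)) [.L (-1), .L (-1), .L (-1)] = H ^ 3 + 3 * H ^ 2 + 2 *
      H := by
  rw [leftElement, level_toNat_of (n := 3) (by decide)]
  simp [leftAux_L, leftAux_W, level, Mode.index, numW] <;> field_simp <;> ring

@[simp]
theorem rightElement_L2_L1 (hh : h ≠ 0) :
    rightElement c H 0 h (u * h) h (-(u * h)) [.L (-2), .L (-1)] = H ^ 2 + H * h + H := by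
  rw [rightElement, level_toNat_of (n := 3) (by decide)]
  simp [rightAux_L, rightAux_W, level, Mode.index, numW] <;> field_simp <;> ring

@[simp]
theorem leftElement_L2_L1 (hh : h ≠ 0) :
    leftElement c H 0 h (u * h) h (-(u * h)) [.L (-2), .L (-1)] = H ^ 2 + H * h + H := by
  rw [leftElement, level_toNat_of (n := 3) (by decide)]
  simp [leftAux_L, leftAux_W, level, Mode.index, numW] <;> field_simp <;> ring

@[simp]
theorem rightElement_L3 (hh : h ≠ 0) :
    rightElement c H 0 h (u * h) h (-(u * h)) [.L (-3)] = H + 2 * h := by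
  rw [rightElement, level_toNat_of (n := 3) (by decide)]
  simp [rightAux_L, rightAux_W, level, Mode.index, numW] <;> field_simp <;> ring

@[simp]
theorem leftElement_L3 (hh : h ≠ 0) :
    leftElement c H 0 h (u * h) h (-(u * h)) [.L (-3)] = H + 2 * h := by
  rw [leftElement, level_toNat_of (n := 3) (by decide)]
  simp [leftAux_L, leftAux_W, level, Mode.index, numW] <;> field_simp <;> ring

end Elements

/-! ### Homogenised factors of the Gram determinants. -/

section Determinants

variable {R : Type*} [CommRing R]

/-- The factor `32 X + 2 - c` of the Kac determinants, made homogeneous in `(c, y)` and in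
`(c, X, t)`; the other determinant factors below are treated in the same way. -/
def linDet (c y X t : R) : R := (32 * X + 2 * t) * y - c

/-- The determinant of the even quasi-primary states of level two. -/
def evenDet (c y H t : R) : R := 32 * H ^ 2 * y - 14 * H * t * y - c * H + c * t

/-- The norm of the odd quasi-primary state of level two. -/
def qpDet (c y H t : R) : R :=
  c * H + 2 * c * t + 8 * H ^ 2 * y - 18 * H * t * y + 4 * t ^ 2 * y

/-- The determinant of the even quasi-primary states of level three. -/
def qpDetThree (c y H t : R) : R :=
  c * H + 4 * c * t + 3 * H ^ 2 * y - 26 * H * t * y + 40 * t ^ 2 * y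

/-- The new factor in the determinant of the odd quasi-primary states of level three. -/
def oddDet (c y H t : R) : R :=
  5 * c ^ 2 - 64 * c * H * y - 468 * c * t * y - 3072 * H ^ 2 * y ^ 2 + 6272 * H * t * y ^ 2
    - 2156 * t ^ 2 * y ^ 2

end Determinants

/-! ### Solving the Gram systems, separately for even and odd words. -/

section Gram

set_option linter.unusedSectionVars false
set_option linter.unusedSimpArgs false
set_option linter.unusedVariables false
set_option linter.unnecessarySeqFocus false
set_option linter.flexible false

variable {K : Type*} [Field K] [CharZero K]

/-- The values of `(c, h̃)` at which no state of level at most three decouples. -/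
structure IsGeneric (c H : K) : Prop where
  central : 22 + 5 * c ≠ 0
  weight : H ≠ 0
  weight_two : H - 2 ≠ 0
  weight_five : 5 * H - 2 ≠ 0
  lin : linDet c 1 H 1 ≠ 0
  even : evenDet c 1 H 1 ≠ 0
  qp : qpDet c 1 H 1 ≠ 0
  qpThree : qpDetThree c 1 H 1 ≠ 0
  odd : oddDet c 1 H 1 ≠ 0

/-- A square matrix with trivial kernel is invertible, so `Q⁻¹ G` is the solution `v` of `Q v = G`.
It is enough to exhibit `v` and to exclude null vectors; no inverse has to be computed. -/
theorem projectorSum_eq_of_solution {n : ℕ} {b : List Word} (hn : b.length = n) {W : Fin n → Word}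
    (hW : ∀ i, b.get (Fin.cast hn.symm i) = W i) {Q : Word → Word → K} {Gs G : Word → K}
    (hinj : ∀ x : Fin n → K, (∀ i, ∑ j, Q (W i) (W j) * x j = 0) → x = 0) (v : Fin n → K)
    (hv : ∀ i, ∑ j, Q (W i) (W j) * v j = G (W i)) :
    projectorSum b Q Gs G = ∑ i, Gs (W i) * v i := by
  subst hn
  obtain rfl : b.get = W := funext hW
  set M : Matrix (Fin b.length) (Fin b.length) K :=
    Matrix.of fun i j => Q (b.get i) (b.get j) with hM
  have hunit : IsUnit M := by
    rw [← Matrix.mulVec_injective_iff_isUnit]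
    intro x y hxy
    refine sub_eq_zero.1 (hinj _ fun i => ?_)
    have : M.mulVec (x - y) i = 0 := by
      rw [Matrix.mulVec_sub]; simp only [Pi.sub_apply]; rw [show M.mulVec x = M.mulVec y from hxy]; simp
    exact this
  have hsol : M⁻¹.mulVec (fun i => G (b.get i)) = v := by
    have : (fun i => G (b.get i)) = M.mulVec v := funext fun i => (hv i).symm
    rw [this, Matrix.mulVec_mulVec, Matrix.nonsing_inv_mul _ ((Matrix.isUnit_iff_isUnit_det _).1 hunit),
      Matrix.one_mulVec]
  rw [← hsol]
  simp only [projectorSum, Matrix.mulVec, dotProduct, Finset.mul_sum, mul_assoc]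
  rfl

theorem mul_kappa {c : K} (hk : 22 + 5 * c ≠ 0) : (22 + 5 * c) * kappa c = 1 :=
  mul_inv_cancel₀ hk

/-- The basis monomials of level one. -/
def wordsOne : Fin 2 → Word :=
  ![[.W (-1)], [.L (-1)]]

theorem basis_one_get (i : Fin 2) :
    (basis 1).get (Fin.cast (by decide) i) = wordsOne i := by
  fin_cases i <;> rfl

/-- The even block of the Gram matrix of level one, cleared of denominators `22 + 5 c`. -/
def evenGramOne (c H : K) : Matrix (Fin 1) (Fin 1) K :=
  !![
    2 * H]

/-- The rescaled even components of a vector of level one. -/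
noncomputable def evenPartOne (c : K) (x : Fin 2 → K) : Fin 1 → K :=
  ![x 1]

/-- Rows are multiplied by powers of `22 + 5 c` and unknowns by powers of `κ`, shared out so that
the Gram block becomes polynomial. For a word with `k` spin-3 modes both exponents are `k / 2` when
`k` is even; when `k` is odd they are `(k + 1) / 2` for the row and `(k - 1) / 2` for the unknown.
The same convention is used at levels two and three. -/
theorem evenGramOne_row_0 {c : K} (hk : 22 + 5 * c ≠ 0) (H : K) (x : Fin 2 → K) :
    (22 + 5 * c) ^ 0 * ∑ j, gram c H 0 (wordsOne 1) (wordsOne j) * x j =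
      (evenGramOne c H).mulVec (evenPartOne c x) 0 := by
  simp [Fin.sum_univ_succ, wordsOne, evenGramOne, evenPartOne, Matrix.mulVec, dotProduct, -mul_eq_mul_left_iff]

theorem evenGramOne_injective {c H : K} (hg : IsGeneric c H) {y : Fin 1 → K}
    (hy : (evenGramOne c H).mulVec y = 0) : y = 0 := by
  have h0 := congrFun hy 0
  simp only [evenGramOne, Matrix.mulVec, dotProduct, Fin.sum_univ_succ, Matrix.of_apply, Matrix.cons_val,
    Fin.succ_zero_eq_one, Fin.isValue, Fin.reduceSucc, Finset.univ_eq_empty, Finset.sum_empty,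
    Pi.zero_apply] at h0
  have e0 : y 0 = 0 := by
    have e : (2) * H * y 0 = 0 := by
      linear_combination (1) * h0
    exact (mul_eq_zero.1 e).resolve_left (by simp [hg.weight, hg.weight_two, hg.weight_five, hg.lin,
      hg.even, hg.qp, hg.qpThree, hg.odd])
  funext i
  fin_cases i <;> assumption

/-- The solution of the even system of level one. -/
noncomputable def evenSolutionOne (c h H : K) : Fin 1 → K :=
  ![(1 / 2)]

/-- The rescaled even matrix elements of level one. -/
def evenRightOne (c h H : K) : Fin 1 → K :=
  ![H]

/-- The rescaled even adjoint matrix elements of level one. -/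
def evenLeftOne (c h H : K) : Fin 1 → K :=
  ![H]

theorem evenGramOne_mulVec {c H : K} (hg : IsGeneric c H) (h : K) :
    (evenGramOne c H).mulVec (evenSolutionOne c h H) = evenRightOne c h H := by
  funext i
  fin_cases i <;>
    simp [evenGramOne, evenSolutionOne, evenRightOne, Matrix.mulVec, dotProduct, Fin.sum_univ_succ]
  ring

theorem evenRightOne_0 {c h u : K} (H : K) (hh : h ≠ 0) :
    rightElement c H 0 h (u * h) h (-(u * h)) (wordsOne 1) =
      evenRightOne c h H 0 := by
  simp only [wordsOne, evenRightOne, Matrix.cons_val, rightElement_L1 _ _ _ _ hh]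


theorem evenLeftOne_0 {c h u : K} (H : K) (hh : h ≠ 0) :
    leftElement c H 0 h (u * h) h (-(u * h)) (wordsOne 1) =
      evenLeftOne c h H 0 := by
  simp only [wordsOne, evenLeftOne, Matrix.cons_val, leftElement_L1 _ _ _ _ hh]


/-- The odd block of the Gram matrix of level one, cleared of denominators `22 + 5 c`. -/
def oddGramOne (c H : K) : Matrix (Fin 1) (Fin 1) K :=
  !![
    9 / 2 * c * H - 144 * H ^ 2 - 9 * H]

/-- The rescaled odd components of a vector of level one. -/
noncomputable def oddPartOne (c : K) (x : Fin 2 → K) : Fin 1 → K :=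
  ![x 0]

theorem oddGramOne_row_0 {c : K} (hk : 22 + 5 * c ≠ 0) (H : K) (x : Fin 2 → K) :
    (22 + 5 * c) ^ 1 * ∑ j, gram c H 0 (wordsOne 0) (wordsOne j) * x j =
      (oddGramOne c H).mulVec (oddPartOne c x) 0 := by
  simp [Fin.sum_univ_succ, wordsOne, oddGramOne, oddPartOne, Matrix.mulVec, dotProduct, -mul_eq_mul_left_iff]
  rw [kappa]
  field_simp
  ring

theorem oddGramOne_injective {c H : K} (hg : IsGeneric c H) {y : Fin 1 → K}
    (hy : (oddGramOne c H).mulVec y = 0) : y = 0 := by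
  have h0 := congrFun hy 0
  simp only [oddGramOne, Matrix.mulVec, dotProduct, Fin.sum_univ_succ, Matrix.of_apply, Matrix.cons_val,
    Fin.succ_zero_eq_one, Fin.isValue, Fin.reduceSucc, Finset.univ_eq_empty, Finset.sum_empty,
    Pi.zero_apply] at h0
  have e0 : y 0 = 0 := by
    have e : (-9) * linDet c 1 H 1 * H * y 0 = 0 := by
      unfold linDet
      linear_combination (2) * h0
    exact (mul_eq_zero.1 e).resolve_left (by simp [hg.weight, hg.weight_two, hg.weight_five, hg.lin,
      hg.even, hg.qp, hg.qpThree, hg.odd])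
  funext i
  fin_cases i <;> assumption

/-- The solution of the odd system of level one. -/
noncomputable def oddSolutionOne (c h H : K) : Fin 1 → K :=
  ![(1 / 3) / (linDet c 1 H 1)]

/-- The rescaled odd matrix elements of level one. -/
def oddRightOne (c h H : K) : Fin 1 → K :=
  ![-3 / 2 * H]

/-- The rescaled odd adjoint matrix elements of level one. -/
def oddLeftOne (c h H : K) : Fin 1 → K :=
  ![3 / 2 * H]

theorem oddGramOne_mulVec {c H : K} (hg : IsGeneric c H) (h : K) :
    (oddGramOne c H).mulVec (oddSolutionOne c h H) = oddRightOne c h H := by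
  have hA := hg.lin
  funext i
  fin_cases i <;>
    simp [oddGramOne, oddSolutionOne, oddRightOne, Matrix.mulVec, dotProduct, Fin.sum_univ_succ] <;>
    field_simp <;>
    simp only [linDet, evenDet, oddDet] <;>
    ring

theorem oddRightOne_0 {c h u : K} (H : K) (hh : h ≠ 0) :
    rightElement c H 0 h (u * h) h (-(u * h)) (wordsOne 0) =
      u * oddRightOne c h H 0 := by
  simp only [wordsOne, oddRightOne, Matrix.cons_val, rightElement_W1 _ _ _ _ hh]
  ring


theorem oddLeftOne_0 {c h u : K} (H : K) (hh : h ≠ 0) :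
    leftElement c H 0 h (u * h) h (-(u * h)) (wordsOne 0) =
      u * oddLeftOne c h H 0 := by
  simp only [wordsOne, oddLeftOne, Matrix.cons_val, leftElement_W1 _ _ _ _ hh]
  ring


/-- The basis monomials of level two. -/
def wordsTwo : Fin 5 → Word :=
  ![[.W (-1), .W (-1)], [.W (-2)], [.L (-1), .W (-1)], [.L (-1), .L (-1)], [.L (-2)]]

theorem basis_two_get (i : Fin 5) :
    (basis 2).get (Fin.cast (by decide) i) = wordsTwo i := by
  fin_cases i <;> rfl

/-- The even block of the Gram matrix of level two, cleared of denominators `22 + 5 c`. -/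
def evenGramTwo (c H : K) : Matrix (Fin 3) (Fin 3) K :=
  !![
    81 / 2 * c ^ 2 * H ^ 2 + 81 / 4 * c ^ 2 * H - 2592 * c * H ^ 3 - 2106 * c * H ^ 2 - 729 * c *
      H + 41472 * H ^ 4 + 46656 * H ^ 3 + 24786 * H ^ 2 + 1377 * H,
    -27 * c * H + 864 * H ^ 2 + 54 * H,
    -45 / 2 * c * H + 720 * H ^ 2 + 45 * H;
    -27 * c * H + 864 * H ^ 2 + 54 * H,
    8 * H ^ 2 + 4 * H,
    6 * H;
    -45 / 2 * c * H + 720 * H ^ 2 + 45 * H,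
    6 * H,
    1 / 2 * c + 4 * H]

/-- The rescaled even components of a vector of level two. -/
noncomputable def evenPartTwo (c : K) (x : Fin 5 → K) : Fin 3 → K :=
  ![kappa c * x 0, x 3, x 4]

theorem evenGramTwo_row_0 {c : K} (hk : 22 + 5 * c ≠ 0) (H : K) (x : Fin 5 → K) :
    (22 + 5 * c) ^ 1 * ∑ j, gram c H 0 (wordsTwo 0) (wordsTwo j) * x j =
      (evenGramTwo c H).mulVec (evenPartTwo c x) 0 := by
  simp [Fin.sum_univ_succ, wordsTwo, evenGramTwo, evenPartTwo, Matrix.mulVec, dotProduct, -mul_eq_mul_left_iff]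
  rw [kappa]
  field_simp
  ring

theorem evenGramTwo_row_1 {c : K} (hk : 22 + 5 * c ≠ 0) (H : K) (x : Fin 5 → K) :
    (22 + 5 * c) ^ 0 * ∑ j, gram c H 0 (wordsTwo 3) (wordsTwo j) * x j =
      (evenGramTwo c H).mulVec (evenPartTwo c x) 1 := by
  simp [Fin.sum_univ_succ, wordsTwo, evenGramTwo, evenPartTwo, Matrix.mulVec, dotProduct, -mul_eq_mul_left_iff]
  rw [kappa]
  field_simp
  ring

theorem evenGramTwo_row_2 {c : K} (hk : 22 + 5 * c ≠ 0) (H : K) (x : Fin 5 → K) :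
    (22 + 5 * c) ^ 0 * ∑ j, gram c H 0 (wordsTwo 4) (wordsTwo j) * x j =
      (evenGramTwo c H).mulVec (evenPartTwo c x) 2 := by
  simp [Fin.sum_univ_succ, wordsTwo, evenGramTwo, evenPartTwo, Matrix.mulVec, dotProduct, -mul_eq_mul_left_iff]
  rw [kappa]
  field_simp
  ring

/-- Explicit Gaussian elimination. The multipliers of the three rows in the first combination are `2
/ H` times the cofactors of the first column, so the other unknowns drop out and what remains is the
factorised determinant. The remaining unknowns follow one at a time from the zeros already found. -/
theorem evenGramTwo_injective {c H : K} (hg : IsGeneric c H) {y : Fin 3 → K}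
    (hy : (evenGramTwo c H).mulVec y = 0) : y = 0 := by
  have h0 := congrFun hy 0
  have h1 := congrFun hy 1
  have h2 := congrFun hy 2
  simp only [evenGramTwo, Matrix.mulVec, dotProduct, Fin.sum_univ_succ, Matrix.of_apply, Matrix.cons_val,
    Fin.succ_zero_eq_one, Fin.isValue, Fin.reduceSucc, Finset.univ_eq_empty, Finset.sum_empty,
    Pi.zero_apply] at h0 h1 h2
  have e0 : y 0 = 0 := by
    have e : (324) * linDet c 1 H 1 * evenDet c 1 H 1 * qpDet c 1 H 1 * H * y 0 = 0 := by
      unfold linDet evenDet qpDet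
      linear_combination (8 * c * H + 4 * c + 64 * H ^ 2 - 40 * H) * h0 + (27 * c ^ 2 - 918 * c *
        H - 54 * c + 1728 * H ^ 2 + 108 * H) * h1 + (360 * c * H ^ 2 - 144 * c * H - 11520 * H ^ 3
        + 3888 * H ^ 2 + 288 * H) * h2
    exact (mul_eq_zero.1 e).resolve_left (by simp [hg.weight, hg.weight_two, hg.weight_five, hg.lin,
      hg.even, hg.qp, hg.qpThree, hg.odd])
  have e1 : y 1 = 0 := by
    -- The factor `5 H - 2` is a pivot of this particular elimination, not a factor of the
    -- determinant.
    have e : (-24) * linDet c 1 H 1 * H * (5 * H - 2) * y 1 = 0 := by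
      unfold linDet
      linear_combination (4) * h0 + (15 * c - 480 * H - 30) * h1 - (162 * c ^ 2 * H ^ 2 - 324 * c
        ^ 2 * H - 10368 * c * H ^ 3 + 17496 * c * H ^ 2 - 1296 * c * H + 165888 * H ^ 4 - 228096 *
        H ^ 3 + 47304 * H ^ 2 + 3888 * H) * e0
    exact (mul_eq_zero.1 e).resolve_left (by simp [hg.weight, hg.weight_two, hg.weight_five, hg.lin,
      hg.even, hg.qp, hg.qpThree, hg.odd])
  have e2 : y 2 = 0 := by
    have e : (45) * linDet c 1 H 1 * H * y 2 = 0 := by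
      unfold linDet
      linear_combination (2) * h0 - (81 * c ^ 2 * H ^ 2 + 81 / 2 * c ^ 2 * H - 5184 * c * H ^ 3 -
        4212 * c * H ^ 2 - 1458 * c * H + 82944 * H ^ 4 + 93312 * H ^ 3 + 49572 * H ^ 2 + 2754 *
        H) * e0 - (-54 * c * H + 1728 * H ^ 2 + 108 * H) * e1
    exact (mul_eq_zero.1 e).resolve_left (by simp [hg.weight, hg.weight_two, hg.weight_five, hg.lin,
      hg.even, hg.qp, hg.qpThree, hg.odd])
  funext i
  fin_cases i <;> assumption

/-- The solution of the even system of level two. -/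
noncomputable def evenSolutionTwo (c h H : K) : Fin 3 → K :=
  ![(-1 / 18 * c * H + 16 / 9 * H * h - 1 / 9 * H + 2 / 9 * h) / (linDet c 1 H 1 * evenDet c 1 H 1),
    (1 / 8 * c ^ 2 * H - 1 / 4 * c ^ 2 - 8 * c * H ^ 2 + 9 * c * H + 9 / 2 * c * h + 1 / 2 * c + 128 * H ^ 3 - 32 * H ^ 2 - 144 * H * h - 5 / 2 * H - 9 * h) / (linDet c 1 H 1 * evenDet c 1 H 1),
    (-2 * c * H ^ 2 + 2 * c * H * h + c * H - 2 * c * h + 64 * H ^ 3 - 64 * H ^ 2 * h - 28 * H ^ 2 + 60 * H * h - 2 * H + 4 * h) / (linDet c 1 H 1 * evenDet c 1 H 1)]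

/-- The rescaled even matrix elements of level two. -/
def evenRightTwo (c h H : K) : Fin 3 → K :=
  ![-9 / 4 * c * H ^ 2 - 27 / 4 * c * H + 72 * H ^ 2 * h + 297 / 2 * H ^ 2 + 72 * H * h + 27 / 2 *
    H, H ^ 2 + H, H + h]

/-- The rescaled even adjoint matrix elements of level two. -/
def evenLeftTwo (c h H : K) : Fin 3 → K :=
  ![-9 / 4 * c * H ^ 2 - 27 / 4 * c * H + 72 * H ^ 2 * h + 297 / 2 * H ^ 2 + 72 * H * h + 27 / 2 *
    H, H ^ 2 + H, H + h]

theorem evenGramTwo_mulVec {c H : K} (hg : IsGeneric c H) (h : K) :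
    (evenGramTwo c H).mulVec (evenSolutionTwo c h H) = evenRightTwo c h H := by
  have hA := hg.lin
  have hE := hg.even
  funext i
  fin_cases i <;>
    simp [evenGramTwo, evenSolutionTwo, evenRightTwo, Matrix.mulVec, dotProduct, Fin.sum_univ_succ] <;>
    field_simp <;>
    simp only [linDet, evenDet, oddDet] <;>
    ring

/-- One factor `22 + 5 c` removes both `κ`, through `(22 + 5 c) κ = 1`, and `u²`, through the
semi-degeneracy relation. What is left is a polynomial in `c`, `h` and `H`. -/
theorem evenRightTwo_0 {c h u : K} (H : K) (hh : h ≠ 0) (hk : 22 + 5 * c ≠ 0)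
    (hu : (22 + 5 * c) * u ^ 2 = linDet c 1 h 1) :
    (22 + 5 * c) * rightElement c H 0 h (u * h) h (-(u * h)) (wordsTwo 0) =
      evenRightTwo c h H 0 := by
  simp only [wordsTwo, evenRightTwo, linDet, Matrix.cons_val, rightElement_W1_W1 _ _ _ _ hh] at hu ⊢
  linear_combination (144 * H ^ 2 + 144 / 5 * H) * mul_kappa hk + (9 / 4 * H ^ 2 + 9 / 4 * H) * hu


theorem evenLeftTwo_0 {c h u : K} (H : K) (hh : h ≠ 0) (hk : 22 + 5 * c ≠ 0)
    (hu : (22 + 5 * c) * u ^ 2 = linDet c 1 h 1) :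
    (22 + 5 * c) * leftElement c H 0 h (u * h) h (-(u * h)) (wordsTwo 0) =
      evenLeftTwo c h H 0 := by
  simp only [wordsTwo, evenLeftTwo, linDet, Matrix.cons_val, leftElement_W1_W1 _ _ _ _ hh] at hu ⊢
  linear_combination (144 * H ^ 2 + 144 / 5 * H) * mul_kappa hk + (9 / 4 * H ^ 2 + 9 / 4 * H) * hu


theorem evenRightTwo_1 {c h u : K} (H : K) (hh : h ≠ 0) :
    rightElement c H 0 h (u * h) h (-(u * h)) (wordsTwo 3) =
      evenRightTwo c h H 1 := by
  simp only [wordsTwo, evenRightTwo, Matrix.cons_val, rightElement_L1_L1 _ _ _ _ hh]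


theorem evenLeftTwo_1 {c h u : K} (H : K) (hh : h ≠ 0) :
    leftElement c H 0 h (u * h) h (-(u * h)) (wordsTwo 3) =
      evenLeftTwo c h H 1 := by
  simp only [wordsTwo, evenLeftTwo, Matrix.cons_val, leftElement_L1_L1 _ _ _ _ hh]


theorem evenRightTwo_2 {c h u : K} (H : K) (hh : h ≠ 0) :
    rightElement c H 0 h (u * h) h (-(u * h)) (wordsTwo 4) =
      evenRightTwo c h H 2 := by
  simp only [wordsTwo, evenRightTwo, Matrix.cons_val, rightElement_L2 _ _ _ _ hh]


theorem evenLeftTwo_2 {c h u : K} (H : K) (hh : h ≠ 0) :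
    leftElement c H 0 h (u * h) h (-(u * h)) (wordsTwo 4) =
      evenLeftTwo c h H 2 := by
  simp only [wordsTwo, evenLeftTwo, Matrix.cons_val, leftElement_L2 _ _ _ _ hh]


/-- The odd block of the Gram matrix of level two, cleared of denominators `22 + 5 c`. -/
def oddGramTwo (c H : K) : Matrix (Fin 2) (Fin 2) K :=
  !![
    -36 * c * H - 288 * H ^ 2 - 216 * H,
    18 * c * H - 576 * H ^ 2 - 36 * H;
    18 * c * H - 576 * H ^ 2 - 36 * H,
    9 * c * H ^ 2 + 9 * c * H - 288 * H ^ 3 - 306 * H ^ 2 - 18 * H]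

/-- The rescaled odd components of a vector of level two. -/
noncomputable def oddPartTwo (c : K) (x : Fin 5 → K) : Fin 2 → K :=
  ![x 1, x 2]

theorem oddGramTwo_row_0 {c : K} (hk : 22 + 5 * c ≠ 0) (H : K) (x : Fin 5 → K) :
    (22 + 5 * c) ^ 1 * ∑ j, gram c H 0 (wordsTwo 1) (wordsTwo j) * x j =
      (oddGramTwo c H).mulVec (oddPartTwo c x) 0 := by
  simp [Fin.sum_univ_succ, wordsTwo, oddGramTwo, oddPartTwo, Matrix.mulVec, dotProduct, -mul_eq_mul_left_iff]
  rw [kappa]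
  field_simp
  ring

theorem oddGramTwo_row_1 {c : K} (hk : 22 + 5 * c ≠ 0) (H : K) (x : Fin 5 → K) :
    (22 + 5 * c) ^ 1 * ∑ j, gram c H 0 (wordsTwo 2) (wordsTwo j) * x j =
      (oddGramTwo c H).mulVec (oddPartTwo c x) 1 := by
  simp [Fin.sum_univ_succ, wordsTwo, oddGramTwo, oddPartTwo, Matrix.mulVec, dotProduct, -mul_eq_mul_left_iff]
  rw [kappa]
  field_simp
  ring

theorem oddGramTwo_injective {c H : K} (hg : IsGeneric c H) {y : Fin 2 → K}
    (hy : (oddGramTwo c H).mulVec y = 0) : y = 0 := by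
  have h0 := congrFun hy 0
  have h1 := congrFun hy 1
  simp only [oddGramTwo, Matrix.mulVec, dotProduct, Fin.sum_univ_succ, Matrix.of_apply, Matrix.cons_val,
    Fin.succ_zero_eq_one, Fin.isValue, Fin.reduceSucc, Finset.univ_eq_empty, Finset.sum_empty,
    Pi.zero_apply] at h0 h1
  have e0 : y 0 = 0 := by
    have e : (36) * qpDet c 1 H 1 * H * y 0 = 0 := by
      unfold qpDet
      linear_combination (-H - 1) * h0 + (2) * h1
    exact (mul_eq_zero.1 e).resolve_left (by simp [hg.weight, hg.weight_two, hg.weight_five, hg.lin,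
      hg.even, hg.qp, hg.qpThree, hg.odd])
  have e1 : y 1 = 0 := by
    have e : (-18) * linDet c 1 H 1 * H * y 1 = 0 := by
      unfold linDet
      linear_combination (1) * h0 - (-36 * c * H - 288 * H ^ 2 - 216 * H) * e0
    exact (mul_eq_zero.1 e).resolve_left (by simp [hg.weight, hg.weight_two, hg.weight_five, hg.lin,
      hg.even, hg.qp, hg.qpThree, hg.odd])
  funext i
  fin_cases i <;> assumption

/-- The solution of the odd system of level two. -/
noncomputable def oddSolutionTwo (c h H : K) : Fin 2 → K :=
  ![0,
    (1 / 6) / (linDet c 1 H 1)]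

/-- The rescaled odd matrix elements of level two. -/
def oddRightTwo (c h H : K) : Fin 2 → K :=
  ![-3 * H, -3 / 2 * H ^ 2 - 3 / 2 * H]

/-- The rescaled odd adjoint matrix elements of level two. -/
def oddLeftTwo (c h H : K) : Fin 2 → K :=
  ![3 * H, 3 / 2 * H ^ 2 + 3 / 2 * H]

/-- The vector of matrix elements is proportional to the second column: the odd sector of level two
contributes only the `L₋₁` descendant of `W₋₁`. For this reason `qpDet` is absent from the
denominators and is needed only to exclude null vectors. -/
theorem oddGramTwo_mulVec {c H : K} (hg : IsGeneric c H) (h : K) :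
    (oddGramTwo c H).mulVec (oddSolutionTwo c h H) = oddRightTwo c h H := by
  have hA := hg.lin
  funext i
  fin_cases i <;>
    simp [oddGramTwo, oddSolutionTwo, oddRightTwo, Matrix.mulVec, dotProduct, Fin.sum_univ_succ] <;>
    field_simp <;>
    simp only [linDet, evenDet, oddDet] <;>
    ring

theorem oddRightTwo_0 {c h u : K} (H : K) (hh : h ≠ 0) :
    rightElement c H 0 h (u * h) h (-(u * h)) (wordsTwo 1) =
      u * oddRightTwo c h H 0 := by
  simp only [wordsTwo, oddRightTwo, Matrix.cons_val, rightElement_W2 _ _ _ _ hh]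
  ring


theorem oddLeftTwo_0 {c h u : K} (H : K) (hh : h ≠ 0) :
    leftElement c H 0 h (u * h) h (-(u * h)) (wordsTwo 1) =
      u * oddLeftTwo c h H 0 := by
  simp only [wordsTwo, oddLeftTwo, Matrix.cons_val, leftElement_W2 _ _ _ _ hh]
  ring


theorem oddRightTwo_1 {c h u : K} (H : K) (hh : h ≠ 0) :
    rightElement c H 0 h (u * h) h (-(u * h)) (wordsTwo 2) =
      u * oddRightTwo c h H 1 := by
  simp only [wordsTwo, oddRightTwo, Matrix.cons_val, rightElement_L1_W1 _ _ _ _ hh]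
  ring


theorem oddLeftTwo_1 {c h u : K} (H : K) (hh : h ≠ 0) :
    leftElement c H 0 h (u * h) h (-(u * h)) (wordsTwo 2) =
      u * oddLeftTwo c h H 1 := by
  simp only [wordsTwo, oddLeftTwo, Matrix.cons_val, leftElement_L1_W1 _ _ _ _ hh]
  ring


/-- The basis monomials of level three. -/
def wordsThree : Fin 10 → Word :=
  ![[.W (-1), .W (-1), .W (-1)], [.W (-2), .W (-1)], [.W (-3)], [.L (-1), .W (-1), .W (-1)], [.L
    (-1), .W (-2)], [.L (-1), .L (-1), .W (-1)], [.L (-2), .W (-1)], [.L (-1), .L (-1), .L (-1)],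
    [.L (-2), .L (-1)], [.L (-3)]]

theorem basis_three_get (i : Fin 10) :
    (basis 3).get (Fin.cast (by decide) i) = wordsThree i := by
  fin_cases i <;> rfl

/-- The even block of the Gram matrix of level three, cleared of denominators `22 + 5 c`. -/
def evenGramThree (c H : K) : Matrix (Fin 5) (Fin 5) K :=
  !![
    -162 * c ^ 2 * H ^ 2 - 162 * c ^ 2 * H + 3888 * c * H ^ 3 + 1944 * c * H ^ 2 - 1944 * c * H +
      41472 * H ^ 4 + 116640 * H ^ 3 + 79704 * H ^ 2 + 4536 * H,
    162 * c ^ 2 * H ^ 2 + 81 * c ^ 2 * H - 10368 * c * H ^ 3 - 8424 * c * H ^ 2 - 2916 * c * H +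
      165888 * H ^ 4 + 186624 * H ^ 3 + 99144 * H ^ 2 + 5508 * H,
    -108 * c * H + 3456 * H ^ 2 + 216 * H,
    -54 * c * H + 1728 * H ^ 2 + 108 * H,
    -36 * c * H + 1152 * H ^ 2 + 72 * H;
    162 * c ^ 2 * H ^ 2 + 81 * c ^ 2 * H - 10368 * c * H ^ 3 - 8424 * c * H ^ 2 - 2916 * c * H +
      165888 * H ^ 4 + 186624 * H ^ 3 + 99144 * H ^ 2 + 5508 * H,
    81 * c ^ 2 * H ^ 3 + 405 / 2 * c ^ 2 * H ^ 2 + 891 / 2 * c ^ 2 * H - 5184 * c * H ^ 4 - 14580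
      * c * H ^ 3 - 33210 * c * H ^ 2 - 4374 * c * H + 82944 * H ^ 5 + 259200 * H ^ 4 + 609444 * H
      ^ 3 + 148554 * H ^ 2 + 6966 * H,
    -162 * c * H ^ 2 - 162 * c * H + 5184 * H ^ 3 + 5508 * H ^ 2 + 324 * H,
    -45 * c * H ^ 2 - 81 * c * H + 1440 * H ^ 3 + 2682 * H ^ 2 + 162 * H,
    -90 * c * H + 2880 * H ^ 2 + 180 * H;
    -108 * c * H + 3456 * H ^ 2 + 216 * H,
    -162 * c * H ^ 2 - 162 * c * H + 5184 * H ^ 3 + 5508 * H ^ 2 + 324 * H,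
    48 * H ^ 3 + 72 * H ^ 2 + 24 * H,
    36 * H ^ 2 + 12 * H,
    24 * H;
    -54 * c * H + 1728 * H ^ 2 + 108 * H,
    -45 * c * H ^ 2 - 81 * c * H + 1440 * H ^ 3 + 2682 * H ^ 2 + 162 * H,
    36 * H ^ 2 + 12 * H,
    c * H + 8 * H ^ 2 + 8 * H,
    10 * H;
    -36 * c * H + 1152 * H ^ 2 + 72 * H,
    -90 * c * H + 2880 * H ^ 2 + 180 * H,
    24 * H,
    10 * H,
    2 * c + 6 * H]

/-- The rescaled even components of a vector of level three. -/
noncomputable def evenPartThree (c : K) (x : Fin 10 → K) : Fin 5 → K :=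
  ![kappa c * x 1, kappa c * x 3, x 7, x 8, x 9]

theorem evenGramThree_row_0 {c : K} (hk : 22 + 5 * c ≠ 0) (H : K) (x : Fin 10 → K) :
    (22 + 5 * c) ^ 1 * ∑ j, gram c H 0 (wordsThree 1) (wordsThree j) * x j =
      (evenGramThree c H).mulVec (evenPartThree c x) 0 := by
  simp [Fin.sum_univ_succ, wordsThree, evenGramThree, evenPartThree, Matrix.mulVec, dotProduct, -mul_eq_mul_left_iff]
  rw [kappa]
  field_simp
  ring

theorem evenGramThree_row_1 {c : K} (hk : 22 + 5 * c ≠ 0) (H : K) (x : Fin 10 → K) :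
    (22 + 5 * c) ^ 1 * ∑ j, gram c H 0 (wordsThree 3) (wordsThree j) * x j =
      (evenGramThree c H).mulVec (evenPartThree c x) 1 := by
  simp [Fin.sum_univ_succ, wordsThree, evenGramThree, evenPartThree, Matrix.mulVec, dotProduct, -mul_eq_mul_left_iff]
  rw [kappa]
  field_simp
  ring

theorem evenGramThree_row_2 {c : K} (hk : 22 + 5 * c ≠ 0) (H : K) (x : Fin 10 → K) :
    (22 + 5 * c) ^ 0 * ∑ j, gram c H 0 (wordsThree 7) (wordsThree j) * x j =
      (evenGramThree c H).mulVec (evenPartThree c x) 2 := by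
  simp [Fin.sum_univ_succ, wordsThree, evenGramThree, evenPartThree, Matrix.mulVec, dotProduct, -mul_eq_mul_left_iff]
  rw [kappa]
  field_simp
  ring

theorem evenGramThree_row_3 {c : K} (hk : 22 + 5 * c ≠ 0) (H : K) (x : Fin 10 → K) :
    (22 + 5 * c) ^ 0 * ∑ j, gram c H 0 (wordsThree 8) (wordsThree j) * x j =
      (evenGramThree c H).mulVec (evenPartThree c x) 3 := by
  simp [Fin.sum_univ_succ, wordsThree, evenGramThree, evenPartThree, Matrix.mulVec, dotProduct, -mul_eq_mul_left_iff]
  rw [kappa]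
  field_simp
  ring

theorem evenGramThree_row_4 {c : K} (hk : 22 + 5 * c ≠ 0) (H : K) (x : Fin 10 → K) :
    (22 + 5 * c) ^ 0 * ∑ j, gram c H 0 (wordsThree 9) (wordsThree j) * x j =
      (evenGramThree c H).mulVec (evenPartThree c x) 4 := by
  simp [Fin.sum_univ_succ, wordsThree, evenGramThree, evenPartThree, Matrix.mulVec, dotProduct, -mul_eq_mul_left_iff]
  rw [kappa]
  field_simp
  ring

/-- Elimination as at level two. Each combination of rows leaves a single new unknown, multiplied by
factors that `IsGeneric` keeps non-zero, up to unknowns already known to vanish; `H - 2` and `5 H -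
2` enter through the choice of pivots. -/
theorem evenGramThree_injective {c H : K} (hg : IsGeneric c H) {y : Fin 5 → K}
    (hy : (evenGramThree c H).mulVec y = 0) : y = 0 := by
  have h0 := congrFun hy 0
  have h1 := congrFun hy 1
  have h2 := congrFun hy 2
  have h3 := congrFun hy 3
  have h4 := congrFun hy 4
  simp only [evenGramThree, Matrix.mulVec, dotProduct, Fin.sum_univ_succ, Matrix.of_apply, Matrix.cons_val,
    Fin.succ_zero_eq_one, Fin.isValue, Fin.reduceSucc, Finset.univ_eq_empty, Finset.sum_empty,
    Pi.zero_apply] at h0 h1 h2 h3 h4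
  have e0 : y 0 = 0 := by
    have e : (324) * qpDetThree c 1 H 1 * linDet c 1 H 1 * qpDet c 1 H 1 * H * H * y 0 = 0 := by
      unfold qpDetThree linDet qpDet
      linear_combination (2 * c * H ^ 2 + 6 * c * H + 4 * c + 6 * H ^ 3 - 2 * H ^ 2 - 24 * H + 8)
        * h0 + (-4 * c * H - 4 * c - 12 * H ^ 2 + 28 * H - 8) * h1 + (-9 * c ^ 2 + 297 * c * H -
        288 * H ^ 2 + 558 * H + 36) * h2 + (-72 * c * H ^ 2 + 144 * c * H + 2304 * H ^ 3 - 4464 *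
        H ^ 2 - 288 * H) * h3 + (36 * c * H ^ 3 - 72 * c * H ^ 2 - 1152 * H ^ 4 + 2232 * H ^ 3 +
        144 * H ^ 2) * h4
    exact (mul_eq_zero.1 e).resolve_left (by simp [hg.weight, hg.weight_two, hg.weight_five, hg.lin,
      hg.even, hg.qp, hg.qpThree, hg.odd])
  have e1 : y 1 = 0 := by
    have e : (-648) * linDet c 1 H 1 * evenDet c 1 H 1 * qpDet c 1 H 1 * H * (H - 2) * y 1 = 0 := by
      unfold linDet evenDet qpDet
      linear_combination (-10 * c * H ^ 2 - 6 * c * H + 4 * c - 30 * H ^ 3 + 82 * H ^ 2 - 48 * H +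
        8) * h0 + (12 * c * H - 4 * H ^ 2 + 12 * H - 8) * h1 + (18 * c ^ 2 - 567 * c * H - 54 * c
        - 288 * H ^ 2 + 558 * H + 36) * h2 + (-180 * c * H ^ 3 + 432 * c * H ^ 2 - 144 * c * H +
        5760 * H ^ 4 - 13464 * H ^ 3 + 3744 * H ^ 2 + 288 * H) * h4 - (1620 * c ^ 3 * H ^ 4 + 4536
        * c ^ 3 * H ^ 3 + 1296 * c ^ 3 * H ^ 2 - 2592 * c ^ 3 * H - 34020 * c ^ 2 * H ^ 5 - 169776
        * c ^ 2 * H ^ 4 - 97200 * c ^ 2 * H ^ 3 + 119232 * c ^ 2 * H ^ 2 - 531360 * c * H ^ 6 +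
        462672 * c * H ^ 5 + 1818288 * c * H ^ 4 - 1293408 * c * H ^ 3 + 108864 * c * H ^ 2 +
        10368 * c * H - 1244160 * H ^ 7 + 5873472 * H ^ 6 - 8668944 * H ^ 5 + 3996864 * H ^ 4 -
        378432 * H ^ 3 - 41472 * H ^ 2) * e0
    exact (mul_eq_zero.1 e).resolve_left (by simp [hg.weight, hg.weight_two, hg.weight_five, hg.lin,
      hg.even, hg.qp, hg.qpThree, hg.odd])
  have e4 : y 4 = 0 := by
    have e : (-36) * linDet c 1 H 1 * H * (H - 2) * (5 * H - 2) * y 4 = 0 := by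
      unfold linDet
      linear_combination (-5 * H ^ 2 - 3 * H + 2) * h0 + (6 * H) * h1 + (9 * c - 288 * H - 18) *
        h2 - (810 * c ^ 2 * H ^ 4 + 2268 * c ^ 2 * H ^ 3 + 648 * c ^ 2 * H ^ 2 - 1296 * c ^ 2 * H
        - 19440 * c * H ^ 5 - 83592 * c * H ^ 4 - 38880 * c * H ^ 3 + 54432 * c * H ^ 2 - 207360 *
        H ^ 6 + 287712 * H ^ 5 + 454248 * H ^ 4 - 428976 * H ^ 3 + 54432 * H ^ 2 + 5184 * H) * e0
        - (-324 * c ^ 2 * H ^ 4 + 324 * c ^ 2 * H ^ 3 + 1296 * c ^ 2 * H ^ 2 - 1296 * c ^ 2 * H +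
        20736 * c * H ^ 5 - 14256 * c * H ^ 4 - 86832 * c * H ^ 3 + 64800 * c * H ^ 2 - 331776 * H
        ^ 6 + 124416 * H ^ 5 + 1439856 * H ^ 4 - 740016 * H ^ 3 + 31104 * H ^ 2 + 5184 * H) * e1
    exact (mul_eq_zero.1 e).resolve_left (by simp [hg.weight, hg.weight_two, hg.weight_five, hg.lin,
      hg.even, hg.qp, hg.qpThree, hg.odd])
  have e2 : y 2 = 0 := by
    have e : (-432) * linDet c 1 H 1 * H * H * y 2 = 0 := by
      unfold linDet
      linear_combination (5 * H + 9) * h0 + (-6) * h1 - (-810 * c ^ 2 * H ^ 3 - 3240 * c ^ 2 * H ^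
        2 - 1944 * c ^ 2 * H + 19440 * c * H ^ 4 + 106920 * c * H ^ 3 + 58320 * c * H ^ 2 + 207360
        * H ^ 5 - 38880 * H ^ 4 + 328536 * H ^ 3 + 145152 * H ^ 2 + 7776 * H) * e0 - (324 * c ^ 2
        * H ^ 3 + 648 * c ^ 2 * H ^ 2 - 1944 * c ^ 2 * H - 20736 * c * H ^ 4 - 47952 * c * H ^ 3 +
        108864 * c * H ^ 2 + 331776 * H ^ 5 + 870912 * H ^ 4 - 1481328 * H ^ 3 + 28512 * H ^ 2 +
        7776 * H) * e1 - (-180 * c * H ^ 2 + 216 * c * H + 5760 * H ^ 3 - 6552 * H ^ 2 - 432 * H)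
        * e4
    exact (mul_eq_zero.1 e).resolve_left (by simp [hg.weight, hg.weight_two, hg.weight_five, hg.lin,
      hg.even, hg.qp, hg.qpThree, hg.odd])
  have e3 : y 3 = 0 := by
    have e : (54) * linDet c 1 H 1 * H * y 3 = 0 := by
      unfold linDet
      linear_combination (1) * h0 - (-162 * c ^ 2 * H ^ 2 - 162 * c ^ 2 * H + 3888 * c * H ^ 3 +
        1944 * c * H ^ 2 - 1944 * c * H + 41472 * H ^ 4 + 116640 * H ^ 3 + 79704 * H ^ 2 + 4536 *
        H) * e0 - (162 * c ^ 2 * H ^ 2 + 81 * c ^ 2 * H - 10368 * c * H ^ 3 - 8424 * c * H ^ 2 -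
        2916 * c * H + 165888 * H ^ 4 + 186624 * H ^ 3 + 99144 * H ^ 2 + 5508 * H) * e1 - (-36 * c
        * H + 1152 * H ^ 2 + 72 * H) * e4 - (-108 * c * H + 3456 * H ^ 2 + 216 * H) * e2
    exact (mul_eq_zero.1 e).resolve_left (by simp [hg.weight, hg.weight_two, hg.weight_five, hg.lin,
      hg.even, hg.qp, hg.qpThree, hg.odd])
  funext i
  fin_cases i <;> assumption

/-- The solution of the even system of level three. -/
noncomputable def evenSolutionThree (c h H : K) : Fin 5 → K :=
  ![0,
    (-1 / 36 * c * H + 8 / 9 * H * h - 1 / 18 * H + 1 / 9 * h) / (linDet c 1 H 1 * evenDet c 1 H 1),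
    (1 / 48 * c ^ 2 * H - 1 / 12 * c ^ 2 - 4 / 3 * c * H ^ 2 + 8 / 3 * c * H + 9 / 4 * c * h + 1 / 6 * c + 64 / 3 * H ^ 3 - 72 * H * h - 1 / 12 * H - 9 / 2 * h) / (linDet c 1 H 1 * evenDet c 1 H 1),
    (-c * H ^ 2 + c * H * h + 1 / 2 * c * H - c * h + 32 * H ^ 3 - 32 * H ^ 2 * h - 14 * H ^ 2 + 30 * H * h - H + 2 * h) / (linDet c 1 H 1 * evenDet c 1 H 1),
    (-c * H ^ 2 + c * H * h + 1 / 2 * c * H - c * h + 32 * H ^ 3 - 32 * H ^ 2 * h - 14 * H ^ 2 + 30 * H * h - H + 2 * h) / (linDet c 1 H 1 * evenDet c 1 H 1)]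

/-- The rescaled even matrix elements of level three. -/
def evenRightThree (c h H : K) : Fin 5 → K :=
  ![-9 / 2 * c * H ^ 2 - 9 * c * H + 144 * H ^ 2 * h + 153 * H ^ 2 + 144 * H * h + 18 * H, -9 / 4
    * c * H ^ 3 - 45 / 4 * c * H ^ 2 - 27 / 2 * c * H + 72 * H ^ 3 * h + 297 / 2 * H ^ 3 + 216 * H
    ^ 2 * h + 621 / 2 * H ^ 2 + 144 * H * h + 27 * H, H ^ 3 + 3 * H ^ 2 + 2 * H, H ^ 2 + H * h +
    H, H + 2 * h]

/-- The rescaled even adjoint matrix elements of level three. -/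
def evenLeftThree (c h H : K) : Fin 5 → K :=
  ![-9 / 2 * c * H ^ 2 - 9 * c * H + 144 * H ^ 2 * h + 153 * H ^ 2 + 144 * H * h + 18 * H, -9 / 4
    * c * H ^ 3 - 45 / 4 * c * H ^ 2 - 27 / 2 * c * H + 72 * H ^ 3 * h + 297 / 2 * H ^ 3 + 216 * H
    ^ 2 * h + 621 / 2 * H ^ 2 + 144 * H * h + 27 * H, H ^ 3 + 3 * H ^ 2 + 2 * H, H ^ 2 + H * h +
    H, H + 2 * h]

/-- The solution has no component along `W₋₂ W₋₁` and the same denominators as at level two; its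
component along `L₋₁ W₋₁ W₋₁` is half of the level-two one along `W₋₁ W₋₁`. The even sector acquires
no new pole at level three, and `qpDetThree` enters only the invertibility argument. -/
theorem evenGramThree_mulVec {c H : K} (hg : IsGeneric c H) (h : K) :
    (evenGramThree c H).mulVec (evenSolutionThree c h H) = evenRightThree c h H := by
  have hA := hg.lin
  have hE := hg.even
  funext i
  fin_cases i <;>
    simp [evenGramThree, evenSolutionThree, evenRightThree, Matrix.mulVec, dotProduct, Fin.sum_univ_succ] <;>
    field_simp <;>
    simp only [linDet, evenDet, oddDet] <;>
    ring

theorem evenRightThree_0 {c h u : K} (H : K) (hh : h ≠ 0) (hk : 22 + 5 * c ≠ 0)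
    (hu : (22 + 5 * c) * u ^ 2 = linDet c 1 h 1) :
    (22 + 5 * c) * rightElement c H 0 h (u * h) h (-(u * h)) (wordsThree 1) =
      evenRightThree c h H 0 := by
  simp only [wordsThree, evenRightThree, linDet, Matrix.cons_val, rightElement_W2_W1 _ _ _ _ hh] at hu ⊢
  linear_combination (144 * H ^ 2 + 144 / 5 * H) * mul_kappa hk + (9 / 2 * H ^ 2 + 9 / 2 * H) * hu


theorem evenLeftThree_0 {c h u : K} (H : K) (hh : h ≠ 0) (hk : 22 + 5 * c ≠ 0)
    (hu : (22 + 5 * c) * u ^ 2 = linDet c 1 h 1) :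
    (22 + 5 * c) * leftElement c H 0 h (u * h) h (-(u * h)) (wordsThree 1) =
      evenLeftThree c h H 0 := by
  simp only [wordsThree, evenLeftThree, linDet, Matrix.cons_val, leftElement_W2_W1 _ _ _ _ hh] at hu ⊢
  linear_combination (144 * H ^ 2 + 144 / 5 * H) * mul_kappa hk + (9 / 2 * H ^ 2 + 9 / 2 * H) * hu


theorem evenRightThree_1 {c h u : K} (H : K) (hh : h ≠ 0) (hk : 22 + 5 * c ≠ 0)
    (hu : (22 + 5 * c) * u ^ 2 = linDet c 1 h 1) :
    (22 + 5 * c) * rightElement c H 0 h (u * h) h (-(u * h)) (wordsThree 3) =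
      evenRightThree c h H 1 := by
  simp only [wordsThree, evenRightThree, linDet, Matrix.cons_val, rightElement_L1_W1_W1 _ _ _ _ hh] at hu ⊢
  linear_combination (144 * H ^ 3 + 1584 / 5 * H ^ 2 + 288 / 5 * H) * mul_kappa hk + (9 / 4 * H ^
    3 + 27 / 4 * H ^ 2 + 9 / 2 * H) * hu


theorem evenLeftThree_1 {c h u : K} (H : K) (hh : h ≠ 0) (hk : 22 + 5 * c ≠ 0)
    (hu : (22 + 5 * c) * u ^ 2 = linDet c 1 h 1) :
    (22 + 5 * c) * leftElement c H 0 h (u * h) h (-(u * h)) (wordsThree 3) =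
      evenLeftThree c h H 1 := by
  simp only [wordsThree, evenLeftThree, linDet, Matrix.cons_val, leftElement_L1_W1_W1 _ _ _ _ hh] at hu ⊢
  linear_combination (144 * H ^ 3 + 1584 / 5 * H ^ 2 + 288 / 5 * H) * mul_kappa hk + (9 / 4 * H ^
    3 + 27 / 4 * H ^ 2 + 9 / 2 * H) * hu


theorem evenRightThree_2 {c h u : K} (H : K) (hh : h ≠ 0) :
    rightElement c H 0 h (u * h) h (-(u * h)) (wordsThree 7) =
      evenRightThree c h H 2 := by
  simp only [wordsThree, evenRightThree, Matrix.cons_val, rightElement_L1_L1_L1 _ _ _ _ hh]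


theorem evenLeftThree_2 {c h u : K} (H : K) (hh : h ≠ 0) :
    leftElement c H 0 h (u * h) h (-(u * h)) (wordsThree 7) =
      evenLeftThree c h H 2 := by
  simp only [wordsThree, evenLeftThree, Matrix.cons_val, leftElement_L1_L1_L1 _ _ _ _ hh]


theorem evenRightThree_3 {c h u : K} (H : K) (hh : h ≠ 0) :
    rightElement c H 0 h (u * h) h (-(u * h)) (wordsThree 8) =
      evenRightThree c h H 3 := by
  simp only [wordsThree, evenRightThree, Matrix.cons_val, rightElement_L2_L1 _ _ _ _ hh]


theorem evenLeftThree_3 {c h u : K} (H : K) (hh : h ≠ 0) :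
    leftElement c H 0 h (u * h) h (-(u * h)) (wordsThree 8) =
      evenLeftThree c h H 3 := by
  simp only [wordsThree, evenLeftThree, Matrix.cons_val, leftElement_L2_L1 _ _ _ _ hh]


theorem evenRightThree_4 {c h u : K} (H : K) (hh : h ≠ 0) :
    rightElement c H 0 h (u * h) h (-(u * h)) (wordsThree 9) =
      evenRightThree c h H 4 := by
  simp only [wordsThree, evenRightThree, Matrix.cons_val, rightElement_L3 _ _ _ _ hh]


theorem evenLeftThree_4 {c h u : K} (H : K) (hh : h ≠ 0) :
    leftElement c H 0 h (u * h) h (-(u * h)) (wordsThree 9) =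
      evenLeftThree c h H 4 := by
  simp only [wordsThree, evenLeftThree, Matrix.cons_val, leftElement_L3 _ _ _ _ hh]


/-- The odd block of the Gram matrix of level three, cleared of denominators `22 + 5 c`. -/
def oddGramThree (c H : K) : Matrix (Fin 5) (Fin 5) K :=
  !![
    2187 / 4 * c ^ 3 * H ^ 3 + 6561 / 8 * c ^ 3 * H ^ 2 + 2187 / 8 * c ^ 3 * H - 52488 * c ^ 2 * H
      ^ 4 - 216513 / 2 * c ^ 2 * H ^ 3 - 929475 / 4 * c ^ 2 * H ^ 2 - 519777 / 4 * c ^ 2 * H +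
      1679616 * c * H ^ 5 + 4408992 * c * H ^ 4 + 14423265 * c * H ^ 3 + 19755171 / 2 * c * H ^ 2
      + 1966113 / 2 * c * H - 17915904 * H ^ 6 - 57106944 * H ^ 5 - 232556832 * H ^ 4 - 183689046
      * H ^ 3 - 33762177 * H ^ 2 - 1448523 * H,
    2025 / 2 * c ^ 2 * H - 19440 * c * H ^ 2 + 10206 * c * H - 414720 * H ^ 3 - 417312 * H ^ 2 -
      24462 * H,
    243 * c ^ 2 * H + 23328 * c * H ^ 2 + 14580 * c * H - 995328 * H ^ 3 - 544320 * H ^ 2 - 30132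
      * H,
    -729 / 2 * c ^ 2 * H ^ 2 - 1701 / 2 * c ^ 2 * H + 23328 * c * H ^ 3 + 59778 * c * H ^ 2 + 7290
      * c * H - 373248 * H ^ 4 - 1041984 * H ^ 3 - 242514 * H ^ 2 - 11178 * H,
    -1215 / 4 * c ^ 2 * H ^ 2 - 405 / 4 * c ^ 2 * H + 19440 * c * H ^ 3 + 10935 * c * H ^ 2 + 3645
      * c * H - 311040 * H ^ 4 - 246240 * H ^ 3 - 124335 * H ^ 2 - 6885 * H;
    2025 / 2 * c ^ 2 * H - 19440 * c * H ^ 2 + 10206 * c * H - 414720 * H ^ 3 - 417312 * H ^ 2 -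
      24462 * H,
    -15 / 2 * c ^ 2 - 333 / 2 * c * H - 33 * c - 432 * H ^ 2 - 819 * H,
    -180 * c * H - 1440 * H ^ 2 - 1080 * H,
    90 * c * H - 2880 * H ^ 2 - 180 * H,
    63 / 2 * c * H - 1008 * H ^ 2 - 63 * H;
    243 * c ^ 2 * H + 23328 * c * H ^ 2 + 14580 * c * H - 995328 * H ^ 3 - 544320 * H ^ 2 - 30132
      * H,
    -180 * c * H - 1440 * H ^ 2 - 1080 * H,
    -72 * c * H ^ 2 - 72 * c * H - 576 * H ^ 3 - 3888 * H ^ 2 - 1008 * H,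
    72 * c * H ^ 2 + 108 * c * H - 2304 * H ^ 3 - 3600 * H ^ 2 - 216 * H,
    54 * c * H - 1728 * H ^ 2 - 108 * H;
    -729 / 2 * c ^ 2 * H ^ 2 - 1701 / 2 * c ^ 2 * H + 23328 * c * H ^ 3 + 59778 * c * H ^ 2 + 7290
      * c * H - 373248 * H ^ 4 - 1041984 * H ^ 3 - 242514 * H ^ 2 - 11178 * H,
    90 * c * H - 2880 * H ^ 2 - 180 * H,
    72 * c * H ^ 2 + 108 * c * H - 2304 * H ^ 3 - 3600 * H ^ 2 - 216 * H,
    36 * c * H ^ 3 + 90 * c * H ^ 2 + 54 * c * H - 1152 * H ^ 4 - 2952 * H ^ 3 - 1908 * H ^ 2 -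
      108 * H,
    27 * c * H ^ 2 + 27 * c * H - 864 * H ^ 3 - 918 * H ^ 2 - 54 * H;
    -1215 / 4 * c ^ 2 * H ^ 2 - 405 / 4 * c ^ 2 * H + 19440 * c * H ^ 3 + 10935 * c * H ^ 2 + 3645
      * c * H - 311040 * H ^ 4 - 246240 * H ^ 3 - 124335 * H ^ 2 - 6885 * H,
    63 / 2 * c * H - 1008 * H ^ 2 - 63 * H,
    54 * c * H - 1728 * H ^ 2 - 108 * H,
    27 * c * H ^ 2 + 27 * c * H - 864 * H ^ 3 - 918 * H ^ 2 - 54 * H,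
    9 / 4 * c ^ 2 * H - 54 * c * H ^ 2 + 27 / 2 * c * H - 576 * H ^ 3 - 612 * H ^ 2 - 36 * H]

/-- The rescaled odd components of a vector of level three. -/
noncomputable def oddPartThree (c : K) (x : Fin 10 → K) : Fin 5 → K :=
  ![kappa c * x 0, x 2, x 4, x 5, x 6]

theorem oddGramThree_row_0 {c : K} (hk : 22 + 5 * c ≠ 0) (H : K) (x : Fin 10 → K) :
    (22 + 5 * c) ^ 2 * ∑ j, gram c H 0 (wordsThree 0) (wordsThree j) * x j =
      (oddGramThree c H).mulVec (oddPartThree c x) 0 := by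
  simp [Fin.sum_univ_succ, wordsThree, oddGramThree, oddPartThree, Matrix.mulVec, dotProduct, -mul_eq_mul_left_iff]
  rw [kappa]
  field_simp
  ring

theorem oddGramThree_row_1 {c : K} (hk : 22 + 5 * c ≠ 0) (H : K) (x : Fin 10 → K) :
    (22 + 5 * c) ^ 1 * ∑ j, gram c H 0 (wordsThree 2) (wordsThree j) * x j =
      (oddGramThree c H).mulVec (oddPartThree c x) 1 := by
  simp [Fin.sum_univ_succ, wordsThree, oddGramThree, oddPartThree, Matrix.mulVec, dotProduct, -mul_eq_mul_left_iff]
  rw [kappa]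
  field_simp
  ring

theorem oddGramThree_row_2 {c : K} (hk : 22 + 5 * c ≠ 0) (H : K) (x : Fin 10 → K) :
    (22 + 5 * c) ^ 1 * ∑ j, gram c H 0 (wordsThree 4) (wordsThree j) * x j =
      (oddGramThree c H).mulVec (oddPartThree c x) 2 := by
  simp [Fin.sum_univ_succ, wordsThree, oddGramThree, oddPartThree, Matrix.mulVec, dotProduct, -mul_eq_mul_left_iff]
  rw [kappa]
  field_simp
  ring

theorem oddGramThree_row_3 {c : K} (hk : 22 + 5 * c ≠ 0) (H : K) (x : Fin 10 → K) :
    (22 + 5 * c) ^ 1 * ∑ j, gram c H 0 (wordsThree 5) (wordsThree j) * x j =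
      (oddGramThree c H).mulVec (oddPartThree c x) 3 := by
  simp [Fin.sum_univ_succ, wordsThree, oddGramThree, oddPartThree, Matrix.mulVec, dotProduct, -mul_eq_mul_left_iff]
  rw [kappa]
  field_simp
  ring

theorem oddGramThree_row_4 {c : K} (hk : 22 + 5 * c ≠ 0) (H : K) (x : Fin 10 → K) :
    (22 + 5 * c) ^ 1 * ∑ j, gram c H 0 (wordsThree 6) (wordsThree j) * x j =
      (oddGramThree c H).mulVec (oddPartThree c x) 4 := by
  simp [Fin.sum_univ_succ, wordsThree, oddGramThree, oddPartThree, Matrix.mulVec, dotProduct, -mul_eq_mul_left_iff]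
  rw [kappa]
  field_simp
  ring

/-- The elimination starts from the component along `W₋₃`, which can be isolated without the factors
`linDet` and `H`. Three more components are isolated by combining all five rows, and the last one is
read from the row of `W₋₃`. -/
theorem oddGramThree_injective {c H : K} (hg : IsGeneric c H) {y : Fin 5 → K}
    (hy : (oddGramThree c H).mulVec y = 0) : y = 0 := by
  have h0 := congrFun hy 0
  have h1 := congrFun hy 1
  have h2 := congrFun hy 2
  have h3 := congrFun hy 3
  have h4 := congrFun hy 4
  simp only [oddGramThree, Matrix.mulVec, dotProduct, Fin.sum_univ_succ, Matrix.of_apply, Matrix.cons_val,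
    Fin.succ_zero_eq_one, Fin.isValue, Fin.reduceSucc, Finset.univ_eq_empty, Finset.sum_empty,
    Pi.zero_apply] at h0 h1 h2 h3 h4
  have e1 : y 1 = 0 := by
    have e : (81) * qpDetThree c 1 H 1 * oddDet c 1 H 1 * evenDet c 1 H 1 * qpDet c 1 H 1 * y 1 = 0 := by
      unfold qpDetThree oddDet evenDet qpDet
      linear_combination (-100 * c ^ 2 * H - 200 * c ^ 2 - 2500 * c * H ^ 2 - 2720 * c * H + 240 *
        c + 3200 * H ^ 3 + 10120 * H ^ 2 - 40880 * H + 15680) * h0 + (54 * c ^ 3 * H ^ 3 + 270 * c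
        ^ 3 * H ^ 2 + 108 * c ^ 3 * H - 432 * c ^ 3 - 3024 * c ^ 2 * H ^ 4 - 22032 * c ^ 2 * H ^ 3
        - 45684 * c ^ 2 * H ^ 2 + 2808 * c ^ 2 * H + 37152 * c ^ 2 + 27648 * c * H ^ 5 + 468288 *
        c * H ^ 4 + 1529496 * c * H ^ 3 + 462024 * c * H ^ 2 - 1220400 * c * H + 499392 * c +
        442368 * H ^ 6 - 1271808 * H ^ 5 - 4380480 * H ^ 4 + 4991328 * H ^ 3 + 14932944 * H ^ 2 -
        9017568 * H + 846720) * h1 + (-135 * c ^ 3 * H ^ 2 - 405 * c ^ 3 * H - 810 * c ^ 3 + 7560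
        * c ^ 2 * H ^ 3 + 39960 * c ^ 2 * H ^ 2 + 43740 * c ^ 2 * H - 42120 * c ^ 2 - 69120 * c *
        H ^ 4 - 1032480 * c * H ^ 3 - 635580 * c * H ^ 2 + 1495260 * c * H - 521640 * c - 1105920
        * H ^ 5 + 5391360 * H ^ 4 - 1213920 * H ^ 3 - 14508720 * H ^ 2 + 9072000 * H - 1270080) *
        h2 + (135 * c ^ 3 * H - 810 * c ^ 3 - 6993 * c ^ 2 * H ^ 2 - 10638 * c ^ 2 * H + 33696 * c
        ^ 2 + 32832 * c * H ^ 3 + 1498068 * c * H ^ 2 - 935820 * c * H + 336312 * c + 1686528 * H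
        ^ 4 - 10502784 * H ^ 3 + 16330140 * H ^ 2 - 3823848 * H - 635040) * h3 + (-756 * c ^ 2 * H
        ^ 3 - 15660 * c ^ 2 * H ^ 2 - 15192 * c ^ 2 * H + 26208 * c ^ 2 + 48384 * c * H ^ 4 +
        436752 * c * H ^ 3 + 838224 * c * H ^ 2 - 760896 * c * H + 193536 * c - 774144 * H ^ 5 +
        2059776 * H ^ 4 - 4068432 * H ^ 3 + 7712784 * H ^ 2 - 3384864 * H + 282240) * h4
    exact (mul_eq_zero.1 e).resolve_left (by simp [hg.weight, hg.weight_two, hg.weight_five, hg.lin,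
      hg.even, hg.qp, hg.qpThree, hg.odd])
  have e0 : y 0 = 0 := by
    have e : (4374) * qpDetThree c 1 H 1 * oddDet c 1 H 1 * linDet c 1 H 1 * evenDet c 1 H 1 * qpDet c 1 H 1 * H * H * y 0 = 0 := by
      unfold qpDetThree oddDet linDet evenDet qpDet
      linear_combination (40 * c ^ 3 * H ^ 2 + 140 * c ^ 3 * H + 120 * c ^ 3 + 1208 * c ^ 2 * H ^
        3 + 1964 * c ^ 2 * H ^ 2 - 520 * c ^ 2 * H + 768 * c ^ 2 + 9408 * c * H ^ 4 + 1768 * c * H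
        ^ 3 + 6504 * c * H ^ 2 - 4672 * c * H + 1056 * c + 18432 * H ^ 5 - 131712 * H ^ 4 + 210768
        * H ^ 3 - 34752 * H ^ 2 - 14784 * H) * h0 + (5400 * c ^ 3 * H ^ 3 + 10800 * c ^ 3 * H ^ 2
        - 37800 * c ^ 2 * H ^ 4 - 209520 * c ^ 2 * H ^ 3 - 34560 * c ^ 2 * H ^ 2 - 4492800 * c * H
        ^ 5 - 5516640 * c * H ^ 4 + 2328480 * c * H ^ 3 - 820800 * c * H ^ 2 + 5529600 * H ^ 6 +
        17832960 * H ^ 5 - 69547680 * H ^ 4 + 22680000 * H ^ 3 + 1693440 * H ^ 2) * h1 + (540 * c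
        ^ 4 * H + 810 * c ^ 4 - 14472 * c ^ 3 * H ^ 2 - 33102 * c ^ 3 * H + 3564 * c ^ 3 - 300348
        * c ^ 2 * H ^ 3 + 267300 * c ^ 2 * H ^ 2 - 188784 * c ^ 2 * H - 3240 * c ^ 2 + 7416576 * c
        * H ^ 4 - 3837456 * c * H ^ 3 + 1841616 * c * H ^ 2 - 257688 * c * H - 14256 * c -
        21786624 * H ^ 5 + 55392768 * H ^ 4 - 24411888 * H ^ 3 + 1445904 * H ^ 2 + 199584 * H) *
        h2 + (405 * c ^ 4 * H + 270 * c ^ 4 - 4779 * c ^ 3 * H ^ 2 - 20844 * c ^ 3 * H + 1188 * c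
        ^ 3 - 256446 * c ^ 2 * H ^ 3 + 361260 * c ^ 2 * H ^ 2 - 348948 * c ^ 2 * H - 1080 * c ^ 2
        - 217728 * c * H ^ 4 - 8101512 * c * H ^ 3 + 5330772 * c * H ^ 2 - 1135296 * c * H - 4752
        * c + 1492992 * H ^ 5 + 13430016 * H ^ 4 - 40223736 * H ^ 3 + 14750208 * H ^ 2 + 66528 *
        H) * h3 + (5400 * c ^ 3 * H ^ 3 + 15840 * c ^ 3 * H ^ 2 + 1440 * c ^ 3 * H - 17280 * c ^ 3
        - 52920 * c ^ 2 * H ^ 4 - 599472 * c ^ 2 * H ^ 3 - 637056 * c ^ 2 * H ^ 2 + 645120 * c ^ 2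
        * H - 110592 * c ^ 2 - 3525120 * c * H ^ 5 - 2801952 * c * H ^ 4 + 13945248 * c * H ^ 3 -
        11166336 * c * H ^ 2 + 2763648 * c * H - 152064 * c - 9953280 * H ^ 6 + 61903872 * H ^ 5 -
        115614432 * H ^ 4 + 72301248 * H ^ 3 - 19187712 * H ^ 2 + 2128896 * H) * h4
    exact (mul_eq_zero.1 e).resolve_left (by simp [hg.weight, hg.weight_two, hg.weight_five, hg.lin,
      hg.even, hg.qp, hg.qpThree, hg.odd])
  have e2 : y 2 = 0 := by
    have e : (648) * qpDetThree c 1 H 1 * oddDet c 1 H 1 * evenDet c 1 H 1 * qpDet c 1 H 1 * H * H * y 2 = 0 := by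
      unfold qpDetThree oddDet evenDet qpDet
      linear_combination (-80 * c ^ 3 * H - 120 * c ^ 3 - 416 * c ^ 2 * H ^ 2 + 904 * c ^ 2 * H -
        768 * c ^ 2 + 31184 * c * H ^ 3 - 11504 * c * H ^ 2 + 5200 * c * H - 1056 * c - 100864 * H
        ^ 4 + 262752 * H ^ 3 - 129440 * H ^ 2 + 14784 * H) * h0 + (-1080 * c ^ 3 * H ^ 4 - 3240 *
        c ^ 3 * H ^ 3 - 6480 * c ^ 3 * H ^ 2 + 60480 * c ^ 2 * H ^ 5 + 319680 * c ^ 2 * H ^ 4 +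
        349920 * c ^ 2 * H ^ 3 - 336960 * c ^ 2 * H ^ 2 - 552960 * c * H ^ 6 - 8259840 * c * H ^ 5
        - 5084640 * c * H ^ 4 + 11962080 * c * H ^ 3 - 4173120 * c * H ^ 2 - 8847360 * H ^ 7 +
        43130880 * H ^ 6 - 9711360 * H ^ 5 - 116069760 * H ^ 4 + 72576000 * H ^ 3 - 10160640 * H ^
        2) * h1 + (45 * c ^ 4 * H ^ 3 + 90 * c ^ 4 * H ^ 2 - 225 * c ^ 4 * H - 810 * c ^ 4 - 1881
        * c ^ 3 * H ^ 4 - 7794 * c ^ 3 * H ^ 3 + 6471 * c ^ 3 * H ^ 2 + 42408 * c ^ 3 * H - 3564 *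
        c ^ 3 - 15264 * c ^ 2 * H ^ 5 + 81414 * c ^ 2 * H ^ 4 - 26082 * c ^ 2 * H ^ 3 - 252972 * c
        ^ 2 * H ^ 2 + 310212 * c ^ 2 * H + 3240 * c ^ 2 + 857088 * c * H ^ 6 + 2742912 * c * H ^ 5
        + 3764628 * c * H ^ 4 - 5898240 * c * H ^ 3 - 48420 * c * H ^ 2 + 638640 * c * H + 14256 *
        c + 2654208 * H ^ 7 - 10119168 * H ^ 6 - 20520576 * H ^ 5 + 80301960 * H ^ 4 - 42946488 *
        H ^ 3 + 5921568 * H ^ 2 - 199584 * H) * h2 + (-90 * c ^ 4 * H ^ 2 - 90 * c ^ 4 * H - 270 *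
        c ^ 4 + 3762 * c ^ 3 * H ^ 3 + 14526 * c ^ 3 * H ^ 2 + 6390 * c ^ 3 * H - 1188 * c ^ 3 +
        30528 * c ^ 2 * H ^ 4 - 355896 * c ^ 2 * H ^ 3 + 252 * c ^ 2 * H ^ 2 + 102312 * c ^ 2 * H
        + 1080 * c ^ 2 - 1714176 * c * H ^ 5 - 1663488 * c * H ^ 4 + 1034568 * c * H ^ 3 - 1888344
        * c * H ^ 2 + 356760 * c * H + 4752 * c - 5308416 * H ^ 6 + 36052992 * H ^ 5 - 58339584 *
        H ^ 4 + 13701312 * H ^ 3 + 2499696 * H ^ 2 - 66528 * H) * h3 + (-10800 * c ^ 3 * H ^ 2 -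
        10080 * c ^ 3 * H + 17280 * c ^ 3 + 15120 * c ^ 2 * H ^ 4 + 388800 * c ^ 2 * H ^ 3 +
        725184 * c ^ 2 * H ^ 2 - 700416 * c ^ 2 * H + 110592 * c ^ 2 - 967680 * c * H ^ 5 + 250560
        * c * H ^ 4 - 11661696 * c * H ^ 3 + 10650816 * c * H ^ 2 - 2839680 * c * H + 152064 * c +
        15482880 * H ^ 6 - 52254720 * H ^ 5 + 62070336 * H ^ 4 - 47167488 * H ^ 3 + 17429760 * H ^
        2 - 2128896 * H) * h4
    exact (mul_eq_zero.1 e).resolve_left (by simp [hg.weight, hg.weight_two, hg.weight_five, hg.lin,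
      hg.even, hg.qp, hg.qpThree, hg.odd])
  have e3 : y 3 = 0 := by
    have e : (648) * qpDetThree c 1 H 1 * oddDet c 1 H 1 * linDet c 1 H 1 * evenDet c 1 H 1 * qpDet c 1 H 1 * H * H * y 3 = 0 := by
      unfold qpDetThree oddDet linDet evenDet qpDet
      linear_combination (60 * c ^ 4 * H + 40 * c ^ 4 - 708 * c ^ 3 * H ^ 2 - 3088 * c ^ 3 * H +
        176 * c ^ 3 - 37992 * c ^ 2 * H ^ 3 + 53520 * c ^ 2 * H ^ 2 - 51696 * c ^ 2 * H - 160 * c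
        ^ 2 - 32256 * c * H ^ 4 - 1200224 * c * H ^ 3 + 789744 * c * H ^ 2 - 168192 * c * H - 704
        * c + 221184 * H ^ 5 + 1989632 * H ^ 4 - 5959072 * H ^ 3 + 2185216 * H ^ 2 + 9856 * H) *
        h0 + (-1080 * c ^ 4 * H ^ 3 + 6480 * c ^ 4 * H ^ 2 + 90504 * c ^ 3 * H ^ 4 - 120096 * c ^
        3 * H ^ 3 - 282528 * c ^ 3 * H ^ 2 - 2052864 * c ^ 2 * H ^ 5 - 14819760 * c ^ 2 * H ^ 4 +
        15942528 * c ^ 2 * H ^ 3 - 2151360 * c ^ 2 * H ^ 2 - 5087232 * c * H ^ 6 + 468052992 * c *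
        H ^ 5 - 346241952 * c * H ^ 4 + 101713536 * c * H ^ 3 + 10461312 * c * H ^ 2 + 431751168 *
        H ^ 7 - 2661728256 * H ^ 6 + 4012471296 * H ^ 5 - 717622848 * H ^ 4 - 223751808 * H ^ 3 -
        10160640 * H ^ 2) * h1 + (90 * c ^ 5 * H ^ 2 + 90 * c ^ 5 * H + 270 * c ^ 5 - 6642 * c ^ 4
        * H ^ 3 - 17586 * c ^ 4 * H ^ 2 - 15210 * c ^ 4 * H + 648 * c ^ 4 + 89856 * c ^ 3 * H ^ 4
        + 828252 * c ^ 3 * H ^ 3 + 233280 * c ^ 3 * H ^ 2 - 127548 * c ^ 3 * H - 3456 * c ^ 3 +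
        2691072 * c ^ 2 * H ^ 5 - 9664128 * c ^ 2 * H ^ 4 - 1738296 * c ^ 2 * H ^ 3 + 5162832 * c
        ^ 2 * H ^ 2 - 117576 * c ^ 2 * H - 2592 * c ^ 2 - 49545216 * c * H ^ 6 - 92712960 * c * H
        ^ 5 + 88118784 * c * H ^ 4 - 72059184 * c * H ^ 3 + 5139936 * c * H ^ 2 + 932112 * c * H +
        9504 * c - 169869312 * H ^ 7 + 1143078912 * H ^ 6 - 1794760704 * H ^ 5 + 321762816 * H ^ 4
        + 107392896 * H ^ 3 + 2870496 * H ^ 2 - 133056 * H) * h2 + (90 * c ^ 5 * H ^ 2 + 45 * c ^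
        5 * H + 90 * c ^ 5 - 3042 * c ^ 4 * H ^ 3 - 10035 * c ^ 4 * H ^ 2 - 8154 * c ^ 4 * H + 216
        * c ^ 4 - 60624 * c ^ 3 * H ^ 4 + 181350 * c ^ 3 * H ^ 3 - 7398 * c ^ 3 * H ^ 2 + 341964 *
        c ^ 3 * H - 1152 * c ^ 3 + 1469952 * c ^ 2 * H ^ 5 + 2558880 * c ^ 2 * H ^ 4 + 9863244 * c
        ^ 2 * H ^ 3 - 9186228 * c ^ 2 * H ^ 2 + 6458904 * c ^ 2 * H - 864 * c ^ 2 + 19021824 * c *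
        H ^ 6 + 23040000 * c * H ^ 5 - 23055552 * c * H ^ 4 + 193697352 * c * H ^ 3 - 107838504 *
        c * H ^ 2 + 21190464 * c * H + 3168 * c + 42467328 * H ^ 7 - 287539200 * H ^ 6 + 358557696
        * H ^ 5 - 181284480 * H ^ 4 + 693595440 * H ^ 3 - 288819648 * H ^ 2 - 44352 * H) * h3 +
        (-1080 * c ^ 4 * H ^ 3 + 4320 * c ^ 4 * H ^ 2 + 4320 * c ^ 4 * H - 5760 * c ^ 4 + 45144 *
        c ^ 3 * H ^ 4 - 49248 * c ^ 3 * H ^ 3 - 330048 * c ^ 3 * H ^ 2 + 138816 * c ^ 3 * H -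
        25344 * c ^ 3 + 366336 * c ^ 2 * H ^ 5 - 6909840 * c ^ 2 * H ^ 4 + 3836160 * c ^ 2 * H ^ 3
        + 1351296 * c ^ 2 * H ^ 2 - 114048 * c ^ 2 * H + 23040 * c ^ 2 - 20570112 * c * H ^ 6 +
        127927296 * c * H ^ 5 + 39926304 * c * H ^ 4 - 65628288 * c * H ^ 3 + 23521536 * c * H ^ 2
        - 2011392 * c * H + 101376 * c - 63700992 * H ^ 7 + 65912832 * H ^ 6 - 105145344 * H ^ 5 +
        593872704 * H ^ 4 - 285936768 * H ^ 3 + 22081536 * H ^ 2 - 1419264 * H) * h4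
    exact (mul_eq_zero.1 e).resolve_left (by simp [hg.weight, hg.weight_two, hg.weight_five, hg.lin,
      hg.even, hg.qp, hg.qpThree, hg.odd])
  have e4 : y 4 = 0 := by
    have e : (-63) * linDet c 1 H 1 * H * y 4 = 0 := by
      unfold linDet
      linear_combination (2) * h1 - (-15 * c ^ 2 - 333 * c * H - 66 * c - 864 * H ^ 2 - 1638 * H)
        * e1 - (2025 * c ^ 2 * H - 38880 * c * H ^ 2 + 20412 * c * H - 829440 * H ^ 3 - 834624 * H
        ^ 2 - 48924 * H) * e0 - (-360 * c * H - 2880 * H ^ 2 - 2160 * H) * e2 - (180 * c * H -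
        5760 * H ^ 2 - 360 * H) * e3
    exact (mul_eq_zero.1 e).resolve_left (by simp [hg.weight, hg.weight_two, hg.weight_five, hg.lin,
      hg.even, hg.qp, hg.qpThree, hg.odd])
  funext i
  fin_cases i <;> assumption

/-- The solution of the odd system of level three. -/
noncomputable def oddSolutionThree (c h H : K) : Fin 5 → K :=
  ![(5 / 162 * c ^ 2 * H + 5 / 81 * c ^ 2 + 16 / 27 * c * H ^ 2 - 80 / 81 * c * H * h - 28 / 81 * c * H - 190 / 81 * c * h + 22 / 81 * c - 512 / 27 * H ^ 2 * h + 160 / 27 * H ^ 2 + 1120 / 81 * H * h - 70 / 27 * H - 196 / 81 * h) / (oddDet c 1 H 1 * linDet c 1 H 1 * evenDet c 1 H 1),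
    (14 / 3 * c ^ 2 * H ^ 2 + 2 / 3 * c ^ 2 * H * h + 1 / 3 * c ^ 2 * H - 2 / 3 * c ^ 2 * h - 128 * c * H ^ 3 - 640 / 3 * c * H ^ 2 * h + 136 / 3 * c * H ^ 2 - 136 / 3 * c * H * h - 100 / 3 * c * H + 200 / 3 * c * h - 2048 / 3 * H ^ 4 + 6144 * H ^ 3 * h - 6400 / 3 * H ^ 3 + 7424 / 3 * H ^ 2 * h + 2744 / 3 * H ^ 2 - 1960 * H * h + 196 / 3 * H - 392 / 3 * h) / (oddDet c 1 H 1 * linDet c 1 H 1 * evenDet c 1 H 1),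
    (5 / 12 * c ^ 3 - 17 * c ^ 2 * H - 15 * c ^ 2 * h + c ^ 2 + 64 * c * H ^ 2 + 704 * c * H * h - 28 * c * H - 68 * c * h - 11 / 3 * c + 5120 / 3 * H ^ 3 - 7168 * H ^ 2 * h - 640 * H ^ 2 + 2688 * H * h - 140 / 3 * H + 196 * h) / (oddDet c 1 H 1 * linDet c 1 H 1 * evenDet c 1 H 1),
    (-5 / 24 * c ^ 3 * H + 5 / 12 * c ^ 3 + 28 / 3 * c ^ 2 * H ^ 2 + 145 / 12 * c ^ 2 * H - 15 / 2 * c ^ 2 * h - 77 / 3 * c ^ 2 + 128 / 3 * c * H ^ 3 - 3344 / 3 * c * H ^ 2 + 96 * c * H * h + 4141 / 6 * c * H + 222 * c * h - 121 * c - 4096 * H ^ 4 + 28928 / 3 * H ^ 3 + 4608 * H ^ 2 * h - 21584 / 3 * H ^ 2 - 2240 * H * h + 1645 * H + 98 * h) / (oddDet c 1 H 1 * linDet c 1 H 1 * evenDet c 1 H 1),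
    (10 / 3 * c ^ 2 * H ^ 2 - 10 / 3 * c ^ 2 * H * h + 65 / 9 * c ^ 2 * H + 10 / 3 * c ^ 2 * h - 80 / 9 * c ^ 2 - 128 / 3 * c * H ^ 3 + 128 / 3 * c * H ^ 2 * h - 1256 / 3 * c * H ^ 2 - 520 / 9 * c * H * h + 2428 / 9 * c * H + 136 / 9 * c * h - 352 / 9 * c - 2048 * H ^ 4 + 2048 * H ^ 3 * h + 3840 * H ^ 3 + 1792 / 3 * H ^ 2 * h - 7768 / 3 * H ^ 2 - 4984 / 9 * H * h + 1708 / 3 * H - 392 / 9 * h) / (oddDet c 1 H 1 * linDet c 1 H 1 * evenDet c 1 H 1)]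

/-- The rescaled odd matrix elements of level three. -/
def oddRightThree (c h H : K) : Fin 5 → K :=
  ![27 / 8 * c * H ^ 3 + 243 / 8 * c * H ^ 2 + 189 / 4 * c * H - 108 * H ^ 3 * h - 2619 / 4 * H ^
    3 - 324 * H ^ 2 * h - 6291 / 4 * H ^ 2 - 216 * H * h - 621 / 2 * H, -9 / 2 * H - h, -3 * H ^ 2
    - 6 * H, -3 / 2 * H ^ 3 - 9 / 2 * H ^ 2 - 3 * H, -3 / 2 * H ^ 2 - 3 / 2 * H * h - 3 / 2 * H]

/-- The rescaled odd adjoint matrix elements of level three. -/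
def oddLeftThree (c h H : K) : Fin 5 → K :=
  ![-27 / 8 * c * H ^ 3 - 243 / 8 * c * H ^ 2 - 189 / 4 * c * H + 108 * H ^ 3 * h + 2619 / 4 * H ^
    3 + 324 * H ^ 2 * h + 6291 / 4 * H ^ 2 + 216 * H * h + 621 / 2 * H, 9 / 2 * H + h, 3 * H ^ 2 +
    6 * H, 3 / 2 * H ^ 3 + 9 / 2 * H ^ 2 + 3 * H, 3 / 2 * H ^ 2 + 3 / 2 * H * h + 3 / 2 * H]

set_option maxHeartbeats 2000000 in
theorem oddGramThree_mulVec {c H : K} (hg : IsGeneric c H) (h : K) :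
    (oddGramThree c H).mulVec (oddSolutionThree c h H) = oddRightThree c h H := by
  have hA := hg.lin
  have hE := hg.even
  have hF := hg.odd
  funext i
  fin_cases i <;>
    simp [oddGramThree, oddSolutionThree, oddRightThree, Matrix.mulVec, dotProduct, Fin.sum_univ_succ] <;>
    field_simp <;>
    simp only [linDet, evenDet, oddDet] <;>
    ring

theorem oddRightThree_0 {c h u : K} (H : K) (hh : h ≠ 0) (hk : 22 + 5 * c ≠ 0)
    (hu : (22 + 5 * c) * u ^ 2 = linDet c 1 h 1) :
    (22 + 5 * c) * rightElement c H 0 h (u * h) h (-(u * h)) (wordsThree 0) =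
      u * oddRightThree c h H 0 := by
  simp only [wordsThree, oddRightThree, linDet, Matrix.cons_val, rightElement_W1_W1_W1 _ _ _ _ hh] at hu ⊢
  linear_combination (-648 * H ^ 3 - 8208 / 5 * H ^ 2 - 2376 / 5 * H) * u * mul_kappa hk + (-27 /
    8 * H ^ 3 - 81 / 8 * H ^ 2 - 27 / 4 * H) * u * hu


theorem oddLeftThree_0 {c h u : K} (H : K) (hh : h ≠ 0) (hk : 22 + 5 * c ≠ 0)
    (hu : (22 + 5 * c) * u ^ 2 = linDet c 1 h 1) :
    (22 + 5 * c) * leftElement c H 0 h (u * h) h (-(u * h)) (wordsThree 0) =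
      u * oddLeftThree c h H 0 := by
  simp only [wordsThree, oddLeftThree, linDet, Matrix.cons_val, leftElement_W1_W1_W1 _ _ _ _ hh] at hu ⊢
  linear_combination (648 * H ^ 3 + 8208 / 5 * H ^ 2 + 2376 / 5 * H) * u * mul_kappa hk + (27 / 8
    * H ^ 3 + 81 / 8 * H ^ 2 + 27 / 4 * H) * u * hu


theorem oddRightThree_1 {c h u : K} (H : K) (hh : h ≠ 0) :
    rightElement c H 0 h (u * h) h (-(u * h)) (wordsThree 2) =
      u * oddRightThree c h H 1 := by
  simp only [wordsThree, oddRightThree, Matrix.cons_val, rightElement_W3 _ _ _ _ hh]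
  ring


theorem oddLeftThree_1 {c h u : K} (H : K) (hh : h ≠ 0) :
    leftElement c H 0 h (u * h) h (-(u * h)) (wordsThree 2) =
      u * oddLeftThree c h H 1 := by
  simp only [wordsThree, oddLeftThree, Matrix.cons_val, leftElement_W3 _ _ _ _ hh]
  ring


theorem oddRightThree_2 {c h u : K} (H : K) (hh : h ≠ 0) :
    rightElement c H 0 h (u * h) h (-(u * h)) (wordsThree 4) =
      u * oddRightThree c h H 2 := by
  simp only [wordsThree, oddRightThree, Matrix.cons_val, rightElement_L1_W2 _ _ _ _ hh]
  ring


theorem oddLeftThree_2 {c h u : K} (H : K) (hh : h ≠ 0) :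
    leftElement c H 0 h (u * h) h (-(u * h)) (wordsThree 4) =
      u * oddLeftThree c h H 2 := by
  simp only [wordsThree, oddLeftThree, Matrix.cons_val, leftElement_L1_W2 _ _ _ _ hh]
  ring


theorem oddRightThree_3 {c h u : K} (H : K) (hh : h ≠ 0) :
    rightElement c H 0 h (u * h) h (-(u * h)) (wordsThree 5) =
      u * oddRightThree c h H 3 := by
  simp only [wordsThree, oddRightThree, Matrix.cons_val, rightElement_L1_L1_W1 _ _ _ _ hh]
  ring


theorem oddLeftThree_3 {c h u : K} (H : K) (hh : h ≠ 0) :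
    leftElement c H 0 h (u * h) h (-(u * h)) (wordsThree 5) =
      u * oddLeftThree c h H 3 := by
  simp only [wordsThree, oddLeftThree, Matrix.cons_val, leftElement_L1_L1_W1 _ _ _ _ hh]
  ring


theorem oddRightThree_4 {c h u : K} (H : K) (hh : h ≠ 0) :
    rightElement c H 0 h (u * h) h (-(u * h)) (wordsThree 6) =
      u * oddRightThree c h H 4 := by
  simp only [wordsThree, oddRightThree, Matrix.cons_val, rightElement_L2_W1 _ _ _ _ hh]
  ring


theorem oddLeftThree_4 {c h u : K} (H : K) (hh : h ≠ 0) :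
    leftElement c H 0 h (u * h) h (-(u * h)) (wordsThree 6) =
      u * oddLeftThree c h H 4 := by
  simp only [wordsThree, oddLeftThree, Matrix.cons_val, leftElement_L2_W1 _ _ _ _ hh]
  ring


end Gram

/-! ### Block coefficients as sums over the even and odd sectors. -/

section Block

set_option linter.unusedSectionVars false
set_option linter.unusedSimpArgs false
set_option linter.unusedVariables false
set_option linter.flexible false

variable {K : Type*} [Field K] [CharZero K]

theorem kappa_ne_zero {c : K} (hk : 22 + 5 * c ≠ 0) : kappa c ≠ 0 :=
  inv_ne_zero hk

/-- The solution of the Gram system of level one. -/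
noncomputable def solutionOne (c h u H : K) : Fin 2 → K :=
  ![(22 + 5 * c) * (u * oddSolutionOne c h H 0), evenSolutionOne c h H 0]

theorem evenPartOne_solution {c : K} (hk : 22 + 5 * c ≠ 0) (h u H : K) :
    evenPartOne c (solutionOne c h u H) = evenSolutionOne c h H := by
  have hκ := mul_kappa hk
  funext i
  fin_cases i
  · rfl

theorem oddPartOne_solution {c : K} (hk : 22 + 5 * c ≠ 0) (h u H : K) :
    oddPartOne c (solutionOne c h u H) = ((22 + 5 * c) * u) • oddSolutionOne c h H := by
  have hκ := mul_kappa hk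
  funext i
  fin_cases i
  · change oddPartOne c (solutionOne c h u H) 0 = (22 + 5 * c) * u * oddSolutionOne c h H 0
    simp only [oddPartOne, solutionOne, Matrix.cons_val]
    ring

theorem gram_one_injective {c H : K} (hg : IsGeneric c H) {x : Fin 2 → K}
    (hx : ∀ i, ∑ j, gram c H 0 (wordsOne i) (wordsOne j) * x j = 0) : x = 0 := by
  have h0 : evenPartOne c x = 0 := by
    refine evenGramOne_injective hg (funext fun a => ?_)
    fin_cases a
    · exact (evenGramOne_row_0 hg.central H x).symm.trans (by rw [hx, mul_zero]; rfl)
  have h1 : oddPartOne c x = 0 := by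
    refine oddGramOne_injective hg (funext fun a => ?_)
    fin_cases a
    · exact (oddGramOne_row_0 hg.central H x).symm.trans (by rw [hx, mul_zero]; rfl)
  have hκ := kappa_ne_zero hg.central
  funext i
  fin_cases i
  · exact congrFun h1 0
  · exact congrFun h0 0

/-- The rows are equalities after multiplication by a power of `22 + 5 c`, which is then cancelled.
In the odd sector the right-hand side carries a factor `u` and the row an extra factor `22 + 5 c`;
this explains the prefactor `(22 + 5 c) u` of the odd components. -/
theorem gram_one_solution {c h u H : K} (hg : IsGeneric c H) (hh : h ≠ 0)
    (hu : (22 + 5 * c) * u ^ 2 = linDet c 1 h 1) (i : Fin 2) :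
    ∑ j, gram c H 0 (wordsOne i) (wordsOne j) * solutionOne c h u H j =
      rightElement c H 0 h (u * h) h (-(u * h)) (wordsOne i) := by
  have hk := hg.central
  fin_cases i
  · refine mul_left_cancel₀ (pow_ne_zero 1 hk)
      ((oddGramOne_row_0 hk H (solutionOne c h u H)).trans ?_)
    rw [oddPartOne_solution hk, Matrix.mulVec_smul, oddGramOne_mulVec hg]
    change (22 + 5 * c) * u * oddRightOne c h H 0 =
      (22 + 5 * c) ^ 1 * rightElement c H 0 h (u * h) h (-(u * h)) (wordsOne 0)
    linear_combination -((22 + 5 * c) * oddRightOne_0 (c := c) (u := u) H hh)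
  · refine mul_left_cancel₀ (pow_ne_zero 0 hk)
      ((evenGramOne_row_0 hk H (solutionOne c h u H)).trans ?_)
    rw [evenPartOne_solution hk, evenGramOne_mulVec hg]
    change evenRightOne c h H 0 =
      (22 + 5 * c) ^ 0 * rightElement c H 0 h (u * h) h (-(u * h)) (wordsOne 1)
    linear_combination -(evenRightOne_0 (c := c) (u := u) H hh)

/-- The odd components of the solution carry `(22 + 5 c) u` and the odd left elements a further `u`.
Their product `(22 + 5 c) u²` equals `linDet c 1 h 1`, so the sign of the charge disappears. Levels
two and three work in the same way. -/
theorem coeff_block_one_eq_sum {c h u H : K} (hg : IsGeneric c H) (hh : h ≠ 0)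
    (hu : (22 + 5 * c) * u ^ 2 = linDet c 1 h 1) :
    PowerSeries.coeff 1 (block c h (u * h) H) =
      ∑ j, evenLeftOne c h H j * evenSolutionOne c h H j +
        linDet c 1 h 1 * ∑ j, oddLeftOne c h H j * oddSolutionOne c h H j := by
  have hk := hg.central
  rw [block, PowerSeries.coeff_mk,
    projectorSum_eq_of_solution (n := 2) (by decide) basis_one_get (fun _ => gram_one_injective hg) _
      (gram_one_solution hg hh hu)]
  have l0 := oddLeftOne_0 (c := c) (u := u) H hh
  have l1 := evenLeftOne_0 (c := c) (u := u) H hh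
  simp only [Fin.sum_univ_succ, solutionOne, Matrix.cons_val, Fin.isValue, Fin.succ_zero_eq_one,
    Fin.reduceSucc, Finset.univ_eq_empty, Finset.sum_empty, add_zero]
  linear_combination (22 + 5 * c) * u * oddSolutionOne c h H 0 * l0 + oddLeftOne c h H 0 *
    oddSolutionOne c h H 0 * hu + evenSolutionOne c h H 0 * l1

/-- The solution of the Gram system of level two. -/
noncomputable def solutionTwo (c h u H : K) : Fin 5 → K :=
  ![(22 + 5 * c) * evenSolutionTwo c h H 0, (22 + 5 * c) * (u * oddSolutionTwo c h H 0), (22 + 5 *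
    c) * (u * oddSolutionTwo c h H 1), evenSolutionTwo c h H 1, evenSolutionTwo c h H 2]

theorem evenPartTwo_solution {c : K} (hk : 22 + 5 * c ≠ 0) (h u H : K) :
    evenPartTwo c (solutionTwo c h u H) = evenSolutionTwo c h H := by
  have hκ := mul_kappa hk
  funext i
  fin_cases i
  · change evenPartTwo c (solutionTwo c h u H) 0 = evenSolutionTwo c h H 0
    simp only [evenPartTwo, solutionTwo, Matrix.cons_val]
    linear_combination evenSolutionTwo c h H 0 * hκ
  · rfl
  · rfl

theorem oddPartTwo_solution {c : K} (hk : 22 + 5 * c ≠ 0) (h u H : K) :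
    oddPartTwo c (solutionTwo c h u H) = ((22 + 5 * c) * u) • oddSolutionTwo c h H := by
  have hκ := mul_kappa hk
  funext i
  fin_cases i
  · change oddPartTwo c (solutionTwo c h u H) 0 = (22 + 5 * c) * u * oddSolutionTwo c h H 0
    simp only [oddPartTwo, solutionTwo, Matrix.cons_val]
    ring
  · change oddPartTwo c (solutionTwo c h u H) 1 = (22 + 5 * c) * u * oddSolutionTwo c h H 1
    simp only [oddPartTwo, solutionTwo, Matrix.cons_val]
    ring

theorem gram_two_injective {c H : K} (hg : IsGeneric c H) {x : Fin 5 → K}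
    (hx : ∀ i, ∑ j, gram c H 0 (wordsTwo i) (wordsTwo j) * x j = 0) : x = 0 := by
  have h0 : evenPartTwo c x = 0 := by
    refine evenGramTwo_injective hg (funext fun a => ?_)
    fin_cases a
    · exact (evenGramTwo_row_0 hg.central H x).symm.trans (by rw [hx, mul_zero]; rfl)
    · exact (evenGramTwo_row_1 hg.central H x).symm.trans (by rw [hx, mul_zero]; rfl)
    · exact (evenGramTwo_row_2 hg.central H x).symm.trans (by rw [hx, mul_zero]; rfl)
  have h1 : oddPartTwo c x = 0 := by
    refine oddGramTwo_injective hg (funext fun a => ?_)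
    fin_cases a
    · exact (oddGramTwo_row_0 hg.central H x).symm.trans (by rw [hx, mul_zero]; rfl)
    · exact (oddGramTwo_row_1 hg.central H x).symm.trans (by rw [hx, mul_zero]; rfl)
  have hκ := kappa_ne_zero hg.central
  funext i
  fin_cases i
  · exact (mul_eq_zero.1 (congrFun h0 0)).resolve_left hκ
  · exact congrFun h1 0
  · exact congrFun h1 1
  · exact congrFun h0 1
  · exact congrFun h0 2

theorem gram_two_solution {c h u H : K} (hg : IsGeneric c H) (hh : h ≠ 0)
    (hu : (22 + 5 * c) * u ^ 2 = linDet c 1 h 1) (i : Fin 5) :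
    ∑ j, gram c H 0 (wordsTwo i) (wordsTwo j) * solutionTwo c h u H j =
      rightElement c H 0 h (u * h) h (-(u * h)) (wordsTwo i) := by
  have hk := hg.central
  fin_cases i
  · refine mul_left_cancel₀ (pow_ne_zero 1 hk)
      ((evenGramTwo_row_0 hk H (solutionTwo c h u H)).trans ?_)
    rw [evenPartTwo_solution hk, evenGramTwo_mulVec hg]
    change evenRightTwo c h H 0 =
      (22 + 5 * c) ^ 1 * rightElement c H 0 h (u * h) h (-(u * h)) (wordsTwo 0)
    linear_combination -(evenRightTwo_0 (c := c) (u := u) H hh hk hu)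
  · refine mul_left_cancel₀ (pow_ne_zero 1 hk)
      ((oddGramTwo_row_0 hk H (solutionTwo c h u H)).trans ?_)
    rw [oddPartTwo_solution hk, Matrix.mulVec_smul, oddGramTwo_mulVec hg]
    change (22 + 5 * c) * u * oddRightTwo c h H 0 =
      (22 + 5 * c) ^ 1 * rightElement c H 0 h (u * h) h (-(u * h)) (wordsTwo 1)
    linear_combination -((22 + 5 * c) * oddRightTwo_0 (c := c) (u := u) H hh)
  · refine mul_left_cancel₀ (pow_ne_zero 1 hk)
      ((oddGramTwo_row_1 hk H (solutionTwo c h u H)).trans ?_)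
    rw [oddPartTwo_solution hk, Matrix.mulVec_smul, oddGramTwo_mulVec hg]
    change (22 + 5 * c) * u * oddRightTwo c h H 1 =
      (22 + 5 * c) ^ 1 * rightElement c H 0 h (u * h) h (-(u * h)) (wordsTwo 2)
    linear_combination -((22 + 5 * c) * oddRightTwo_1 (c := c) (u := u) H hh)
  · refine mul_left_cancel₀ (pow_ne_zero 0 hk)
      ((evenGramTwo_row_1 hk H (solutionTwo c h u H)).trans ?_)
    rw [evenPartTwo_solution hk, evenGramTwo_mulVec hg]
    change evenRightTwo c h H 1 =
      (22 + 5 * c) ^ 0 * rightElement c H 0 h (u * h) h (-(u * h)) (wordsTwo 3)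
    linear_combination -(evenRightTwo_1 (c := c) (u := u) H hh)
  · refine mul_left_cancel₀ (pow_ne_zero 0 hk)
      ((evenGramTwo_row_2 hk H (solutionTwo c h u H)).trans ?_)
    rw [evenPartTwo_solution hk, evenGramTwo_mulVec hg]
    change evenRightTwo c h H 2 =
      (22 + 5 * c) ^ 0 * rightElement c H 0 h (u * h) h (-(u * h)) (wordsTwo 4)
    linear_combination -(evenRightTwo_2 (c := c) (u := u) H hh)

theorem coeff_block_two_eq_sum {c h u H : K} (hg : IsGeneric c H) (hh : h ≠ 0)
    (hu : (22 + 5 * c) * u ^ 2 = linDet c 1 h 1) :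
    PowerSeries.coeff 2 (block c h (u * h) H) =
      ∑ j, evenLeftTwo c h H j * evenSolutionTwo c h H j +
        linDet c 1 h 1 * ∑ j, oddLeftTwo c h H j * oddSolutionTwo c h H j := by
  have hk := hg.central
  rw [block, PowerSeries.coeff_mk,
    projectorSum_eq_of_solution (n := 5) (by decide) basis_two_get (fun _ => gram_two_injective hg) _
      (gram_two_solution hg hh hu)]
  have l0 := evenLeftTwo_0 (c := c) (u := u) H hh hk hu
  have l1 := oddLeftTwo_0 (c := c) (u := u) H hh
  have l2 := oddLeftTwo_1 (c := c) (u := u) H hh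
  have l3 := evenLeftTwo_1 (c := c) (u := u) H hh
  have l4 := evenLeftTwo_2 (c := c) (u := u) H hh
  simp only [Fin.sum_univ_succ, solutionTwo, Matrix.cons_val, Fin.isValue, Fin.succ_zero_eq_one,
    Fin.reduceSucc, Finset.univ_eq_empty, Finset.sum_empty, add_zero]
  linear_combination evenSolutionTwo c h H 0 * l0 + (22 + 5 * c) * u * oddSolutionTwo c h H 0 * l1
    + oddLeftTwo c h H 0 * oddSolutionTwo c h H 0 * hu + (22 + 5 * c) * u * oddSolutionTwo c h H 1
    * l2 + oddLeftTwo c h H 1 * oddSolutionTwo c h H 1 * hu + evenSolutionTwo c h H 1 * l3 +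
    evenSolutionTwo c h H 2 * l4

/-- The solution of the Gram system of level three. -/
noncomputable def solutionThree (c h u H : K) : Fin 10 → K :=
  ![(22 + 5 * c) ^ 2 * (u * oddSolutionThree c h H 0), (22 + 5 * c) * evenSolutionThree c h H 0,
    (22 + 5 * c) * (u * oddSolutionThree c h H 1), (22 + 5 * c) * evenSolutionThree c h H 1, (22 +
    5 * c) * (u * oddSolutionThree c h H 2), (22 + 5 * c) * (u * oddSolutionThree c h H 3), (22 +
    5 * c) * (u * oddSolutionThree c h H 4), evenSolutionThree c h H 2, evenSolutionThree c h H 3,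
    evenSolutionThree c h H 4]

theorem evenPartThree_solution {c : K} (hk : 22 + 5 * c ≠ 0) (h u H : K) :
    evenPartThree c (solutionThree c h u H) = evenSolutionThree c h H := by
  have hκ := mul_kappa hk
  funext i
  fin_cases i
  · change evenPartThree c (solutionThree c h u H) 0 = evenSolutionThree c h H 0
    simp only [evenPartThree, solutionThree, Matrix.cons_val]
    linear_combination evenSolutionThree c h H 0 * hκ
  · change evenPartThree c (solutionThree c h u H) 1 = evenSolutionThree c h H 1
    simp only [evenPartThree, solutionThree, Matrix.cons_val]
    linear_combination evenSolutionThree c h H 1 * hκ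
  · rfl
  · rfl
  · rfl

theorem oddPartThree_solution {c : K} (hk : 22 + 5 * c ≠ 0) (h u H : K) :
    oddPartThree c (solutionThree c h u H) = ((22 + 5 * c) * u) • oddSolutionThree c h H := by
  have hκ := mul_kappa hk
  funext i
  fin_cases i
  · change oddPartThree c (solutionThree c h u H) 0 = (22 + 5 * c) * u * oddSolutionThree c h H 0
    simp only [oddPartThree, solutionThree, Matrix.cons_val]
    linear_combination (22 + 5 * c) * u * oddSolutionThree c h H 0 * hκ
  · change oddPartThree c (solutionThree c h u H) 1 = (22 + 5 * c) * u * oddSolutionThree c h H 1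
    simp only [oddPartThree, solutionThree, Matrix.cons_val]
    ring
  · change oddPartThree c (solutionThree c h u H) 2 = (22 + 5 * c) * u * oddSolutionThree c h H 2
    simp only [oddPartThree, solutionThree, Matrix.cons_val]
    ring
  · change oddPartThree c (solutionThree c h u H) 3 = (22 + 5 * c) * u * oddSolutionThree c h H 3
    simp only [oddPartThree, solutionThree, Matrix.cons_val]
    ring
  · change oddPartThree c (solutionThree c h u H) 4 = (22 + 5 * c) * u * oddSolutionThree c h H 4
    simp only [oddPartThree, solutionThree, Matrix.cons_val]
    ring

theorem gram_three_injective {c H : K} (hg : IsGeneric c H) {x : Fin 10 → K}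
    (hx : ∀ i, ∑ j, gram c H 0 (wordsThree i) (wordsThree j) * x j = 0) : x = 0 := by
  have h0 : evenPartThree c x = 0 := by
    refine evenGramThree_injective hg (funext fun a => ?_)
    fin_cases a
    · exact (evenGramThree_row_0 hg.central H x).symm.trans (by rw [hx, mul_zero]; rfl)
    · exact (evenGramThree_row_1 hg.central H x).symm.trans (by rw [hx, mul_zero]; rfl)
    · exact (evenGramThree_row_2 hg.central H x).symm.trans (by rw [hx, mul_zero]; rfl)
    · exact (evenGramThree_row_3 hg.central H x).symm.trans (by rw [hx, mul_zero]; rfl)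
    · exact (evenGramThree_row_4 hg.central H x).symm.trans (by rw [hx, mul_zero]; rfl)
  have h1 : oddPartThree c x = 0 := by
    refine oddGramThree_injective hg (funext fun a => ?_)
    fin_cases a
    · exact (oddGramThree_row_0 hg.central H x).symm.trans (by rw [hx, mul_zero]; rfl)
    · exact (oddGramThree_row_1 hg.central H x).symm.trans (by rw [hx, mul_zero]; rfl)
    · exact (oddGramThree_row_2 hg.central H x).symm.trans (by rw [hx, mul_zero]; rfl)
    · exact (oddGramThree_row_3 hg.central H x).symm.trans (by rw [hx, mul_zero]; rfl)
    · exact (oddGramThree_row_4 hg.central H x).symm.trans (by rw [hx, mul_zero]; rfl)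
  have hκ := kappa_ne_zero hg.central
  funext i
  fin_cases i
  · exact (mul_eq_zero.1 (congrFun h1 0)).resolve_left hκ
  · exact (mul_eq_zero.1 (congrFun h0 0)).resolve_left hκ
  · exact congrFun h1 1
  · exact (mul_eq_zero.1 (congrFun h0 1)).resolve_left hκ
  · exact congrFun h1 2
  · exact congrFun h1 3
  · exact congrFun h1 4
  · exact congrFun h0 2
  · exact congrFun h0 3
  · exact congrFun h0 4

theorem gram_three_solution {c h u H : K} (hg : IsGeneric c H) (hh : h ≠ 0)
    (hu : (22 + 5 * c) * u ^ 2 = linDet c 1 h 1) (i : Fin 10) :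
    ∑ j, gram c H 0 (wordsThree i) (wordsThree j) * solutionThree c h u H j =
      rightElement c H 0 h (u * h) h (-(u * h)) (wordsThree i) := by
  have hk := hg.central
  fin_cases i
  · refine mul_left_cancel₀ (pow_ne_zero 2 hk)
      ((oddGramThree_row_0 hk H (solutionThree c h u H)).trans ?_)
    rw [oddPartThree_solution hk, Matrix.mulVec_smul, oddGramThree_mulVec hg]
    change (22 + 5 * c) * u * oddRightThree c h H 0 =
      (22 + 5 * c) ^ 2 * rightElement c H 0 h (u * h) h (-(u * h)) (wordsThree 0)
    linear_combination -((22 + 5 * c) * oddRightThree_0 (c := c) (u := u) H hh hk hu)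
  · refine mul_left_cancel₀ (pow_ne_zero 1 hk)
      ((evenGramThree_row_0 hk H (solutionThree c h u H)).trans ?_)
    rw [evenPartThree_solution hk, evenGramThree_mulVec hg]
    change evenRightThree c h H 0 =
      (22 + 5 * c) ^ 1 * rightElement c H 0 h (u * h) h (-(u * h)) (wordsThree 1)
    linear_combination -(evenRightThree_0 (c := c) (u := u) H hh hk hu)
  · refine mul_left_cancel₀ (pow_ne_zero 1 hk)
      ((oddGramThree_row_1 hk H (solutionThree c h u H)).trans ?_)
    rw [oddPartThree_solution hk, Matrix.mulVec_smul, oddGramThree_mulVec hg]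
    change (22 + 5 * c) * u * oddRightThree c h H 1 =
      (22 + 5 * c) ^ 1 * rightElement c H 0 h (u * h) h (-(u * h)) (wordsThree 2)
    linear_combination -((22 + 5 * c) * oddRightThree_1 (c := c) (u := u) H hh)
  · refine mul_left_cancel₀ (pow_ne_zero 1 hk)
      ((evenGramThree_row_1 hk H (solutionThree c h u H)).trans ?_)
    rw [evenPartThree_solution hk, evenGramThree_mulVec hg]
    change evenRightThree c h H 1 =
      (22 + 5 * c) ^ 1 * rightElement c H 0 h (u * h) h (-(u * h)) (wordsThree 3)
    linear_combination -(evenRightThree_1 (c := c) (u := u) H hh hk hu)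
  · refine mul_left_cancel₀ (pow_ne_zero 1 hk)
      ((oddGramThree_row_2 hk H (solutionThree c h u H)).trans ?_)
    rw [oddPartThree_solution hk, Matrix.mulVec_smul, oddGramThree_mulVec hg]
    change (22 + 5 * c) * u * oddRightThree c h H 2 =
      (22 + 5 * c) ^ 1 * rightElement c H 0 h (u * h) h (-(u * h)) (wordsThree 4)
    linear_combination -((22 + 5 * c) * oddRightThree_2 (c := c) (u := u) H hh)
  · refine mul_left_cancel₀ (pow_ne_zero 1 hk)
      ((oddGramThree_row_3 hk H (solutionThree c h u H)).trans ?_)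
    rw [oddPartThree_solution hk, Matrix.mulVec_smul, oddGramThree_mulVec hg]
    change (22 + 5 * c) * u * oddRightThree c h H 3 =
      (22 + 5 * c) ^ 1 * rightElement c H 0 h (u * h) h (-(u * h)) (wordsThree 5)
    linear_combination -((22 + 5 * c) * oddRightThree_3 (c := c) (u := u) H hh)
  · refine mul_left_cancel₀ (pow_ne_zero 1 hk)
      ((oddGramThree_row_4 hk H (solutionThree c h u H)).trans ?_)
    rw [oddPartThree_solution hk, Matrix.mulVec_smul, oddGramThree_mulVec hg]
    change (22 + 5 * c) * u * oddRightThree c h H 4 =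
      (22 + 5 * c) ^ 1 * rightElement c H 0 h (u * h) h (-(u * h)) (wordsThree 6)
    linear_combination -((22 + 5 * c) * oddRightThree_4 (c := c) (u := u) H hh)
  · refine mul_left_cancel₀ (pow_ne_zero 0 hk)
      ((evenGramThree_row_2 hk H (solutionThree c h u H)).trans ?_)
    rw [evenPartThree_solution hk, evenGramThree_mulVec hg]
    change evenRightThree c h H 2 =
      (22 + 5 * c) ^ 0 * rightElement c H 0 h (u * h) h (-(u * h)) (wordsThree 7)
    linear_combination -(evenRightThree_2 (c := c) (u := u) H hh)
  · refine mul_left_cancel₀ (pow_ne_zero 0 hk)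
      ((evenGramThree_row_3 hk H (solutionThree c h u H)).trans ?_)
    rw [evenPartThree_solution hk, evenGramThree_mulVec hg]
    change evenRightThree c h H 3 =
      (22 + 5 * c) ^ 0 * rightElement c H 0 h (u * h) h (-(u * h)) (wordsThree 8)
    linear_combination -(evenRightThree_3 (c := c) (u := u) H hh)
  · refine mul_left_cancel₀ (pow_ne_zero 0 hk)
      ((evenGramThree_row_4 hk H (solutionThree c h u H)).trans ?_)
    rw [evenPartThree_solution hk, evenGramThree_mulVec hg]
    change evenRightThree c h H 4 =
      (22 + 5 * c) ^ 0 * rightElement c H 0 h (u * h) h (-(u * h)) (wordsThree 9)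
    linear_combination -(evenRightThree_4 (c := c) (u := u) H hh)

theorem coeff_block_three_eq_sum {c h u H : K} (hg : IsGeneric c H) (hh : h ≠ 0)
    (hu : (22 + 5 * c) * u ^ 2 = linDet c 1 h 1) :
    PowerSeries.coeff 3 (block c h (u * h) H) =
      ∑ j, evenLeftThree c h H j * evenSolutionThree c h H j +
        linDet c 1 h 1 * ∑ j, oddLeftThree c h H j * oddSolutionThree c h H j := by
  have hk := hg.central
  rw [block, PowerSeries.coeff_mk,
    projectorSum_eq_of_solution (n := 10) (by decide) basis_three_get (fun _ => gram_three_injective hg) _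
      (gram_three_solution hg hh hu)]
  have l0 := oddLeftThree_0 (c := c) (u := u) H hh hk hu
  have l1 := evenLeftThree_0 (c := c) (u := u) H hh hk hu
  have l2 := oddLeftThree_1 (c := c) (u := u) H hh
  have l3 := evenLeftThree_1 (c := c) (u := u) H hh hk hu
  have l4 := oddLeftThree_2 (c := c) (u := u) H hh
  have l5 := oddLeftThree_3 (c := c) (u := u) H hh
  have l6 := oddLeftThree_4 (c := c) (u := u) H hh
  have l7 := evenLeftThree_2 (c := c) (u := u) H hh
  have l8 := evenLeftThree_3 (c := c) (u := u) H hh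
  have l9 := evenLeftThree_4 (c := c) (u := u) H hh
  simp only [Fin.sum_univ_succ, solutionThree, Matrix.cons_val, Fin.isValue, Fin.succ_zero_eq_one,
    Fin.reduceSucc, Finset.univ_eq_empty, Finset.sum_empty, add_zero]
  linear_combination (22 + 5 * c) * u * oddSolutionThree c h H 0 * l0 + oddLeftThree c h H 0 *
    oddSolutionThree c h H 0 * hu + evenSolutionThree c h H 0 * l1 + (22 + 5 * c) * u *
    oddSolutionThree c h H 1 * l2 + oddLeftThree c h H 1 * oddSolutionThree c h H 1 * hu +
    evenSolutionThree c h H 1 * l3 + (22 + 5 * c) * u * oddSolutionThree c h H 2 * l4 +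
    oddLeftThree c h H 2 * oddSolutionThree c h H 2 * hu + (22 + 5 * c) * u * oddSolutionThree c h
    H 3 * l5 + oddLeftThree c h H 3 * oddSolutionThree c h H 3 * hu + (22 + 5 * c) * u *
    oddSolutionThree c h H 4 * l6 + oddLeftThree c h H 4 * oddSolutionThree c h H 4 * hu +
    evenSolutionThree c h H 2 * l7 + evenSolutionThree c h H 3 * l8 + evenSolutionThree c h H 4 *
    l9

end Block

/-! ### Closed forms in the variable `x = z / √(1 - z)`. -/

section ClosedForms

/-- The numerator of `logTwo`. -/
def numTwo {R : Type*} [CommRing R] (A y H d t : R) : R :=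
  A ^ 3 * H ^ 2 - 8 * A ^ 2 * H ^ 3 * y + 64 * A ^ 2 * H ^ 2 * d * y - 8 * A ^ 2 * H * d ^ 2 * y +
    8 * A ^ 2 * H * d * y * t + 8 * A ^ 2 * d ^ 2 * y * t - 512 * A * H ^ 3 * d * y ^ 2 + 1088 * A
    * H ^ 2 * d ^ 2 * y ^ 2 - 64 * A * H ^ 2 * d * y ^ 2 * t + 64 * A * H * d ^ 2 * y ^ 2 * t -
    8192 * H ^ 3 * d ^ 2 * y ^ 3 - 1024 * H ^ 2 * d ^ 2 * y ^ 3 * t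

/-- The numerator of `logThree`. -/
def numThree {R : Type*} [CommRing R] (A y H d t : R) : R :=
  55 * A ^ 5 * H ^ 2 + 5 * A ^ 5 * H * t - 3168 * A ^ 4 * H ^ 3 * y + 4352 * A ^ 4 * H ^ 2 * d * y
    - 1296 * A ^ 4 * H ^ 2 * y * t + 32 * A ^ 4 * H * d ^ 2 * y - 32 * A ^ 4 * H * d * y * t + 438
    * A ^ 4 * H * y * t ^ 2 - 32 * A ^ 4 * d ^ 2 * y * t + 56320 * A ^ 3 * H ^ 4 * y ^ 2 - 239616
    * A ^ 3 * H ^ 3 * d * y ^ 2 + 32768 * A ^ 3 * H ^ 3 * y ^ 2 * t + 76544 * A ^ 3 * H ^ 2 * d ^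
    2 * y ^ 2 - 31488 * A ^ 3 * H ^ 2 * d * y ^ 2 * t - 11776 * A ^ 3 * H ^ 2 * y ^ 2 * t ^ 2 +
    4864 * A ^ 3 * H * d ^ 2 * y ^ 2 * t - 3072 * A ^ 3 * H * d * y ^ 2 * t ^ 2 - 3968 * A ^ 3 * H
    * y ^ 2 * t ^ 3 - 3072 * A ^ 3 * d ^ 2 * y ^ 2 * t ^ 2 - 262144 * A ^ 2 * H ^ 5 * y ^ 3 +
    3735552 * A ^ 2 * H ^ 4 * d * y ^ 3 - 131072 * A ^ 2 * H ^ 4 * y ^ 3 * t - 4153344 * A ^ 2 * H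
    ^ 3 * d ^ 2 * y ^ 3 + 1302528 * A ^ 2 * H ^ 3 * d * y ^ 3 * t + 131072 * A ^ 2 * H ^ 3 * y ^ 3
    * t ^ 2 - 675840 * A ^ 2 * H ^ 2 * d ^ 2 * y ^ 3 * t + 122880 * A ^ 2 * H ^ 2 * d * y ^ 3 * t
    ^ 2 + 65536 * A ^ 2 * H ^ 2 * y ^ 3 * t ^ 3 + 73728 * A ^ 2 * H * d ^ 2 * y ^ 3 * t ^ 2 + 6144
    * A ^ 2 * H * y ^ 3 * t ^ 4 - 16777216 * A * H ^ 5 * d * y ^ 4 + 61865984 * A * H ^ 4 * d ^ 2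
    * y ^ 4 - 8388608 * A * H ^ 4 * d * y ^ 4 * t + 21889024 * A * H ^ 3 * d ^ 2 * y ^ 4 * t -
    786432 * A * H ^ 3 * d * y ^ 4 * t ^ 2 + 1179648 * A * H ^ 2 * d ^ 2 * y ^ 4 * t ^ 2 -
    268435456 * H ^ 5 * d ^ 2 * y ^ 5 - 134217728 * H ^ 4 * d ^ 2 * y ^ 5 * t - 12582912 * H ^ 3 *
    d ^ 2 * y ^ 5 * t ^ 2

variable {K : Type*} [Field K]

/-- The first coefficient of the logarithm of the block in the variable `z / √(1 - z)`. -/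
def logOne (c y h H t : K) : K :=
  H * linDet c y h t / (2 * linDet c y H t)

/-- The second coefficient of the logarithm of the block in the variable `z / √(1 - z)`. -/
def logTwo (c y h H t : K) : K :=
  numTwo (linDet c y H t) y H (h - H) t / (4 * linDet c y H t ^ 2 * evenDet c y H t)

/-- The third coefficient of the logarithm of the block in the variable `z / √(1 - z)`. -/
def logThree (c y h H t : K) : K :=
  linDet c y h t * numThree (linDet c y H t) y H (h - H) t /
    (48 * linDet c y H t ^ 3 * evenDet c y H t * oddDet c y H t)

variable [CharZero K] {c h u H : K}

theorem coeff_block_one (hg : IsGeneric c H) (hh : h ≠ 0)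
    (hu : (22 + 5 * c) * u ^ 2 = linDet c 1 h 1) :
    PowerSeries.coeff 1 (block c h (u * h) H) = H / 2 + logOne c 1 h H 1 := by
  have hA := hg.lin
  rw [coeff_block_one_eq_sum hg hh hu]
  simp [evenLeftOne, evenSolutionOne, oddLeftOne, oddSolutionOne, logOne]
  field_simp

/-- This and the next sums compare with `(1 - z)^(-H/2) exp(ℓ₁ x + ℓ₂ x² + ℓ₃ x³)`. The even sector
matches the even powers of `x`: the first term is the `z²` coefficient of `(1 - z)^(-H/2)`, and `ℓ₂
+ ℓ₁² / 2` is the coefficient of `x²` in the exponential. -/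
theorem sum_evenTwo (hg : IsGeneric c H) :
    ∑ j, evenLeftTwo c h H j * evenSolutionTwo c h H j =
      H * (H + 2) / 8 + (logTwo c 1 h H 1 + logOne c 1 h H 1 ^ 2 / 2) := by
  have hA := hg.lin
  have hE := hg.even
  simp only [Fin.sum_univ_succ, evenLeftTwo, evenSolutionTwo, Matrix.cons_val, Fin.isValue,
    Fin.succ_zero_eq_one, Fin.reduceSucc, Finset.univ_eq_empty, Finset.sum_empty, add_zero,
    logTwo, logOne]
  field_simp
  simp only [linDet, evenDet, numTwo]
  ring

/-- The odd sector matches the odd powers of `x`; here it is the `z²` coefficient of `ℓ₁ z (1 -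
z)^(-(H+1)/2)`. -/
theorem sum_oddTwo (hg : IsGeneric c H) :
    linDet c 1 h 1 * ∑ j, oddLeftTwo c h H j * oddSolutionTwo c h H j =
      logOne c 1 h H 1 * (1 + H) / 2 := by
  have hA := hg.lin
  simp only [Fin.sum_univ_succ, oddLeftTwo, oddSolutionTwo, Matrix.cons_val, Fin.isValue,
    Fin.succ_zero_eq_one, Fin.reduceSucc, Finset.univ_eq_empty, Finset.sum_empty, add_zero, logOne]
  field_simp
  ring

theorem coeff_block_two (hg : IsGeneric c H) (hh : h ≠ 0)
    (hu : (22 + 5 * c) * u ^ 2 = linDet c 1 h 1) :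
    PowerSeries.coeff 2 (block c h (u * h) H) =
      H * (H + 2) / 8 + (logTwo c 1 h H 1 + logOne c 1 h H 1 ^ 2 / 2) +
        logOne c 1 h H 1 * (1 + H) / 2 := by
  rw [coeff_block_two_eq_sum hg hh hu, sum_evenTwo hg, sum_oddTwo hg]

/-- No even power of `x` starts at order `z³`, so nothing new appears: these are the `z³`
coefficients of `(1 - z)^(-H/2)` and of `z² (1 - z)^(-H/2 - 1)`. -/
theorem sum_evenThree (hg : IsGeneric c H) :
    ∑ j, evenLeftThree c h H j * evenSolutionThree c h H j =
      H * (H + 2) * (H + 4) / 48 +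
        (logTwo c 1 h H 1 + logOne c 1 h H 1 ^ 2 / 2) * (H + 2) / 2 := by
  have hA := hg.lin
  have hE := hg.even
  simp only [Fin.sum_univ_succ, evenLeftThree, evenSolutionThree, Matrix.cons_val, Fin.isValue,
    Fin.succ_zero_eq_one, Fin.reduceSucc, Finset.univ_eq_empty, Finset.sum_empty, add_zero,
    logTwo, logOne]
  field_simp
  simp only [linDet, evenDet, numTwo]
  ring

-- The first term propagates `ℓ₁` from level one through `z (1 - z)^(-(H+1)/2)`; the bracket is the
-- coefficient of `x³` in the exponential and brings in `ℓ₃`.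
set_option maxHeartbeats 2000000 in
theorem sum_oddThree (hg : IsGeneric c H) :
    linDet c 1 h 1 * ∑ j, oddLeftThree c h H j * oddSolutionThree c h H j =
      logOne c 1 h H 1 * (H + 1) * (H + 3) / 8 +
        (logThree c 1 h H 1 + logOne c 1 h H 1 * logTwo c 1 h H 1 +
          logOne c 1 h H 1 ^ 3 / 6) := by
  have hA := hg.lin
  have hE := hg.even
  have hF := hg.odd
  -- The common factor `linDet c 1 h 1` is stripped off before the rational identity is checked,
  -- which lowers the degrees and requires no assumption that this factor is non-zero.
  have key : ∑ j, oddLeftThree c h H j * oddSolutionThree c h H j =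
      H * (H + 1) * (H + 3) / (16 * linDet c 1 H 1) +
        (numThree (linDet c 1 H 1) 1 H (h - H) 1 /
            (48 * linDet c 1 H 1 ^ 3 * evenDet c 1 H 1 * oddDet c 1 H 1) +
          H * numTwo (linDet c 1 H 1) 1 H (h - H) 1 /
            (2 * 4 * linDet c 1 H 1 ^ 3 * evenDet c 1 H 1) +
          H ^ 3 * linDet c 1 h 1 ^ 2 / (48 * linDet c 1 H 1 ^ 3)) := by
    simp only [Fin.sum_univ_succ, oddLeftThree, oddSolutionThree, Matrix.cons_val, Fin.isValue,
      Fin.succ_zero_eq_one, Fin.reduceSucc, Finset.univ_eq_empty, Finset.sum_empty, add_zero]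
    field_simp
    simp only [linDet, evenDet, oddDet, numTwo, numThree]
    ring
  rw [key, logOne, logTwo, logThree]
  ring

theorem coeff_block_three (hg : IsGeneric c H) (hh : h ≠ 0)
    (hu : (22 + 5 * c) * u ^ 2 = linDet c 1 h 1) :
    PowerSeries.coeff 3 (block c h (u * h) H) =
      H * (H + 2) * (H + 4) / 48 +
          (logTwo c 1 h H 1 + logOne c 1 h H 1 ^ 2 / 2) * (H + 2) / 2 +
        (logOne c 1 h H 1 * (H + 1) * (H + 3) / 8 +
          (logThree c 1 h H 1 + logOne c 1 h H 1 * logTwo c 1 h H 1 +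
            logOne c 1 h H 1 ^ 3 / 6)) := by
  rw [coeff_block_three_eq_sum hg hh hu, sum_evenThree hg, sum_oddThree hg]

end ClosedForms

/-! ### The constant term of the block. -/

section Normalisation

open PowerSeries

variable {K : Type*} [Field K] [CharZero K]

theorem basis_zero_get (i : Fin 1) :
    (basis 0).get (Fin.cast (by decide) i) = (fun _ => []) i := by
  fin_cases i; rfl

theorem constantCoeff_block (c h w H : K) : constantCoeff (block c h w H) = 1 := by
  rw [← coeff_zero_eq_constantCoeff_apply, block, coeff_mk,
    projectorSum_eq_of_solution (n := 1) (by decide) basis_zero_get (v := fun _ => 1)]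
  · simp [leftElement]
  · intro x hx
    have := hx 0
    simp [gram_eq, numW] at this
    funext i
    rw [Subsingleton.elim i 0, this]
    rfl
  · simp [gram_eq, numW, rightElement]

end Normalisation

/-! ### The logarithm of the block to third order. -/

section Logarithm

open PowerSeries

variable {K : Type*} [Field K] [Algebra ℚ K]

/-- Since `f - 1` is divisible by `X`, its `d`-th power is divisible by `X ^ d`, and only `d ≤ n`
contributes. -/
theorem coeff_logOf_eq_sum {f : K⟦X⟧} (hf : constantCoeff f = 1) {n N : ℕ} (hn : n < N) :
    coeff n (logOf f) = ∑ d ∈ Finset.range N, coeff d (log K) * coeff n ((f - 1) ^ d) := by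
  have hc : constantCoeff (f - 1) = 0 := by simp [hf]
  rw [logOf_eq, coeff_subst' (HasSubst.of_constantCoeff_zero' hc),
    finsum_eq_sum_of_support_subset (s := Finset.range N)]
  · simp
  · intro d hd
    rw [Finset.coe_range, Set.mem_Iio]
    by_contra! h
    refine hd ?_
    have h1 : (X : K⟦X⟧) ^ d ∣ (f - 1) ^ d := pow_dvd_pow_of_dvd (X_dvd_iff.2 hc) d
    simp [X_pow_dvd_iff.1 h1 n (by lia)]

variable {f : K⟦X⟧}

theorem coeff_zero_logOf (hf : constantCoeff f = 1) : coeff 0 (logOf f) = 0 := by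
  rw [coeff_zero_eq_constantCoeff_apply, constantCoeff_logOf hf]

theorem coeff_one_logOf (hf : constantCoeff f = 1) : coeff 1 (logOf f) = coeff 1 f := by
  rw [coeff_logOf_eq_sum hf (N := 2) (by lia)]
  simp [Finset.sum_range_succ, coeff_one]

variable [CharZero K]

theorem coeff_two_logOf (hf : constantCoeff f = 1) :
    coeff 2 (logOf f) = coeff 2 f - coeff 1 f ^ 2 / 2 := by
  rw [coeff_logOf_eq_sum hf (N := 3) (by lia)]
  simp [Finset.sum_range_succ, coeff_one, pow_succ, coeff_mul, Finset.Nat.antidiagonal_succ, hf]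
  ring

theorem coeff_three_logOf (hf : constantCoeff f = 1) :
    coeff 3 (logOf f) = coeff 3 f - coeff 1 f * coeff 2 f + coeff 1 f ^ 3 / 3 := by
  rw [coeff_logOf_eq_sum hf (N := 4) (by lia)]
  simp [Finset.sum_range_succ, coeff_one, pow_succ, coeff_mul, Finset.Nat.antidiagonal_succ, hf]
  ring

/-- The coefficients of the logarithm of the block, up to third order. -/
def logCoeff (c y h H t : K) : ℕ → K
  | 1 => H / 2 + logOne c y h H t
  | 2 => H / 4 + logOne c y h H t / 2 + logTwo c y h H t
  | 3 => H / 6 + 3 / 8 * logOne c y h H t + logTwo c y h H t + logThree c y h H t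
  | _ => 0

/-- With `u = w / h` the charge condition becomes `(22 + 5 c) u² = 32 h + 2 - c`. In `x = z / √(1 -
z)` the logarithm is `-(H / 2) log (1 - z) + ℓ₁ x + ℓ₂ x² + ℓ₃ x³` modulo `z⁴`. The numerical
coefficients of `logCoeff` come from `x = z + z²/2 + 3z³/8 + ⋯` and `x² = z² + z³ + ⋯`. -/
theorem coeff_logBlock {c h w H : K} (hg : IsGeneric c H) (hh : h ≠ 0)
    (hw : w ^ 2 = semiDegenerateCharge c h) {n : ℕ} (hn : n < 4) :
    coeff n (logBlock c h w H) = logCoeff c 1 h H 1 n := by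
  obtain ⟨u, rfl⟩ : ∃ u, w = u * h := ⟨w / h, (div_mul_cancel₀ w hh).symm⟩
  have hu : (22 + 5 * c) * u ^ 2 = linDet c 1 h 1 := by
    have hk := hg.central
    have : u ^ 2 = 32 / (22 + 5 * c) * (h + 1 / 5) - 1 / 5 :=
      mul_right_cancel₀ (pow_ne_zero 2 hh) (by rw [← mul_pow, hw, semiDegenerateCharge])
    rw [this, linDet]
    field_simp
    ring
  have h0 := constantCoeff_block c h (u * h) H
  have h1 := coeff_block_one hg hh hu
  have h2 := coeff_block_two hg hh hu
  have h3 := coeff_block_three hg hh hu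
  rw [logBlock]
  interval_cases n
  · rw [coeff_zero_logOf h0, logCoeff]
    all_goals simp
  · rw [coeff_one_logOf h0, h1, logCoeff]
  · rw [coeff_two_logOf h0, h1, h2, logCoeff]
    ring
  · rw [coeff_three_logOf h0, h1, h2, h3, logCoeff]
    ring

end Logarithm

/-! ### Homogeneity of the logarithmic coefficients. -/

section Scaling

variable {R : Type*} [CommRing R] (a b c y X H d t : R)

theorem linDet_scale :
    linDet (a * b * c) (b * y) (a * X) (a * t) = a * b * linDet c y X t := by
  unfold linDet; ring

theorem evenDet_scale :
    evenDet (a * b * c) (b * y) (a * H) (a * t) = a ^ 2 * b * evenDet c y H t := by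
  unfold evenDet; ring

theorem qpDet_scale :
    qpDet (a * b * c) (b * y) (a * H) (a * t) = a ^ 2 * b * qpDet c y H t := by
  unfold qpDet; ring

theorem qpDetThree_scale :
    qpDetThree (a * b * c) (b * y) (a * H) (a * t) = a ^ 2 * b * qpDetThree c y H t := by
  unfold qpDetThree; ring

theorem oddDet_scale :
    oddDet (a * b * c) (b * y) (a * H) (a * t) = a ^ 2 * b ^ 2 * oddDet c y H t := by
  unfold oddDet; ring

theorem numTwo_scale :
    numTwo (a * b * c) (b * y) (a * H) (a * d) (a * t) = a ^ 5 * b ^ 3 * numTwo c y H d t := by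
  unfold numTwo; ring

theorem numThree_scale :
    numThree (a * b * c) (b * y) (a * H) (a * d) (a * t) = a ^ 7 * b ^ 5 * numThree c y H d t := by
  unfold numThree; ring

variable {K : Type*} [Field K] {a b : K} (c y h H t : K)

/-- In `(a, b)` the bidegrees are `(1, 1)` for `linDet`, `(2, 1)` for `evenDet`, `(2, 2)` for
`oddDet`, `(5, 3)` for `numTwo` and `(7, 5)` for `numThree`. In the numerators the first slot holds
a value of `linDet`, which scales like the central charge. Each of the three quotients then has
bidegree `(1, 0)`. This allows `c^α` to be pulled out and leaves only `c^(-α)` and one power of `c`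
that measures `α - 1`. -/
theorem logCoeff_scale (ha : a ≠ 0) (hb : b ≠ 0) (n : ℕ) :
    logCoeff (a * b * c) (b * y) (a * h) (a * H) (a * t) n = a * logCoeff c y h H t n := by
  have h1 : logOne (a * b * c) (b * y) (a * h) (a * H) (a * t) = a * logOne c y h H t := by
    rw [logOne, logOne, linDet_scale, linDet_scale, ← mul_div_assoc,
      ← mul_div_mul_left _ (2 * linDet c y H t) (mul_ne_zero ha hb)]
    congr 1 <;> ring
  have h2 : logTwo (a * b * c) (b * y) (a * h) (a * H) (a * t) = a * logTwo c y h H t := by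
    rw [logTwo, logTwo, linDet_scale, evenDet_scale, ← mul_sub, numTwo_scale, ← mul_div_assoc,
      ← mul_div_mul_left _ (_ * evenDet c y H t)
        (mul_ne_zero (pow_ne_zero 4 ha) (pow_ne_zero 3 hb))]
    congr 1 <;> ring
  have h3 : logThree (a * b * c) (b * y) (a * h) (a * H) (a * t) = a * logThree c y h H t := by
    rw [logThree, logThree, linDet_scale, linDet_scale, evenDet_scale, oddDet_scale, ← mul_sub,
      numThree_scale, ← mul_div_assoc, ← mul_div_mul_left _ (_ * oddDet c y H t)
        (mul_ne_zero (pow_ne_zero 7 ha) (pow_ne_zero 6 hb))]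
    congr 1 <;> ring
  match n with
  | 0 => simp [logCoeff]
  | 1 => simp only [logCoeff, h1]; ring
  | 2 => simp only [logCoeff, h1, h2]; ring
  | 3 => simp only [logCoeff, h1, h2, h3]; ring
  | n + 4 => simp [logCoeff]

end Scaling

/-! ### Puiseux series: powers of `c`, integrality, substitution into power series. -/

section Powers

theorem cPow_mul (a b : ℚ) : cPow a * cPow b = cPow (a + b) := by
  simp [cPow, HahnSeries.single_mul_single, add_comm]

@[simp]
theorem cPow_zero : cPow 0 = 1 := by
  simp [cPow]

theorem cPow_ne_zero (a : ℚ) : cPow a ≠ 0 := by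
  simp [cPow]

theorem orderTop_cPow (a : ℚ) : (cPow a).orderTop = ((-a : ℚ) : WithTop ℚ) := by
  simp [cPow, HahnSeries.orderTop_single]

theorem coeff_cPow_mul (a : ℚ) (x : Puiseux) (g : ℚ) :
    (cPow a * x).coeff g = x.coeff (g + a) := by
  have := HahnSeries.coeff_single_mul_add (r := (1 : ℂ)) (x := x) (a := g + a) (b := -a)
  rw [one_mul, add_neg_cancel_right] at this
  exact this

/-- Puiseux series with non-positive powers of `c` only. -/
noncomputable def integral : Subring Puiseux where
  carrier := {x | (0 : WithTop ℚ) ≤ x.orderTop}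
  mul_mem' {x y} hx hy := by
    have hx' : (0 : WithTop ℚ) ≤ x.orderTop := hx
    have hy' : (0 : WithTop ℚ) ≤ y.orderTop := hy
    exact (add_nonneg hx' hy').trans HahnSeries.orderTop_add_le_mul
  one_mem' := by simp
  add_mem' {x y} hx hy := by
    have hx' : (0 : WithTop ℚ) ≤ x.orderTop := hx
    have hy' : (0 : WithTop ℚ) ≤ y.orderTop := hy
    exact (le_min hx' hy').trans HahnSeries.min_orderTop_le_orderTop_add
  zero_mem' := by simp
  neg_mem' {x} hx := by simpa using hx

theorem mem_integral_iff {x : Puiseux} : x ∈ integral ↔ (0 : WithTop ℚ) ≤ x.orderTop :=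
  Iff.rfl

theorem mem_integral_of_coeff {x : Puiseux} (h : ∀ g < 0, x.coeff g = 0) : x ∈ integral :=
  mem_integral_iff.2 <| HahnSeries.le_orderTop_iff_forall.2 fun g hg =>
    h g (WithTop.coe_lt_coe.1 hg)

theorem coeff_of_mem_integral {x : Puiseux} (h : x ∈ integral) {g : ℚ} (hg : g < 0) :
    x.coeff g = 0 :=
  HahnSeries.coeff_eq_zero_of_lt_orderTop
    (lt_of_lt_of_le (WithTop.coe_lt_coe.2 hg) (mem_integral_iff.1 h))

theorem cPow_mem_integral {a : ℚ} (ha : a ≤ 0) : cPow a ∈ integral := by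
  rw [mem_integral_iff, orderTop_cPow]
  exact WithTop.coe_le_coe.2 (neg_nonneg.2 ha)

/-- The correction has strictly positive order, so the sum has the order of `1`; orders are additive
under products, so the inverse has order zero as well. -/
theorem inv_one_add_mem_integral {a : ℚ} (ha : a < 0) {r : Puiseux} (hr : r ∈ integral) :
    1 + cPow a * r ≠ 0 ∧ (1 + cPow a * r)⁻¹ ∈ integral := by
  have hlt : (1 : Puiseux).orderTop < (cPow a * r).orderTop := by
    refine lt_of_lt_of_le ?_ HahnSeries.orderTop_add_le_mul
    rw [orderTop_cPow, HahnSeries.orderTop_one]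
    refine lt_of_lt_of_le (b := ((-a : ℚ) : WithTop ℚ)) ?_ (le_add_of_nonneg_right (mem_integral_iff.1 hr))
    exact WithTop.coe_lt_coe.2 (neg_pos.2 ha)
  have h0 : (1 + cPow a * r).orderTop = 0 := by
    rw [HahnSeries.orderTop_add_eq_left hlt, HahnSeries.orderTop_one]
  have hne : 1 + cPow a * r ≠ 0 := by
    intro h
    rw [h] at h0
    simp at h0
  refine ⟨hne, ?_⟩
  have h1 := HahnSeries.orderTop_mul (1 + cPow a * r) (1 + cPow a * r)⁻¹
  rw [mul_inv_cancel₀ hne, h0, zero_add, HahnSeries.orderTop_one] at h1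
  exact mem_integral_iff.2 (le_of_eq h1)

/-- Substitution of `c ^ (-σ)` into a power series. -/
noncomputable def ev (σ : ℚ) : PowerSeries ℂ →+* HahnSeries ℚ ℂ where
  toFun f := (HahnSeries.SummableFamily.powerSeriesFamily (cPow (-σ)) f).hsum
  map_one' := (PowerSeries.heval (R := ℂ) (cPow (-σ))).map_one'
  map_mul' := (PowerSeries.heval (R := ℂ) (cPow (-σ))).map_mul'
  map_zero' := (PowerSeries.heval (R := ℂ) (cPow (-σ))).map_zero'
  map_add' := (PowerSeries.heval (R := ℂ) (cPow (-σ))).map_add'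

variable {σ : ℚ}

theorem orderTop_cPow_neg_pos (hσ : 0 < σ) : 0 < (cPow (-σ)).orderTop := by
  rw [orderTop_cPow, neg_neg]
  exact_mod_cast hσ

theorem coeff_ev_eq_finsum (hσ : 0 < σ) (f : PowerSeries ℂ) (g : ℚ) :
    (ev σ f).coeff g = ∑ᶠ n : ℕ, if g = n * σ then PowerSeries.coeff n f else 0 := by
  change (PowerSeries.heval (cPow (-σ)) f).coeff g = _
  rw [PowerSeries.coeff_heval]
  refine finsum_congr fun n => ?_
  rw [HahnSeries.SummableFamily.coeff_def,
    HahnSeries.SummableFamily.powerSeriesFamily_of_orderTop_pos (orderTop_cPow_neg_pos hσ)]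
  simp only [cPow, neg_neg, HahnSeries.single_pow, one_pow, HahnSeries.coeff_smul,
    HahnSeries.coeff_single, nsmul_eq_mul, smul_eq_mul]
  split_ifs <;> simp

/-- The exponents `n σ` are pairwise distinct for `σ > 0`, so no two terms of the power series mix.
-/
theorem coeff_ev_mul (hσ : 0 < σ) (f : PowerSeries ℂ) (n : ℕ) :
    (ev σ f).coeff (n * σ) = PowerSeries.coeff n f := by
  rw [coeff_ev_eq_finsum hσ, finsum_eq_single _ n, if_pos rfl]
  intro m hm
  rw [if_neg]
  intro h
  exact hm (by exact_mod_cast (mul_right_cancel₀ hσ.ne' h).symm)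

theorem coeff_ev_of_ne (hσ : 0 < σ) (f : PowerSeries ℂ) {g : ℚ} (h : ∀ n : ℕ, g ≠ n * σ) :
    (ev σ f).coeff g = 0 := by
  rw [coeff_ev_eq_finsum hσ]
  simp [h]

theorem coeff_ev_zero (hσ : 0 < σ) (f : PowerSeries ℂ) :
    (ev σ f).coeff 0 = PowerSeries.coeff 0 f := by
  simpa using coeff_ev_mul hσ f 0

theorem ev_mem_integral (hσ : 0 < σ) (f : PowerSeries ℂ) : ev σ f ∈ integral :=
  mem_integral_of_coeff fun g hg => coeff_ev_of_ne hσ f fun n h => by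
    have : (0 : ℚ) ≤ n * σ := by positivity
    linarith

theorem ev_X (hσ : 0 < σ) : ev σ PowerSeries.X = cPow (-σ) :=
  PowerSeries.heval_X _ (orderTop_cPow_neg_pos hσ)

theorem ev_C (r : ℂ) : ev σ (PowerSeries.C r) = HahnSeries.C r := by
  change PowerSeries.heval (cPow (-σ)) (PowerSeries.C r) = _
  rw [PowerSeries.heval_C, HahnSeries.C_apply]
  ext g
  rw [HahnSeries.coeff_smul, HahnSeries.coeff_one, HahnSeries.coeff_single]
  split_ifs <;> simp

end Powers

/-! ### Expansions in `s = c^(-σ)` and `t = c^(-α)`, modulo `t²`. -/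

section Expansions

open PowerSeries

/-- Power series in `t` whose coefficients are power series in `s`. -/
abbrev Bi := PowerSeries (PowerSeries ℂ)

variable {σ α : ℚ}

/-- Pairs of a series in `s` and `t` and of a Puiseux series which is its value at
`s = c ^ (-σ)` and `t = c ^ (-α)`, modulo `t²`. -/
noncomputable def expansions (hσ : 0 < σ) (hα : 0 < α) : Subring (Bi × Puiseux) where
  carrier := {p | ∃ r ∈ integral,
    p.2 = ev σ (coeff 0 p.1) + cPow (-α) * ev σ (coeff 1 p.1) + cPow (-α) ^ 2 * r}
  mul_mem' := by
    rintro ⟨E, x⟩ ⟨E', x'⟩ ⟨r, hr, h⟩ ⟨r', hr', h'⟩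
    have ht : cPow (-α) ∈ integral := cPow_mem_integral (by linarith)
    have he := fun f => ev_mem_integral hσ f
    -- The remainder of the product consists of the product of the two `t`-linear terms and of
    -- everything that contains one of the two remainders.
    refine ⟨ev σ (coeff 1 E) * ev σ (coeff 1 E') +
      r * (ev σ (coeff 0 E') + cPow (-α) * ev σ (coeff 1 E') + cPow (-α) ^ 2 * r') +
      r' * (ev σ (coeff 0 E) + cPow (-α) * ev σ (coeff 1 E)), ?_, ?_⟩
    · exact add_mem (add_mem (mul_mem (he _) (he _)) (mul_mem hr
        (add_mem (add_mem (he _) (mul_mem ht (he _))) (mul_mem (pow_mem ht 2) hr'))))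
        (mul_mem hr' (add_mem (he _) (mul_mem ht (he _))))
    · dsimp only at h h' ⊢
      rw [Prod.mk_mul_mk, h, h']
      dsimp only
      rw [coeff_mul, coeff_mul]
      simp [Finset.Nat.antidiagonal_succ]
      ring
  one_mem' := ⟨0, zero_mem _, by simp [coeff_one]⟩
  add_mem' := by
    rintro ⟨E, x⟩ ⟨E', x'⟩ ⟨r, hr, h⟩ ⟨r', hr', h'⟩
    refine ⟨r + r', add_mem hr hr', ?_⟩
    dsimp only at h h' ⊢
    rw [Prod.mk_add_mk, h, h']
    simp only [map_add]
    ring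
  zero_mem' := ⟨0, zero_mem _, by simp⟩
  neg_mem' := by
    rintro ⟨E, x⟩ ⟨r, hr, h⟩
    refine ⟨-r, neg_mem hr, ?_⟩
    dsimp only at h ⊢
    rw [Prod.neg_mk, h]
    simp only [map_neg]
    ring

variable (hσ : 0 < σ) (hα : 0 < α)

/-- The Puiseux series `x` is the value of `E` at `s = c ^ (-σ)`, `t = c ^ (-α)`, modulo `t²`. -/
def Expands (E : Bi) (x : Puiseux) : Prop :=
  (E, x) ∈ expansions hσ hα

variable {hσ hα} {E E' : Bi} {x x' : Puiseux}

theorem Expands.add (h : Expands hσ hα E x) (h' : Expands hσ hα E' x') :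
    Expands hσ hα (E + E') (x + x') :=
  add_mem (s := expansions hσ hα) (a := (E, x)) (b := (E', x')) h h'

theorem Expands.sub (h : Expands hσ hα E x) (h' : Expands hσ hα E' x') :
    Expands hσ hα (E - E') (x - x') :=
  sub_mem (H := expansions hσ hα) (x := (E, x)) (y := (E', x')) h h'

theorem Expands.mul (h : Expands hσ hα E x) (h' : Expands hσ hα E' x') :
    Expands hσ hα (E * E') (x * x') :=
  mul_mem (s := expansions hσ hα) (a := (E, x)) (b := (E', x')) h h'

theorem Expands.pow (h : Expands hσ hα E x) (n : ℕ) : Expands hσ hα (E ^ n) (x ^ n) :=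
  (expansions hσ hα).pow_mem (x := (E, x)) h n

theorem Expands.one : Expands hσ hα 1 1 :=
  one_mem (expansions hσ hα)

theorem Expands.zero : Expands hσ hα 0 0 :=
  zero_mem (expansions hσ hα)

/-- A constant as a series in `s` and `t`. -/
noncomputable def constBi : ℂ →+* Bi :=
  (C (R := PowerSeries ℂ)).comp (C (R := ℂ))

theorem Expands.const (r : ℂ) : Expands hσ hα (constBi r) (HahnSeries.C r) :=
  ⟨0, zero_mem _, by simp [constBi, coeff_C, ev_C]⟩

theorem Expands.t : Expands hσ hα X (cPow (-α)) :=
  ⟨0, zero_mem _, by simp [coeff_one_X]⟩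

theorem Expands.s : Expands hσ hα (C X) (cPow (-σ)) :=
  ⟨0, zero_mem _, by simp [coeff_C, ev_X hσ]⟩

/-- Division of Puiseux series is reduced to inversion of formal series: the truncated value `y` of
`E'` satisfies `x y = 1 + t² ρ` with `ρ` integral. Hence `x ≠ 0`, and `x⁻¹` differs from `y` by `t²`
times an integral series. -/
theorem Expands.inv_aux (h : Expands hσ hα E x) (hE : E * E' = 1) :
    x ≠ 0 ∧ Expands hσ hα E' x⁻¹ := by
  set y : Puiseux := ev σ (coeff 0 E') + cPow (-α) * ev σ (coeff 1 E') with hy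
  have hEy : Expands hσ hα E' y := ⟨0, zero_mem _, by simp [hy]⟩
  obtain ⟨ρ, hρ, h1⟩ := h.mul hEy
  have ht : cPow (-α) ∈ integral := cPow_mem_integral (by linarith)
  have hyi : y ∈ integral :=
    add_mem (ev_mem_integral hσ _) (mul_mem ht (ev_mem_integral hσ _))
  simp only [hE, coeff_one, if_true, map_one, one_ne_zero, if_false, map_zero, mul_zero,
    add_zero] at h1
  have h2 : cPow (-α) ^ 2 = cPow (-α + -α) := by rw [pow_two, cPow_mul]
  rw [h2] at h1
  obtain ⟨hne, hinv⟩ := inv_one_add_mem_integral (a := -α + -α) (by linarith) hρ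
  rw [← h1] at hne
  have hx : x ≠ 0 := left_ne_zero_of_mul hne
  refine ⟨hx, -(y * (1 + cPow (-α + -α) * ρ)⁻¹ * ρ),
    neg_mem (mul_mem (mul_mem hyi hinv) hρ), ?_⟩
  rw [← h1, ← hy, h2]
  have hy0 : y ≠ 0 := right_ne_zero_of_mul hne
  have h3 : cPow (-α + -α) * ρ = x * y - 1 := by rw [h1]; ring
  -- This is `x⁻¹ = y (x y)⁻¹` together with `(1 + ε)⁻¹ = 1 - (1 + ε)⁻¹ ε` for `ε = t² ρ`.
  have : x⁻¹ = y - y * (x * y)⁻¹ * (cPow (-α + -α) * ρ) := by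
    rw [h3]
    field_simp
    ring
  rw [this]
  ring

theorem Expands.inv (h : Expands hσ hα E x) (hE : E * E' = 1) : Expands hσ hα E' x⁻¹ :=
  (h.inv_aux hE).2

/-- The constant term. -/
noncomputable def constTerm : Bi →+* ℂ :=
  (constantCoeff (R := ℂ)).comp (constantCoeff (R := PowerSeries ℂ))

theorem exists_mul_eq_one_of_constTerm (h : constTerm E ≠ 0) : ∃ E', E * E' = 1 := by
  have : IsUnit E := by
    rw [isUnit_iff_constantCoeff, isUnit_iff_constantCoeff]
    exact isUnit_iff_ne_zero.2 h
  exact this.exists_right_inv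

theorem Expands.ne_zero (h : Expands hσ hα E x) (hE : constTerm E ≠ 0) : x ≠ 0 := by
  obtain ⟨E', h'⟩ := exists_mul_eq_one_of_constTerm hE
  exact (h.inv_aux h').1

section Coefficients

/-- After multiplication by `c^α` the remainder becomes `c^(-α)` times an integral series and
contains only negative powers of `c`. Expansions modulo `t²` therefore determine all non-negative
powers. The four corollaries locate the exponents: at positive powers only `t⁰` contributes, while
at `c^0` the term `s⁰ t¹` always appears and a term `s^i t⁰` is added precisely when `i σ = α`. -/
theorem Expands.coeff_eq (h : Expands hσ hα E x) {g : ℚ} (hg : g ≤ 0) :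
    (cPow α * x).coeff g = (ev σ (coeff 0 E)).coeff (g + α) + (ev σ (coeff 1 E)).coeff g := by
  obtain ⟨r, hr, h⟩ := h
  dsimp only at h
  have h1 : cPow α * x =
      cPow α * ev σ (coeff 0 E) + ev σ (coeff 1 E) + cPow (-α) * r := by
    have : cPow α * cPow (-α) = 1 := by rw [cPow_mul]; simp
    rw [h]
    linear_combination (ev σ (coeff 1 E) + cPow (-α) * r) * this
  rw [h1, HahnSeries.coeff_add, HahnSeries.coeff_add, coeff_cPow_mul, coeff_cPow_mul,
    coeff_of_mem_integral hr (by linarith), add_zero]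

theorem Expands.coeff_pos (h : Expands hσ hα E x) {i : ℕ} (hi : (i : ℚ) * σ < α) :
    (cPow α * x).coeff (-(α - i * σ)) = coeff i (coeff 0 E) := by
  rw [h.coeff_eq (by linarith), show -(α - i * σ) + α = i * σ by ring, coeff_ev_mul hσ,
    coeff_of_mem_integral (ev_mem_integral hσ _) (by linarith), add_zero]

theorem Expands.coeff_zero (h : Expands hσ hα E x) {i : ℕ} (hi : (i : ℚ) * σ = α) :
    (cPow α * x).coeff 0 = coeff i (coeff 0 E) + coeff 0 (coeff 1 E) := by
  rw [h.coeff_eq le_rfl, zero_add, ← hi, coeff_ev_mul hσ, coeff_ev_zero hσ]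

theorem Expands.coeff_zero_of_ne (h : Expands hσ hα E x) (hi : ∀ i : ℕ, (i : ℚ) * σ ≠ α) :
    (cPow α * x).coeff 0 = coeff 0 (coeff 1 E) := by
  rw [h.coeff_eq le_rfl, zero_add, coeff_ev_of_ne hσ _ fun i => (hi i).symm, coeff_ev_zero hσ,
    zero_add]

theorem Expands.coeff_of_ne (h : Expands hσ hα E x) {g : ℚ} (hg : g < 0)
    (hi : ∀ i : ℕ, g ≠ -(α - i * σ)) : (cPow α * x).coeff g = 0 := by
  rw [h.coeff_eq hg.le, coeff_of_mem_integral (ev_mem_integral hσ _) hg, add_zero,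
    coeff_ev_of_ne hσ]
  intro i hi'
  exact hi i (by linarith)

end Coefficients

end Expansions

/-! ### Polynomial expressions under ring homomorphisms. -/

section Maps

variable {R S : Type*} [CommRing R] [CommRing S] (f : R →+* S) (c y X H d t : R)

theorem map_linDet : f (linDet c y X t) = linDet (f c) (f y) (f X) (f t) := by
  simp only [linDet, map_add, map_sub, map_mul, map_ofNat]

theorem map_evenDet : f (evenDet c y H t) = evenDet (f c) (f y) (f H) (f t) := by
  simp only [evenDet, map_add, map_sub, map_mul, map_pow, map_ofNat]

theorem map_qpDet : f (qpDet c y H t) = qpDet (f c) (f y) (f H) (f t) := by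
  simp only [qpDet, map_add, map_sub, map_mul, map_pow, map_ofNat]

theorem map_qpDetThree : f (qpDetThree c y H t) = qpDetThree (f c) (f y) (f H) (f t) := by
  simp only [qpDetThree, map_add, map_sub, map_mul, map_pow, map_ofNat]

theorem map_oddDet : f (oddDet c y H t) = oddDet (f c) (f y) (f H) (f t) := by
  simp only [oddDet, map_add, map_sub, map_mul, map_pow, map_ofNat]

theorem map_numTwo : f (numTwo c y H d t) = numTwo (f c) (f y) (f H) (f d) (f t) := by
  simp only [numTwo, map_add, map_sub, map_mul, map_pow, map_ofNat]

theorem map_numThree : f (numThree c y H d t) = numThree (f c) (f y) (f H) (f d) (f t) := by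
  simp only [numThree, map_add, map_sub, map_mul, map_pow, map_ofNat]

end Maps

/-! ### Expansions of polynomial expressions. -/

section Closure

variable {σ α : ℚ} (hσ : 0 < σ) (hα : 0 < α)

/-- The expansion of a Puiseux series, as a ring homomorphism. -/
noncomputable def expansionHom : expansions hσ hα →+* Bi :=
  (RingHom.fst _ _).comp (expansions hσ hα).subtype

/-- The Puiseux series with a given expansion, as a ring homomorphism. -/
noncomputable def valueHom : expansions hσ hα →+* Puiseux :=
  (RingHom.snd _ _).comp (expansions hσ hα).subtype

variable {hσ hα} {p q P D T : Bi} {c y X d t : Puiseux}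

theorem expands_of_eq {x : expansions hσ hα} (hp : expansionHom hσ hα x = p)
    (hc : valueHom hσ hα x = c) : Expands hσ hα p c :=
  hp ▸ hc ▸ x.2

theorem Expands.exists_eq (h : Expands hσ hα p c) :
    ∃ x, expansionHom hσ hα x = p ∧ valueHom hσ hα x = c :=
  ⟨⟨(p, c), h⟩, rfl, rfl⟩

/-- Pairs of an expansion and its value form a ring, and both projections are ring homomorphisms.
Evaluating the polynomial in that ring and projecting avoids following its monomials one by one; the
lemmas below repeat this for the other polynomials. -/
theorem Expands.linDet (hc : Expands hσ hα p c) (hy : Expands hσ hα q y)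
    (hX : Expands hσ hα P X) (ht : Expands hσ hα T t) :
    Expands hσ hα (linDet p q P T) (linDet c y X t) := by
  obtain ⟨_, rfl, rfl⟩ := hc.exists_eq
  obtain ⟨_, rfl, rfl⟩ := hy.exists_eq
  obtain ⟨_, rfl, rfl⟩ := hX.exists_eq
  obtain ⟨_, rfl, rfl⟩ := ht.exists_eq
  exact expands_of_eq (map_linDet _ _ _ _ _) (map_linDet _ _ _ _ _)

theorem Expands.evenDet (hc : Expands hσ hα p c) (hy : Expands hσ hα q y)
    (hX : Expands hσ hα P X) (ht : Expands hσ hα T t) :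
    Expands hσ hα (evenDet p q P T) (evenDet c y X t) := by
  obtain ⟨_, rfl, rfl⟩ := hc.exists_eq
  obtain ⟨_, rfl, rfl⟩ := hy.exists_eq
  obtain ⟨_, rfl, rfl⟩ := hX.exists_eq
  obtain ⟨_, rfl, rfl⟩ := ht.exists_eq
  exact expands_of_eq (map_evenDet _ _ _ _ _) (map_evenDet _ _ _ _ _)

theorem Expands.qpDet (hc : Expands hσ hα p c) (hy : Expands hσ hα q y)
    (hX : Expands hσ hα P X) (ht : Expands hσ hα T t) :
    Expands hσ hα (qpDet p q P T) (qpDet c y X t) := by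
  obtain ⟨_, rfl, rfl⟩ := hc.exists_eq
  obtain ⟨_, rfl, rfl⟩ := hy.exists_eq
  obtain ⟨_, rfl, rfl⟩ := hX.exists_eq
  obtain ⟨_, rfl, rfl⟩ := ht.exists_eq
  exact expands_of_eq (map_qpDet _ _ _ _ _) (map_qpDet _ _ _ _ _)

theorem Expands.qpDetThree (hc : Expands hσ hα p c) (hy : Expands hσ hα q y)
    (hX : Expands hσ hα P X) (ht : Expands hσ hα T t) :
    Expands hσ hα (qpDetThree p q P T) (qpDetThree c y X t) := by
  obtain ⟨_, rfl, rfl⟩ := hc.exists_eq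
  obtain ⟨_, rfl, rfl⟩ := hy.exists_eq
  obtain ⟨_, rfl, rfl⟩ := hX.exists_eq
  obtain ⟨_, rfl, rfl⟩ := ht.exists_eq
  exact expands_of_eq (map_qpDetThree _ _ _ _ _) (map_qpDetThree _ _ _ _ _)

theorem Expands.oddDet (hc : Expands hσ hα p c) (hy : Expands hσ hα q y)
    (hX : Expands hσ hα P X) (ht : Expands hσ hα T t) :
    Expands hσ hα (oddDet p q P T) (oddDet c y X t) := by
  obtain ⟨_, rfl, rfl⟩ := hc.exists_eq
  obtain ⟨_, rfl, rfl⟩ := hy.exists_eq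
  obtain ⟨_, rfl, rfl⟩ := hX.exists_eq
  obtain ⟨_, rfl, rfl⟩ := ht.exists_eq
  exact expands_of_eq (map_oddDet _ _ _ _ _) (map_oddDet _ _ _ _ _)

theorem Expands.numTwo (hc : Expands hσ hα p c) (hy : Expands hσ hα q y)
    (hX : Expands hσ hα P X) (hd : Expands hσ hα D d) (ht : Expands hσ hα T t) :
    Expands hσ hα (numTwo p q P D T) (numTwo c y X d t) := by
  obtain ⟨_, rfl, rfl⟩ := hc.exists_eq
  obtain ⟨_, rfl, rfl⟩ := hy.exists_eq
  obtain ⟨_, rfl, rfl⟩ := hX.exists_eq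
  obtain ⟨_, rfl, rfl⟩ := hd.exists_eq
  obtain ⟨_, rfl, rfl⟩ := ht.exists_eq
  exact expands_of_eq (map_numTwo _ _ _ _ _ _) (map_numTwo _ _ _ _ _ _)

theorem Expands.numThree (hc : Expands hσ hα p c) (hy : Expands hσ hα q y)
    (hX : Expands hσ hα P X) (hd : Expands hσ hα D d) (ht : Expands hσ hα T t) :
    Expands hσ hα (numThree p q P D T) (numThree c y X d t) := by
  obtain ⟨_, rfl, rfl⟩ := hc.exists_eq
  obtain ⟨_, rfl, rfl⟩ := hy.exists_eq
  obtain ⟨_, rfl, rfl⟩ := hX.exists_eq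
  obtain ⟨_, rfl, rfl⟩ := hd.exists_eq
  obtain ⟨_, rfl, rfl⟩ := ht.exists_eq
  exact expands_of_eq (map_numThree _ _ _ _ _ _) (map_numThree _ _ _ _ _ _)

end Closure

/-! ### The logarithmic coefficients as power series in `s` and `t`. -/

section LogSeries

open PowerSeries

/-- The determinants have non-zero constant term, when the central charge and the homogenising
variable are `p` and `q` up to a common factor and the internal dimension is `δt / t`. -/
structure IsRegular (p q : Bi) (δt : ℂ) : Prop where
  weight : δt ≠ 0
  lin : constTerm (linDet p q (constBi δt) X) ≠ 0
  even : constTerm (evenDet p q (constBi δt) X) ≠ 0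
  qp : constTerm (qpDet p q (constBi δt) X) ≠ 0
  qpThree : constTerm (qpDetThree p q (constBi δt) X) ≠ 0
  odd : constTerm (oddDet p q (constBi δt) X) ≠ 0

/-- The expansion of `logOne`. -/
noncomputable def seriesOne (p q : Bi) (δ δt : ℂ) : Bi :=
  constBi (δt / 2) * linDet p q (constBi δ) X * Ring.inverse (linDet p q (constBi δt) X)

/-- The expansion of `logTwo`. -/
noncomputable def seriesTwo (p q : Bi) (δ δt : ℂ) : Bi :=
  constBi (1 / 4) * numTwo (linDet p q (constBi δt) X) q (constBi δt) (constBi δ - constBi δt) X *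
    Ring.inverse (linDet p q (constBi δt) X ^ 2 * evenDet p q (constBi δt) X)

/-- The expansion of `logThree`. -/
noncomputable def seriesThree (p q : Bi) (δ δt : ℂ) : Bi :=
  constBi (1 / 48) * (linDet p q (constBi δ) X *
    numThree (linDet p q (constBi δt) X) q (constBi δt) (constBi δ - constBi δt) X) *
    Ring.inverse (linDet p q (constBi δt) X ^ 3 * evenDet p q (constBi δt) X *
      oddDet p q (constBi δt) X)

/-- The expansion of `logCoeff`. -/
noncomputable def logSeries (p q : Bi) (δ δt : ℂ) : ℕ → Bi
  | 1 => constBi (δt / 2) + seriesOne p q δ δt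
  | 2 => constBi (δt / 4) + constBi (1 / 2) * seriesOne p q δ δt + seriesTwo p q δ δt
  | 3 => constBi (δt / 6) + constBi (3 / 8) * seriesOne p q δ δt + seriesTwo p q δ δt +
      seriesThree p q δ δt
  | _ => 0

theorem mul_ringInverse_of_constTerm {E : Bi} (h : constTerm E ≠ 0) :
    E * Ring.inverse E = 1 := by
  obtain ⟨E', h'⟩ := exists_mul_eq_one_of_constTerm h
  exact Ring.mul_inverse_cancel _ (IsUnit.of_mul_eq_one _ h')

variable {σ α : ℚ} {hσ : 0 < σ} {hα : 0 < α} {p q : Bi} {c y : Puiseux} {δ δt : ℂ}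

theorem Expands.ringInverse {E : Bi} {x : Puiseux} (h : Expands hσ hα E x)
    (hE : constTerm E ≠ 0) : Expands hσ hα (Ring.inverse E) x⁻¹ :=
  h.inv (mul_ringInverse_of_constTerm hE)

variable (hp : Expands hσ hα p c) (hq : Expands hσ hα q y) (hr : IsRegular p q δt)

include hp hq hr

theorem Expands.logOne :
    Expands hσ hα (seriesOne p q δ δt)
      (logOne c y (HahnSeries.C δ) (HahnSeries.C δt) (cPow (-α))) := by
  have hA := hp.linDet hq (.const δt) .t
  have h := ((Expands.const (δt / 2)).mul (hp.linDet hq (.const δ) .t)).mul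
    (hA.ringInverse hr.lin)
  rw [map_div₀ HahnSeries.C, map_ofNat HahnSeries.C, ← div_eq_mul_inv,
    div_mul_eq_mul_div, div_div] at h
  exact h

theorem Expands.logTwo :
    Expands hσ hα (seriesTwo p q δ δt)
      (logTwo c y (HahnSeries.C δ) (HahnSeries.C δt) (cPow (-α))) := by
  have hA := hp.linDet hq (.const δt) .t
  have hE := hp.evenDet hq (.const δt) .t
  have hA2 := (hA.pow 2).mul hE
  have hA0 : constTerm (W3.linDet p q (constBi δt) X ^ 2 * W3.evenDet p q (constBi δt) X) ≠ 0 := by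
    rw [map_mul, map_pow]
    exact mul_ne_zero (pow_ne_zero _ hr.lin) hr.even
  have h := ((Expands.const (1 / 4)).mul (hA.numTwo hq (.const δt)
    ((Expands.const δ).sub (.const δt)) .t)).mul (hA2.ringInverse hA0)
  rw [map_div₀ HahnSeries.C, map_ofNat HahnSeries.C, map_one HahnSeries.C,
    ← div_eq_mul_inv, div_mul_eq_mul_div, div_div, one_mul, ← mul_assoc] at h
  rw [seriesTwo, W3.logTwo]
  exact h

theorem Expands.logThree :
    Expands hσ hα (seriesThree p q δ δt)
      (logThree c y (HahnSeries.C δ) (HahnSeries.C δt) (cPow (-α))) := by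
  have hA := hp.linDet hq (.const δt) .t
  have hE := hp.evenDet hq (.const δt) .t
  have hF := hp.oddDet hq (.const δt) .t
  have hA3 := ((hA.pow 3).mul hE).mul hF
  have hU := hp.linDet hq (.const δ) .t
  have hN := hA.numThree hq (.const δt) ((Expands.const δ).sub (.const δt)) .t
  have hA0 : constTerm (W3.linDet p q (constBi δt) X ^ 3 *
      W3.evenDet p q (constBi δt) X * W3.oddDet p q (constBi δt) X) ≠ 0 := by
    rw [map_mul, map_mul, map_pow]
    exact mul_ne_zero (mul_ne_zero (pow_ne_zero _ hr.lin) hr.even) hr.odd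
  rw [seriesThree, W3.logThree]
  -- The numerators are made opaque, so that the final rearrangement does not expand them.
  generalize W3.numThree (W3.linDet p q (constBi δt) X) q (constBi δt) (constBi δ - constBi δt) X
    = N at hN ⊢
  generalize W3.numThree (W3.linDet c y (HahnSeries.C δt) (cPow (-α))) y (HahnSeries.C δt)
    (HahnSeries.C δ - HahnSeries.C δt) (cPow (-α)) = N' at hN ⊢
  have h := ((Expands.const (1 / 48)).mul (hU.mul hN)).mul (hA3.ringInverse hA0)
  rw [map_div₀ HahnSeries.C, map_ofNat HahnSeries.C, map_one HahnSeries.C] at h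
  convert h using 1
  ring

theorem Expands.logCoeff (n : ℕ) :
    Expands hσ hα (logSeries p q δ δt n)
      (logCoeff c y (HahnSeries.C δ) (HahnSeries.C δt) (cPow (-α)) n) := by
  have h1 := hp.logOne hq hr (δ := δ)
  have h2 := hp.logTwo hq hr (δ := δ)
  have h3 := hp.logThree hq hr (δ := δ)
  match n with
  | 0 => exact .zero
  | 1 =>
    have h := (Expands.const (δt / 2)).add h1
    rw [map_div₀ HahnSeries.C, map_ofNat] at h
    exact h
  | 2 =>
    have h := ((Expands.const (δt / 4)).add ((Expands.const (1 / 2)).mul h1)).add h2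
    rw [map_div₀ HahnSeries.C, map_div₀ HahnSeries.C, map_ofNat HahnSeries.C, map_ofNat HahnSeries.C,
      map_one HahnSeries.C, div_mul_eq_mul_div, one_mul] at h
    exact h
  | 3 =>
    have h := (((Expands.const (δt / 6)).add ((Expands.const (3 / 8)).mul h1)).add h2).add h3
    rw [map_div₀ HahnSeries.C, map_div₀ HahnSeries.C, map_ofNat HahnSeries.C,
      map_ofNat HahnSeries.C, map_ofNat HahnSeries.C] at h
    exact h
  | n + 4 => exact .zero

/-- The hypothesis on `c` and `y` says that the true central charge is `c^α · y⁻¹` times the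
parameter `c`. Scaling with `a = c^α` and `b = y⁻¹` thus carries each determinant at `(c, 1, δ̃ c^α,
1)` to a non-zero multiple of one at `(c, y, δ̃, c^(-α))`, which is non-zero because its expansion
has a non-zero constant term. The linear conditions on the internal dimension hold since their
expansions start with a multiple of `δ̃`. -/
theorem isGeneric_of_isRegular (hy : y ≠ 0) (hcy : cPow α * c = cPow 1 * y) :
    IsGeneric (cPow 1) (HahnSeries.C δt * cPow α) := by
  have ha := cPow_ne_zero α
  have hc1 : cPow 1 = cPow α * y⁻¹ * c := by
    rw [mul_right_comm, hcy, mul_inv_cancel_right₀ hy]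
  have hy1 : (1 : Puiseux) = y⁻¹ * y := (inv_mul_cancel₀ hy).symm
  have ht1 : (1 : Puiseux) = cPow α * cPow (-α) := by rw [cPow_mul, add_neg_cancel, cPow_zero]
  have hab := mul_ne_zero ha (inv_ne_zero hy)
  have hδt : HahnSeries.C δt ≠ (0 : Puiseux) := by
    simpa using hr.weight
  have hA := (hp.linDet hq (.const δt) .t).ne_zero hr.lin
  have hE := (hp.evenDet hq (.const δt) .t).ne_zero hr.even
  have hF := (hp.oddDet hq (.const δt) .t).ne_zero hr.odd
  have hQ := (hp.qpDet hq (.const δt) .t).ne_zero hr.qp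
  have hQ' := (hp.qpDetThree hq (.const δt) .t).ne_zero hr.qpThree
  have h2 := ((Expands.const (hσ := hσ) (hα := hα) δt).sub ((Expands.const 2).mul .t)).ne_zero
    (by simpa [constTerm, constBi] using hr.weight)
  have h5 := (((Expands.const (hσ := hσ) (hα := hα) 5).mul (.const δt)).sub
    ((Expands.const 2).mul .t)).ne_zero (by simpa [constTerm, constBi] using hr.weight)
  rw [map_ofNat] at h2 h5
  rw [map_ofNat] at h5
  refine ⟨?_, mul_ne_zero hδt ha, ?_, ?_, ?_, ?_, ?_, ?_, ?_⟩
  · intro h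
    -- Index `-1` is the first power of the central charge, whose coefficient in `22 + 5 c` is `5`.
    have := congrArg (fun x : Puiseux => x.coeff (-1)) h
    rw [show (22 : Puiseux) = HahnSeries.C 22 by rw [map_ofNat],
      show (5 : Puiseux) = HahnSeries.C 5 by rw [map_ofNat]] at this
    simp [cPow] at this
  · rw [show HahnSeries.C δt * cPow α - 2 = cPow α * (HahnSeries.C δt - 2 * cPow (-α)) by
      linear_combination -2 * ht1]
    exact mul_ne_zero ha h2
  · rw [show 5 * (HahnSeries.C δt * cPow α) - 2 =
      cPow α * (5 * HahnSeries.C δt - 2 * cPow (-α)) by linear_combination -2 * ht1]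
    exact mul_ne_zero ha h5
  · have := linDet_scale (cPow α) y⁻¹ c y (HahnSeries.C δt) (cPow (-α))
    rw [← hc1, ← hy1, ← ht1, mul_comm _ (HahnSeries.C δt)] at this
    rw [this]
    exact mul_ne_zero hab hA
  · have := evenDet_scale (cPow α) y⁻¹ c y (HahnSeries.C δt) (cPow (-α))
    rw [← hc1, ← hy1, ← ht1, mul_comm _ (HahnSeries.C δt)] at this
    rw [this]
    exact mul_ne_zero (mul_ne_zero (pow_ne_zero _ ha) (inv_ne_zero hy)) hE
  · have := qpDet_scale (cPow α) y⁻¹ c y (HahnSeries.C δt) (cPow (-α))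
    rw [← hc1, ← hy1, ← ht1, mul_comm _ (HahnSeries.C δt)] at this
    rw [this]
    exact mul_ne_zero (mul_ne_zero (pow_ne_zero _ ha) (inv_ne_zero hy)) hQ
  · have := qpDetThree_scale (cPow α) y⁻¹ c y (HahnSeries.C δt) (cPow (-α))
    rw [← hc1, ← hy1, ← ht1, mul_comm _ (HahnSeries.C δt)] at this
    rw [this]
    exact mul_ne_zero (mul_ne_zero (pow_ne_zero _ ha) (inv_ne_zero hy)) hQ'
  · have := oddDet_scale (cPow α) y⁻¹ c y (HahnSeries.C δt) (cPow (-α))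
    rw [← hc1, ← hy1, ← ht1, mul_comm _ (HahnSeries.C δt)] at this
    rw [this]
    exact mul_ne_zero (mul_ne_zero (pow_ne_zero _ ha) (pow_ne_zero _ (inv_ne_zero hy))) hF

end LogSeries

/-! ### The rescaled logarithmic block. -/

section HeavyBlock

variable {σ α : ℚ} {hσ : 0 < σ} {hα : 0 < α} {p q : Bi} {c y : Puiseux} {δ δt : ℝ}

theorem charZero_puiseux : CharZero Puiseux :=
  charZero_of_injective_ringHom (HahnSeries.C_injective (Γ := ℚ) (R := ℂ))

/-- Homogeneity is applied with `a = c^α` and `b = y⁻¹`. It replaces the dimensions by `δ` and `δ̃`,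
the homogenising `1` by `t = c^(-α)`, and the pair formed by the central charge and `1` by the pair
`(c, y)`. -/
theorem coeff_heavyLogBlock (hp : Expands hσ hα p c) (hq : Expands hσ hα q y)
    (hr : IsRegular p q δt) (hy : y ≠ 0) (hcy : cPow α * c = cPow 1 * y) (hδ : δ ≠ 0)
    {w : ℚ → ℝ → Puiseux}
    (hw : w α δ ^ 2 = semiDegenerateCharge (cPow 1) (HahnSeries.C (δ : ℂ) * cPow α))
    {n : ℕ} (hn : n < 4) :
    PowerSeries.coeff n (heavyLogBlock w α δ δt) =
      cPow α * logCoeff c y (HahnSeries.C (δ : ℂ)) (HahnSeries.C (δt : ℂ)) (cPow (-α)) n := by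
  have hδ' : (HahnSeries.C (δ : ℂ) : Puiseux) ≠ 0 := by simpa using hδ
  rw [heavyLogBlock, @coeff_logBlock _ _ _ charZero_puiseux _ _ _ _
    (isGeneric_of_isRegular hp hq hr hy hcy) (mul_ne_zero hδ' (cPow_ne_zero α)) hw _ hn,
    ← logCoeff_scale c y _ _ _ (cPow_ne_zero α) (inv_ne_zero hy), mul_right_comm (cPow α), hcy,
    mul_inv_cancel_right₀ hy, inv_mul_cancel₀ hy, cPow_mul, add_neg_cancel, cPow_zero,
    mul_comm (HahnSeries.C (δ : ℂ)), mul_comm (HahnSeries.C (δt : ℂ))]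

end HeavyBlock

/-! ### Coefficient functions and the classical block of an expansion. -/

section Parts

open PowerSeries

/-- The coefficient functions of the positive powers of `c`. -/
noncomputable def positivePart (E : ℝ → ℝ → ℕ → Bi) (i : ℕ) (δ δt : ℝ) : Polynomial ℂ :=
  trunc 4 (mk fun n => coeff i (coeff 0 (E δ δt n)))

/-- The regular part of the coefficient function of `c ^ 0`. -/
noncomputable def zeroPart (E : ℝ → ℝ → ℕ → Bi) (δ δt : ℝ) : Polynomial ℂ :=
  trunc 4 (mk fun n => coeff 0 (coeff 1 (E δ δt n)))

/-- The coefficients of the logarithmic block at `h = δ c ^ α`, `h̃ = δ̃ c ^ α` are the values of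
`c ^ α E` at `s = c ^ (-σ)`, `t = c ^ (-α)`, up to terms which vanish at large `c`. -/
def HasExpansion (w : ℚ → ℝ → Puiseux) {σ α : ℚ} (hσ : 0 < σ) (hα : 0 < α)
    (E : ℝ → ℝ → ℕ → Bi) : Prop :=
  ∀ δ δt : ℝ, δ ≠ 0 → δt ≠ 0 → ∀ n < 4, ∃ x,
    Expands hσ hα (E δ δt n) x ∧ coeff n (heavyLogBlock w α δ δt) = cPow α * x

variable {w : ℚ → ℝ → Puiseux} {σ α : ℚ} {hσ : 0 < σ} {hα : 0 < α} {E : ℝ → ℝ → ℕ → Bi}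
  {δ δt : ℝ}

theorem HasExpansion.coeffFun_pos (h : HasExpansion w hσ hα E) (hδ : δ ≠ 0) (hδt : δt ≠ 0)
    {i : ℕ} (hi : (i : ℚ) * σ < α) : coeffFun w α (α - i * σ) δ δt = positivePart E i δ δt := by
  ext n
  simp only [coeffFun, positivePart, coeff_trunc, coeff_mk]
  split_ifs with hn
  · obtain ⟨x, hx, hx'⟩ := h δ δt hδ hδt n hn
    rw [hx', hx.coeff_pos hi]
  · rfl

theorem HasExpansion.coeffFun_zero_of_eq (h : HasExpansion w hσ hα E) (hδ : δ ≠ 0)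
    (hδt : δt ≠ 0) {i : ℕ} (hi : (i : ℚ) * σ = α) :
    coeffFun w α 0 δ δt = positivePart E i δ δt + zeroPart E δ δt := by
  ext n
  simp only [coeffFun, positivePart, zeroPart, coeff_trunc, coeff_mk, Polynomial.coeff_add]
  split_ifs with hn
  · obtain ⟨x, hx, hx'⟩ := h δ δt hδ hδt n hn
    rw [hx', neg_zero, hx.coeff_zero hi]
  · simp

theorem HasExpansion.coeffFun_zero_of_ne (h : HasExpansion w hσ hα E) (hδ : δ ≠ 0)
    (hδt : δt ≠ 0) (hi : ∀ i : ℕ, (i : ℚ) * σ ≠ α) :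
    coeffFun w α 0 δ δt = zeroPart E δ δt := by
  ext n
  simp only [coeffFun, zeroPart, coeff_trunc, coeff_mk]
  split_ifs with hn
  · obtain ⟨x, hx, hx'⟩ := h δ δt hδ hδt n hn
    rw [hx', neg_zero, hx.coeff_zero_of_ne hi]
  · rfl

theorem coeff_prin (x : Puiseux) (g : ℚ) :
    (prin x).coeff g = if g ≤ 0 then x.coeff g else 0 := by
  rw [prin, HahnSeries.coeff_add, HahnSeries.C_apply, HahnSeries.coeff_single]
  rcases lt_trichotomy g 0 with hg | rfl | hg
  · simp [hg, hg.le, hg.ne]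
  · simp
  · simp [hg.not_ge, hg.ne', hg.le]

theorem coeff_coeff_term (f : Polynomial ℂ) (a : ℚ) (n : ℕ) (g : ℚ) :
    ((term f a).coeff n).coeff g = if g = -a then f.coeff n else 0 := by
  rw [term, Polynomial.coeff_C_mul, Polynomial.coeff_map, coeff_cPow_mul, HahnSeries.C_apply,
    HahnSeries.coeff_single]
  simp only [eq_neg_iff_add_eq_zero]
  congr

/-- Positive powers of `c` come only from the terms `s^i t⁰`, at the exponents `α - i σ > 0`, so
these terms together with `c^0` exhaust the principal part. The number `k` counts the indices `i`
with `i σ < α`. -/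
theorem HasExpansion.classicalBlock_eq (h : HasExpansion w hσ hα E) (hδ : δ ≠ 0) (hδt : δt ≠ 0)
    {k : ℕ} (hk : ∀ i : ℕ, (i : ℚ) * σ < α ↔ i < k) :
    classicalBlock w α δ δt =
      ∑ i ∈ Finset.range k, term (coeffFun w α (α - i * σ) δ δt) (α - i * σ) +
        term (coeffFun w α 0 δ δt) 0 := by
  ext n g
  rw [Polynomial.coeff_add, Polynomial.finsetSum_coeff, HahnSeries.coeff_add,
    HahnSeries.coeff_sum, coeff_coeff_term, neg_zero]
  simp only [coeff_coeff_term]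
  by_cases hn : n < 4
  · obtain ⟨x, hx, hx'⟩ := h δ δt hδ hδt n hn
    have hc : ∀ a : ℚ, (coeffFun w α a δ δt).coeff n = (cPow α * x).coeff (-a) := fun a => by
      rw [coeffFun, coeff_trunc, if_pos hn, coeff_mk, hx']
    simp only [hc]
    rw [classicalBlock, coeff_trunc, if_pos hn, coeff_mk, hx', coeff_prin]
    rcases lt_trichotomy g 0 with hg | rfl | hg
    · rw [if_pos hg.le, if_neg hg.ne, add_zero]
      by_cases hi : ∃ i : ℕ, g = -(α - i * σ)
      · obtain ⟨i, rfl⟩ := hi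
        have hik : i < k := (hk i).1 (by linarith)
        -- Different `i` give different exponents because `σ ≠ 0`, so a single term of the sum
        -- contributes.
        rw [Finset.sum_eq_single i, if_pos rfl]
        · intro j _ hj
          rw [if_neg]
          intro h'
          have h2 : (j : ℚ) * σ = i * σ := by linarith
          exact hj (by exact_mod_cast mul_right_cancel₀ hσ.ne' h2)
        · intro h'
          exact absurd (Finset.mem_range.2 hik) h'
      · push Not at hi
        rw [hx.coeff_of_ne hg hi]
        exact (Finset.sum_eq_zero fun i _ => if_neg (hi i)).symm
    · rw [if_pos le_rfl, if_pos rfl, neg_zero, Finset.sum_eq_zero, zero_add]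
      intro i hi
      have := (hk i).2 (Finset.mem_range.1 hi)
      rw [if_neg]
      intro h'
      linarith
    · rw [if_neg hg.not_ge, if_neg hg.ne', add_zero]
      refine (Finset.sum_eq_zero fun i hi => ?_).symm
      have := (hk i).2 (Finset.mem_range.1 hi)
      rw [if_neg]
      intro h'
      linarith
  · have hc : ∀ a : ℚ, (coeffFun w α a δ δt).coeff n = 0 := fun a => by
      rw [coeffFun, coeff_trunc, if_neg hn]
    rw [classicalBlock, coeff_trunc, if_neg hn]
    simp [hc]

end Parts

/-! ### Leading behaviour of the spin-3 charge. -/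

section Charge

theorem coeff_cPow (a g : ℚ) : (cPow a).coeff g = if g = -a then 1 else 0 := by
  rw [cPow, HahnSeries.coeff_single]
  congr

theorem order_leadingCoeff_of_coeff {x : Puiseux} {g : ℚ} (hg : x.coeff g ≠ 0)
    (h : ∀ g' < g, x.coeff g' = 0) : x.order = g ∧ x.leadingCoeff = x.coeff g := by
  have hx : x ≠ 0 := by
    rintro rfl
    exact hg rfl
  have ho : x.order = g := by
    refine le_antisymm (HahnSeries.order_le_of_coeff_ne_zero hg) (not_lt.1 fun hlt => ?_)
    have := h _ hlt
    rw [← HahnSeries.leadingCoeff_eq, HahnSeries.leadingCoeff_eq_zero] at this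
    exact hx this
  exact ⟨ho, by rw [HahnSeries.leadingCoeff_eq, ho]⟩

theorem natCast_puiseux (n : ℕ) [n.AtLeastTwo] :
    (OfNat.ofNat n : Puiseux) = HahnSeries.C (OfNat.ofNat n : ℂ) :=
  (map_ofNat HahnSeries.C n).symm

theorem order_central :
    (22 + 5 * cPow 1).order = -1 ∧ (22 + 5 * cPow 1).leadingCoeff = 5 := by
  have hc : ∀ g : ℚ, (22 + 5 * cPow 1).coeff g =
      (if g = 0 then 22 else 0) + if g = -1 then 5 else 0 := fun g => by
    rw [natCast_puiseux 22, natCast_puiseux 5, HahnSeries.coeff_add, HahnSeries.C_mul_eq_smul,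
      HahnSeries.coeff_smul, coeff_cPow, HahnSeries.C_apply, HahnSeries.coeff_single]
    split_ifs <;> simp
  have h5 : (22 + 5 * cPow 1).coeff (-1) = 5 := by rw [hc]; norm_num
  have := order_leadingCoeff_of_coeff (x := 22 + 5 * cPow 1) (g := -1) (by rw [h5]; norm_num)
    fun g hg => by
      rw [hc, if_neg (by linarith), if_neg (by linarith), add_zero]
  rwa [h5] at this

theorem coeff_charge (α : ℚ) (δ : ℂ) (g : ℚ) :
    (32 * (HahnSeries.C δ * cPow α) + 2 - cPow 1).coeff g =
      (if g = -α then 32 * δ else 0) + (if g = 0 then 2 else 0) - if g = -1 then 1 else 0 := by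
  rw [natCast_puiseux 32, natCast_puiseux 2, HahnSeries.coeff_sub, HahnSeries.coeff_add,
    HahnSeries.C_mul_eq_smul, HahnSeries.C_mul_eq_smul, HahnSeries.coeff_smul,
    HahnSeries.coeff_smul, coeff_cPow, coeff_cPow, HahnSeries.C_apply, HahnSeries.coeff_single]
  split_ifs <;> simp

variable {α : ℚ} {δ : ℂ} {x : Puiseux}

theorem order_charge_of_lt_one (hα : 0 < α) (h1 : α < 1) :
    (32 * (HahnSeries.C δ * cPow α) + 2 - cPow 1).order = -1 ∧
      (32 * (HahnSeries.C δ * cPow α) + 2 - cPow 1).leadingCoeff = -1 := by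
  have hc := coeff_charge α δ
  have hl : (32 * (HahnSeries.C δ * cPow α) + 2 - cPow 1).coeff (-1) = -1 := by
    rw [hc, if_neg (by linarith)]
    norm_num
  have := order_leadingCoeff_of_coeff (g := -1) (by rw [hl]; norm_num)
    fun g hg => by
      rw [hc, if_neg (by linarith), if_neg (by linarith), if_neg (by linarith)]
      norm_num
  rwa [hl] at this

theorem order_charge_of_one_lt (h1 : 1 < α) (hδ : δ ≠ 0) :
    (32 * (HahnSeries.C δ * cPow α) + 2 - cPow 1).order = -α ∧
      (32 * (HahnSeries.C δ * cPow α) + 2 - cPow 1).leadingCoeff = 32 * δ := by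
  have hc := coeff_charge α δ
  have hl : (32 * (HahnSeries.C δ * cPow α) + 2 - cPow 1).coeff (-α) = 32 * δ := by
    rw [hc, if_pos rfl, if_neg (by linarith), if_neg (by linarith)]
    norm_num
  have := order_leadingCoeff_of_coeff (g := -α) (by rw [hl]; simpa using hδ)
    fun g hg => by
      rw [hc, if_neg (by linarith), if_neg (by linarith), if_neg (by linarith)]
      norm_num
  rwa [hl] at this

/-- The charge condition is equivalent to `(22 + 5 c) x = h² (32 h + 2 - c)`. Orders and leading
coefficients are multiplicative, and `22 + 5 c` has order `-1` and leading coefficient `5`. The two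
regimes differ in whether `-c` or `32 h` dominates the last factor. -/
theorem order_semiDegenerateCharge (hδ : δ ≠ 0)
    (hx : x = semiDegenerateCharge (cPow 1) (HahnSeries.C δ * cPow α))
    (hU : (32 * (HahnSeries.C δ * cPow α) + 2 - cPow 1).leadingCoeff ≠ 0) :
    x.order = -(2 * α) + (32 * (HahnSeries.C δ * cPow α) + 2 - cPow 1).order + 1 ∧
      x.leadingCoeff =
        δ ^ 2 * (32 * (HahnSeries.C δ * cPow α) + 2 - cPow 1).leadingCoeff / 5 := by
  obtain ⟨ho, hl⟩ := order_central
  have hk : (22 + 5 * cPow 1 : Puiseux) ≠ 0 := by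
    rw [← HahnSeries.leadingCoeff_ne_zero, hl]
    norm_num
  have hU' : (32 * (HahnSeries.C δ * cPow α) + 2 - cPow 1 : Puiseux) ≠ 0 :=
    HahnSeries.leadingCoeff_ne_zero.1 hU
  have hs : (HahnSeries.single (-(2 * α)) (δ ^ 2) : Puiseux) ≠ 0 := by
    simpa using hδ
  have hsq : (HahnSeries.C δ * cPow α) ^ 2 = HahnSeries.single (-(2 * α)) (δ ^ 2) := by
    rw [cPow, HahnSeries.C_apply, HahnSeries.single_mul_single, HahnSeries.single_pow]
    simp
  have hm : x * (22 + 5 * cPow 1) = HahnSeries.single (-(2 * α)) (δ ^ 2) *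
      (32 * (HahnSeries.C δ * cPow α) + 2 - cPow 1) := by
    rw [hx, semiDegenerateCharge, hsq]
    have h5 : (5 : Puiseux) ≠ 0 := by
      rw [natCast_puiseux 5]
      simp
    field_simp
    ring
  have hx0 : x ≠ 0 := left_ne_zero_of_mul (hm ▸ mul_ne_zero hs hU')
  have h1 := congrArg HahnSeries.order hm
  have h2 := congrArg HahnSeries.leadingCoeff hm
  rw [HahnSeries.order_mul hx0 hk, HahnSeries.order_mul hs hU', ho,
    HahnSeries.order_single (by simpa using hδ)] at h1
  rw [HahnSeries.leadingCoeff_mul, HahnSeries.leadingCoeff_mul, hl,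
    HahnSeries.leadingCoeff_of_single] at h2
  exact ⟨by linarith, by rw [← h2]; field_simp⟩

theorem order_semiDegenerateCharge_of_lt_one (hα : 0 < α) (h1 : α < 1) (hδ : δ ≠ 0)
    (hx : x = semiDegenerateCharge (cPow 1) (HahnSeries.C δ * cPow α)) :
    x.order = -(2 * α) ∧ x.leadingCoeff = -δ ^ 2 / 5 := by
  obtain ⟨ho, hl⟩ := order_charge_of_lt_one (δ := δ) hα h1
  have := order_semiDegenerateCharge hδ hx (by rw [hl]; norm_num)
  rw [ho, hl] at this
  exact ⟨by rw [this.1]; ring, by rw [this.2]; ring⟩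

theorem order_semiDegenerateCharge_of_one_lt (h1 : 1 < α) (hδ : δ ≠ 0)
    (hx : x = semiDegenerateCharge (cPow 1) (HahnSeries.C δ * cPow α)) :
    x.order = -(3 * α - 1) ∧ x.leadingCoeff = 32 * δ ^ 3 / 5 := by
  obtain ⟨ho, hl⟩ := order_charge_of_one_lt h1 hδ
  have := order_semiDegenerateCharge hδ hx (by rw [hl]; simpa using hδ)
  rw [ho, hl] at this
  exact ⟨by rw [this.1]; ring, by rw [this.2]; ring⟩

end Charge

/-! ### Regularity at `s = t = 0` and explicit values at `δ = 2`, `δ̃ = 1`. -/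

section Values

open PowerSeries

theorem constTerm_constBi (r : ℂ) : constTerm (constBi r) = r := by
  simp [constTerm, constBi]

theorem constTerm_X : constTerm X = 0 := by
  simp [constTerm]

theorem constTerm_C_X : constTerm (C X) = 0 := by
  simp [constTerm]

/-- For `α < 1` the central charge dominates, so it is normalised to `1` and the homogenising
variable is `s`. At `s = t = 0` the five determinants are `-1`, `-δ̃`, `δ̃`, `δ̃` and `5`. -/
theorem isRegular_lower {δt : ℂ} (h : δt ≠ 0) : IsRegular 1 (C X) δt where
  weight := h
  lin := by
    rw [map_linDet, constTerm_constBi, constTerm_X, constTerm_C_X, map_one]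
    simp [linDet]
  even := by
    rw [map_evenDet, constTerm_constBi, constTerm_X, constTerm_C_X, map_one]
    simp [evenDet, h]
  qp := by
    rw [map_qpDet, constTerm_constBi, constTerm_X, constTerm_C_X, map_one]
    simp [qpDet, h]
  qpThree := by
    rw [map_qpDetThree, constTerm_constBi, constTerm_X, constTerm_C_X, map_one]
    simp [qpDetThree, h]
  odd := by
    rw [map_oddDet, constTerm_constBi, constTerm_X, constTerm_C_X, map_one]
    simp [oddDet]

/-- For `α > 1` the dimensions dominate and the central charge is represented by `s`. At `s = t = 0`
the determinants are `32 δ̃`, `32 δ̃²`, `8 δ̃²`, `3 δ̃²` and `-3072 δ̃²`. -/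
theorem isRegular_upper {δt : ℂ} (h : δt ≠ 0) : IsRegular (C X) 1 δt where
  weight := h
  lin := by
    rw [map_linDet, constTerm_constBi, constTerm_X, constTerm_C_X, map_one]
    simp [linDet, h]
  even := by
    rw [map_evenDet, constTerm_constBi, constTerm_X, constTerm_C_X, map_one]
    simp [evenDet, h]
  qp := by
    rw [map_qpDet, constTerm_constBi, constTerm_X, constTerm_C_X, map_one]
    simp [qpDet, h]
  qpThree := by
    rw [map_qpDetThree, constTerm_constBi, constTerm_X, constTerm_C_X, map_one]
    simp [qpDetThree, h]
  odd := by
    rw [map_oddDet, constTerm_constBi, constTerm_X, constTerm_C_X, map_one]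
    simp [oddDet, h]

/-- With the denominator multiplied out, Taylor coefficients can be extracted by recursion and the
formal inverse never has to be expanded. -/
theorem seriesOne_mul {p q : Bi} {δ δt : ℂ} (hr : IsRegular p q δt) :
    seriesOne p q δ δt * linDet p q (constBi δt) X =
      constBi (δt / 2) * linDet p q (constBi δ) X := by
  have h := mul_ringInverse_of_constTerm hr.lin
  rw [seriesOne]
  linear_combination (constBi (δt / 2) * linDet p q (constBi δ) X) * h

theorem seriesTwo_mul {p q : Bi} {δ δt : ℂ} (hr : IsRegular p q δt) :
    seriesTwo p q δ δt * (linDet p q (constBi δt) X ^ 2 * evenDet p q (constBi δt) X) =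
      constBi (1 / 4) *
        numTwo (linDet p q (constBi δt) X) q (constBi δt) (constBi δ - constBi δt) X := by
  have hA : constTerm (linDet p q (constBi δt) X ^ 2 * evenDet p q (constBi δt) X) ≠ 0 := by
    rw [map_mul, map_pow]
    exact mul_ne_zero (pow_ne_zero _ hr.lin) hr.even
  have h := mul_ringInverse_of_constTerm hA
  rw [seriesTwo]
  linear_combination (constBi (1 / 4) *
    numTwo (linDet p q (constBi δt) X) q (constBi δt) (constBi δ - constBi δt) X) * h

/-- The series of the logarithmic block in the range `0 < α < 1`. -/
noncomputable def lowerSeries (δ δt : ℝ) : ℕ → Bi :=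
  logSeries 1 (C X) δ δt

/-- The series of the logarithmic block in the range `1 < α`. -/
noncomputable def upperSeries (δ δt : ℝ) : ℕ → Bi :=
  logSeries (C X) 1 δ δt

theorem coeff_positivePart {E : ℝ → ℝ → ℕ → Bi} {i n : ℕ} (hn : n < 4) (δ δt : ℝ) :
    (positivePart E i δ δt).coeff n = coeff i (constantCoeff (E δ δt n)) := by
  rw [positivePart, coeff_trunc, if_pos hn, coeff_mk, coeff_zero_eq_constantCoeff_apply]

theorem coeff_zeroPart {E : ℝ → ℝ → ℕ → Bi} {n : ℕ} (hn : n < 4) (δ δt : ℝ) :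
    (zeroPart E δ δt).coeff n = coeff 1 (map constantCoeff (E δ δt n)) := by
  rw [zeroPart, coeff_trunc, if_pos hn, coeff_mk, coeff_map, coeff_zero_eq_constantCoeff_apply]

theorem constantCoeff_constBi (r : ℂ) : constantCoeff (constBi r) = C r := by
  simp [constBi]

theorem map_constBi (r : ℂ) : map constantCoeff (constBi r) = C r := by
  simp [constBi]

section Lower

theorem lower_relation :
    constantCoeff (seriesOne 1 (C X) 2 1) * (C 32 * X - 1) = C (1 / 2) * (C 64 * X - 1) := by
  have := congrArg constantCoeff (seriesOne_mul (δ := 2) (isRegular_lower one_ne_zero))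
  simp only [map_mul, map_linDet, constantCoeff_constBi, constantCoeff_C, constantCoeff_X,
    map_one] at this
  simp only [linDet] at this
  rw [show (64 : ℂ) = 32 * 2 by norm_num, map_mul, map_ofNat, map_ofNat] at *
  linear_combination this

theorem coeff_lower_zero : coeff 0 (constantCoeff (seriesOne 1 (C X) 2 1)) = 1 / 2 := by
  have := congrArg (coeff 0) lower_relation
  simp [mul_sub, ← mul_assoc] at this
  rw [coeff_zero_eq_constantCoeff_apply, this, one_div]

/-- The series is `(1/2) (64 s - 1) / (32 s - 1)`. Comparing coefficients in the relation gives `32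
f₀ - f₁ = 32` and then `f_(i+1) = 32 f_i`. -/
theorem coeff_lower_succ (i : ℕ) :
    coeff (i + 1) (constantCoeff (seriesOne 1 (C X) 2 1)) = -16 * 32 ^ i := by
  have h := fun n => congrArg (coeff (n + 1)) lower_relation
  simp only [mul_sub, ← mul_assoc, ← map_mul, map_sub, coeff_succ_mul_X, mul_one,
    mul_right_comm _ (C _) X, coeff_mul_C, coeff_C] at h
  induction i with
  | zero =>
    have := h 0
    rw [coeff_lower_zero] at this
    simp at this
    linear_combination -this
  | succ i ih =>
    have := h (i + 1)
    rw [ih] at this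
    simp at this
    linear_combination -this

theorem positivePart_lower_zero : (positivePart lowerSeries 0 2 1).coeff 1 = 1 := by
  rw [coeff_positivePart (by norm_num), lowerSeries, logSeries, map_add, map_add,
    constantCoeff_constBi, Complex.ofReal_one, Complex.ofReal_ofNat, coeff_lower_zero]
  norm_num

theorem positivePart_lower_succ (i : ℕ) :
    (positivePart lowerSeries (i + 1) 2 1).coeff 1 = -16 * 32 ^ i := by
  rw [coeff_positivePart (by norm_num), lowerSeries, logSeries, map_add, map_add,
    constantCoeff_constBi, Complex.ofReal_one, Complex.ofReal_ofNat, coeff_lower_succ]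
  simp

theorem lower_zero_relation : map constantCoeff (seriesOne 1 (C X) 2 1) = C (1 / 2) := by
  have := congrArg (map constantCoeff) (seriesOne_mul (δ := 2) (isRegular_lower one_ne_zero))
  simp only [map_mul, map_linDet, map_constBi, map_C, map_X, constantCoeff_X,
    map_one, map_zero] at this
  simp only [linDet] at this
  linear_combination -this

/-- At `s = 0` both linear determinants reduce to `-1`, so `ℓ₁` does not depend on `t`. The
universal part of `c^0` must therefore be detected at order `z²`. -/
theorem zeroPart_lower_one : (zeroPart lowerSeries 2 1).coeff 1 = 0 := by
  rw [coeff_zeroPart (by norm_num), lowerSeries, logSeries, map_add, map_add,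
    map_constBi, Complex.ofReal_one, Complex.ofReal_ofNat, lower_zero_relation]
  simp

theorem zeroPart_lower_two : (zeroPart lowerSeries 2 1).coeff 2 = 1 / 4 := by
  have h := congrArg (map constantCoeff) (seriesTwo_mul (δ := 2) (isRegular_lower one_ne_zero))
  simp only [map_mul, map_pow, map_linDet, map_evenDet, map_numTwo, map_constBi, map_C, map_X,
    constantCoeff_X, map_one, map_zero, map_sub] at h
  simp only [linDet, evenDet, numTwo] at h
  -- At `s = 0` the second-order term is `1 / (4 (1 - t))`, whose linear coefficient in `t` is `1 /
  -- 4`.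
  have h' : map constantCoeff (seriesTwo 1 (C X) 2 1) * (1 - X) = C (1 / 4) := by
    linear_combination -h
  have h0 := congrArg (coeff 0) h'
  have h1 := congrArg (coeff 1) h'
  rw [coeff_zeroPart (by norm_num), lowerSeries, logSeries, map_add, map_add, map_add, map_add,
    map_mul, map_constBi, map_constBi, Complex.ofReal_one, Complex.ofReal_ofNat,
    lower_zero_relation, ← map_mul]
  simp [mul_sub, coeff_C] at h0 h1 ⊢
  rw [← coeff_zero_eq_constantCoeff_apply, coeff_map, coeff_zero_eq_constantCoeff_apply] at h0
  linear_combination h1 + h0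

end Lower

section Upper

theorem upper_relation :
    constantCoeff (seriesOne (C X) 1 2 1) * (C 32 - X) = C (1 / 2) * (C 64 - X) := by
  have := congrArg constantCoeff (seriesOne_mul (δ := 2) (isRegular_upper one_ne_zero))
  simp only [map_mul, map_linDet, constantCoeff_constBi, constantCoeff_C, constantCoeff_X,
    map_one] at this
  simp only [linDet] at this
  rw [show (64 : ℂ) = 32 * 2 by norm_num, map_mul, map_ofNat, map_ofNat] at *
  linear_combination this

theorem coeff_upper_zero : coeff 0 (constantCoeff (seriesOne (C X) 1 2 1)) = 1 := by
  have := congrArg (coeff 0) upper_relation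
  simp [mul_sub] at this
  rw [coeff_zero_eq_constantCoeff_apply]
  linear_combination this / 32

/-- The series is `(1/2) (64 - s) / (32 - s)`. The relation gives `32 f₁ - f₀ = -1/2` and then `32
f_(i+1) = f_i`. -/
theorem coeff_upper_succ (i : ℕ) :
    coeff (i + 1) (constantCoeff (seriesOne (C X) 1 2 1)) = 1 / 64 * (1 / 32) ^ i := by
  have h := fun n => congrArg (coeff (n + 1)) upper_relation
  simp only [mul_sub, ← map_mul, map_sub, coeff_succ_mul_X, coeff_mul_C, coeff_C] at h
  induction i with
  | zero =>
    have := h 0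
    rw [coeff_upper_zero] at this
    simp at this
    linear_combination this / 32
  | succ i ih =>
    have := h (i + 1)
    rw [ih] at this
    rw [if_neg (by lia), if_neg (by lia)] at this
    linear_combination this / 32

theorem positivePart_upper_zero : (positivePart upperSeries 0 2 1).coeff 1 = 3 / 2 := by
  rw [coeff_positivePart (by norm_num), upperSeries, logSeries, map_add, map_add,
    constantCoeff_constBi, Complex.ofReal_one, Complex.ofReal_ofNat, coeff_upper_zero]
  norm_num

theorem positivePart_upper_succ (i : ℕ) :
    (positivePart upperSeries (i + 1) 2 1).coeff 1 = 1 / 64 * (1 / 32) ^ i := by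
  rw [coeff_positivePart (by norm_num), upperSeries, logSeries, map_add, map_add,
    constantCoeff_constBi, Complex.ofReal_one, Complex.ofReal_ofNat, coeff_upper_succ]
  simp

/-- At `s = 0` the first-order term is `(1/2) (64 + 2t) / (32 + 2t)`, whose `t`-derivative at the
origin is `-1/32`. Here order `z` already suffices. -/
theorem zeroPart_upper_one : (zeroPart upperSeries 2 1).coeff 1 = -1 / 32 := by
  have h := congrArg (map constantCoeff) (seriesOne_mul (δ := 2) (isRegular_upper one_ne_zero))
  simp only [map_mul, map_linDet, map_constBi, map_C, map_X, constantCoeff_X,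
    map_one, map_zero] at h
  simp only [linDet] at h
  have h' : map constantCoeff (seriesOne (C X) 1 2 1) * (C 32 + C 2 * X) =
      C (1 / 2) * (C 64 + C 2 * X) := by
    rw [show (64 : ℂ) = 32 * 2 by norm_num, map_mul C, map_ofNat, map_ofNat] at *
    linear_combination h
  have h0 := congrArg (coeff 0) h'
  have h1 := congrArg (coeff 1) h'
  rw [coeff_zeroPart (by norm_num), upperSeries, logSeries, map_add, map_add,
    map_constBi, Complex.ofReal_one, Complex.ofReal_ofNat]
  simp [mul_add, ← mul_assoc, coeff_C, coeff_mul_C, mul_right_comm _ (C _) X] at h0 h1 ⊢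
  rw [← coeff_zero_eq_constantCoeff_apply, coeff_map, coeff_zero_eq_constantCoeff_apply] at h0
  linear_combination h1 / 32 - h0 / 512

end Upper

end Values

/-! ### Positions of `α` relative to the resonances `i σ = α`. -/

section Intervals

variable {α : ℚ} {n : ℕ}

/-- The lower end of the interval says `(n - 1)(1 - α) < α` and the upper end says `α ≤ n (1 - α)`,
so the indices with `i σ < α` are exactly `0, …, n - 1`. -/
theorem lowerInterval_bounds (hn : 1 ≤ n) (h : α ∈ lowerInterval n) :
    0 < α ∧ α < 1 ∧ ∀ i : ℕ, (i : ℚ) * (1 - α) < α ↔ i < n := by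
  have hn' : (1 : ℚ) ≤ n := by exact_mod_cast hn
  obtain ⟨h1, h2⟩ := h
  have h0 : 0 < α := lt_of_le_of_lt (div_nonneg (by linarith) (by linarith)) h1
  rw [div_lt_iff₀ (by linarith)] at h1
  rw [le_div_iff₀ (by linarith)] at h2
  have h3 : α < 1 := by nlinarith
  refine ⟨h0, h3, fun i => ⟨fun hi => ?_, fun hi => ?_⟩⟩
  · by_contra! h'
    have : (n : ℚ) ≤ i := by exact_mod_cast h'
    nlinarith
  · have : (i : ℚ) ≤ n - 1 := by
      rw [le_sub_iff_add_le]
      exact_mod_cast hi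
    nlinarith

theorem lowerRegular_subset : lowerRegular n ⊆ lowerInterval n :=
  fun _ h => ⟨h.1, h.2.le⟩

theorem lowerRegular_ne (hn : 1 ≤ n) (h : α ∈ lowerRegular n) (i : ℕ) :
    (i : ℚ) * (1 - α) ≠ α := by
  obtain ⟨-, h1, hi⟩ := lowerInterval_bounds hn (lowerRegular_subset h)
  have hn' : (1 : ℚ) ≤ n := by exact_mod_cast hn
  obtain ⟨-, h2⟩ := h
  rw [lt_div_iff₀ (by linarith)] at h2
  rcases lt_or_ge i n with h' | h'
  · exact ((hi i).2 h').ne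
  · have : (n : ℚ) ≤ i := by exact_mod_cast h'
    exact (show α < i * (1 - α) by nlinarith).ne'

theorem lowerInterval_cases (h : α ∈ lowerInterval n) :
    α = n / (n + 1) ∨ α ∈ lowerRegular n :=
  (eq_or_lt_of_le h.2).imp id fun h' => ⟨h.1, h'⟩

theorem lower_exceptional (hn : 1 ≤ n) : 0 < (n / (n + 1) : ℚ) ∧ (n / (n + 1) : ℚ) < 1 ∧
    (n : ℚ) * (1 - n / (n + 1)) = n / (n + 1) := by
  have hn' : (1 : ℚ) ≤ n := by exact_mod_cast hn
  refine ⟨by positivity, ?_, ?_⟩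
  · rw [div_lt_one (by linarith)]
    linarith
  · field_simp
    ring

/-- The two ends say `α ≤ (n + 1)(α - 1)` and `n (α - 1) < α`, so the indices with `i σ < α` are `0,
…, n`, one more than in the range below `1`. -/
theorem upperInterval_bounds (hn : 1 ≤ n) (h : α ∈ upperInterval n) :
    1 < α ∧ ∀ i : ℕ, (i : ℚ) * (α - 1) < α ↔ i < n + 1 := by
  have hn' : (1 : ℚ) ≤ n := by exact_mod_cast hn
  obtain ⟨h1, h2⟩ := h
  rw [div_le_iff₀ (by linarith)] at h1
  have h3 : 1 < α := by nlinarith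
  refine ⟨h3, fun i => ⟨fun hi => ?_, fun hi => ?_⟩⟩
  · by_contra! h'
    have : (n : ℚ) + 1 ≤ i := by exact_mod_cast h'
    nlinarith
  · have : (i : ℚ) ≤ n := by exact_mod_cast Nat.lt_succ_iff.1 hi
    nlinarith

theorem upperRegular_subset : upperRegular n ⊆ upperInterval n :=
  fun _ h => ⟨h.1.le, h.2⟩

theorem upperRegular_ne (hn : 1 ≤ n) (h : α ∈ upperRegular n) (i : ℕ) :
    (i : ℚ) * (α - 1) ≠ α := by
  obtain ⟨h1, hi⟩ := upperInterval_bounds hn (upperRegular_subset h)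
  have hn' : (1 : ℚ) ≤ n := by exact_mod_cast hn
  obtain ⟨h2, -⟩ := h
  rw [div_lt_iff₀ (by linarith)] at h2
  rcases lt_or_ge i (n + 1) with h' | h'
  · exact ((hi i).2 h').ne
  · have : (n : ℚ) + 1 ≤ i := by exact_mod_cast h'
    exact (show α < i * (α - 1) by nlinarith).ne'

theorem upperInterval_cases (h : α ∈ upperInterval n) :
    α = (n + 1) / n ∨ α ∈ upperRegular n :=
  (eq_or_lt_of_le h.1).imp Eq.symm fun h' => ⟨h', h.2⟩

theorem upper_exceptional (hn : 1 ≤ n) : 1 < ((n + 1) / n : ℚ) ∧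
    ((n + 1 : ℕ) : ℚ) * ((n + 1) / n - 1) = (n + 1) / n := by
  have hn' : (1 : ℚ) ≤ n := by exact_mod_cast hn
  refine ⟨?_, ?_⟩
  · rw [one_lt_div (by linarith)]
    linarith
  · push_cast
    field_simp
    ring

end Intervals

/-! ### The two regimes `α < 1` and `α > 1`. -/

section Regimes

variable {w : ℚ → ℝ → Puiseux}
  (hw : ∀ (α : ℚ) (δ : ℝ), 0 < α → δ ≠ 0 →
    w α δ ^ 2 = semiDegenerateCharge (cPow 1) (HahnSeries.C (δ : ℂ) * cPow α))
  {α : ℚ} {n : ℕ} {δ δt : ℝ}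

theorem not_sameFun_of_coeff {f g : ℝ → ℝ → Polynomial ℂ} {k : ℕ}
    (h : (f 2 1).coeff k ≠ (g 2 1).coeff k) : ¬ SameFun f g :=
  fun h' => h (by rw [h' 2 1 two_ne_zero one_ne_zero])

include hw

/-- Here `(c, y) = (1, c^(α - 1))`, so `σ = 1 - α`. The series on the right does not involve `α`,
which is the reason for the universality of the coefficient functions. -/
theorem hasExpansion_lower (hα : 0 < α) (h1 : α < 1) :
    HasExpansion w (sub_pos.2 h1) hα lowerSeries := by
  intro δ δt hδ hδt n hn
  have hr := isRegular_lower (δt := (δt : ℂ)) (by exact_mod_cast hδt)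
  exact ⟨_, Expands.one.logCoeff .s hr n, coeff_heavyLogBlock
    (hσ := sub_pos.2 h1) (hα := hα) .one .s hr (cPow_ne_zero _)
    (by rw [cPow_mul]; ring_nf) hδ (hw α δ hα hδ) hn⟩

/-- Here `(c, y) = (c^(1 - α), 1)`, so `σ = α - 1`; again the series is independent of `α`. -/
theorem hasExpansion_upper (h1 : 1 < α) :
    HasExpansion w (sub_pos.2 h1) (zero_lt_one.trans h1) upperSeries := by
  intro δ δt hδ hδt n hn
  have hr := isRegular_upper (δt := (δt : ℂ)) (by exact_mod_cast hδt)
  exact ⟨_, Expands.s.logCoeff .one hr n, coeff_heavyLogBlock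
    (hσ := sub_pos.2 h1) (hα := zero_lt_one.trans h1) .s .one hr one_ne_zero
    (by rw [cPow_mul]; ring_nf) hδ (hw α δ (zero_lt_one.trans h1) hδ) hn⟩

/-- The exponent `m α - m + 1` equals `α - i (1 - α)` for `i = m - 1`. -/
theorem coeffFun_lower (hn : 1 ≤ n) (h : α ∈ lowerInterval n) {m : ℕ} (h1 : 1 ≤ m) (hm : m ≤ n)
    (hδ : δ ≠ 0) (hδt : δt ≠ 0) :
    coeffFun w α (m * α - m + 1) δ δt = positivePart lowerSeries (m - 1) δ δt := by
  obtain ⟨h0, h2, hi⟩ := lowerInterval_bounds hn h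
  rw [← (hasExpansion_lower hw h0 h2).coeffFun_pos hδ hδt ((hi (m - 1)).2 (by lia))]
  congr 1
  push_cast [h1]
  ring

/-- The exponent `-m α + m + 1` equals `α - i (α - 1)` for `i = m + 1`, which is a natural number
because `m ≥ -1`. -/
theorem coeffFun_upper (hn : 1 ≤ n) (h : α ∈ upperInterval n) {m : ℤ} (h1 : -1 ≤ m)
    (hm : m ≤ n - 1) (hδ : δ ≠ 0) (hδt : δt ≠ 0) :
    coeffFun w α (-m * α + m + 1) δ δt = positivePart upperSeries (m + 1).toNat δ δt := by
  obtain ⟨h2, hi⟩ := upperInterval_bounds hn h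
  rw [← (hasExpansion_upper hw h2).coeffFun_pos hδ hδt ((hi (m + 1).toNat).2 (by lia))]
  have : (((m + 1).toNat : ℕ) : ℚ) = m + 1 := by
    have h3 : (((m + 1).toNat : ℕ) : ℤ) = m + 1 := Int.toNat_of_nonneg (by lia)
    exact_mod_cast congrArg (Int.cast : ℤ → ℚ) h3
  rw [this]
  congr 1
  ring

theorem coeffFun_zero_lowerRegular (hn : 1 ≤ n) (h : α ∈ lowerRegular n) (hδ : δ ≠ 0)
    (hδt : δt ≠ 0) : coeffFun w α 0 δ δt = zeroPart lowerSeries δ δt := by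
  obtain ⟨h0, h2, -⟩ := lowerInterval_bounds hn (lowerRegular_subset h)
  exact (hasExpansion_lower hw h0 h2).coeffFun_zero_of_ne hδ hδt (lowerRegular_ne hn h)

theorem coeffFun_zero_lowerExceptional (hn : 1 ≤ n) (hδ : δ ≠ 0) (hδt : δt ≠ 0) :
    coeffFun w (n / (n + 1)) 0 δ δt =
      positivePart lowerSeries n δ δt + zeroPart lowerSeries δ δt := by
  obtain ⟨h0, h2, h3⟩ := lower_exceptional hn
  exact (hasExpansion_lower hw h0 h2).coeffFun_zero_of_eq hδ hδt h3

theorem coeffFun_zero_upperRegular (hn : 1 ≤ n) (h : α ∈ upperRegular n) (hδ : δ ≠ 0)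
    (hδt : δt ≠ 0) : coeffFun w α 0 δ δt = zeroPart upperSeries δ δt := by
  obtain ⟨h2, -⟩ := upperInterval_bounds hn (upperRegular_subset h)
  exact (hasExpansion_upper hw h2).coeffFun_zero_of_ne hδ hδt (upperRegular_ne hn h)

theorem coeffFun_zero_upperExceptional (hn : 1 ≤ n) (hδ : δ ≠ 0) (hδt : δt ≠ 0) :
    coeffFun w ((n + 1) / n) 0 δ δt =
      positivePart upperSeries (n + 1) δ δt + zeroPart upperSeries δ δt := by
  obtain ⟨h2, h3⟩ := upper_exceptional hn
  exact (hasExpansion_upper hw h2).coeffFun_zero_of_eq hδ hδt h3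

theorem classicalBlock_lower (hn : 1 ≤ n) (h : α ∈ lowerInterval n) (hδ : δ ≠ 0)
    (hδt : δt ≠ 0) :
    classicalBlock w α δ δt =
      ∑ m ∈ Finset.Icc 1 n, term (coeffFun w α (m * α - m + 1) δ δt) (m * α - m + 1) +
        term (coeffFun w α 0 δ δt) 0 := by
  obtain ⟨h0, h2, hi⟩ := lowerInterval_bounds hn h
  rw [(hasExpansion_lower hw h0 h2).classicalBlock_eq hδ hδt hi]
  congr 1
  refine Finset.sum_nbij' (fun i => i + 1) (fun m => m - 1) (fun i hi => ?_) (fun m hm => ?_)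
    (fun i _ => by simp) (fun m hm => ?_) (fun i _ => ?_)
  · simp only [Finset.mem_range, Finset.mem_Icc] at *
    lia
  · simp only [Finset.mem_range, Finset.mem_Icc] at *
    lia
  · simp only [Finset.mem_Icc] at hm
    lia
  · rw [show α - i * (1 - α) = ((i + 1 : ℕ) : ℚ) * α - ((i + 1 : ℕ) : ℚ) + 1 by push_cast; ring]

theorem classicalBlock_upper (hn : 1 ≤ n) (h : α ∈ upperInterval n) (hδ : δ ≠ 0)
    (hδt : δt ≠ 0) :
    classicalBlock w α δ δt =
      ∑ m ∈ Finset.Icc (-1 : ℤ) (n - 1),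
        term (coeffFun w α (-m * α + m + 1) δ δt) (-m * α + m + 1) +
        term (coeffFun w α 0 δ δt) 0 := by
  obtain ⟨h2, hi⟩ := upperInterval_bounds hn h
  rw [(hasExpansion_upper hw h2).classicalBlock_eq hδ hδt hi]
  congr 1
  refine Finset.sum_nbij' (fun i => (i : ℤ) - 1) (fun m => (m + 1).toNat) (fun i hi => ?_)
    (fun m hm => ?_) (fun i _ => by simp) (fun m hm => ?_) (fun i _ => ?_)
  · simp only [Finset.mem_range, Finset.mem_Icc] at *
    lia
  · simp only [Finset.mem_range, Finset.mem_Icc] at *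
    lia
  · simp only [Finset.mem_Icc] at hm
    lia
  · rw [show α - i * (α - 1) = -(((i : ℤ) - 1 : ℤ) : ℚ) * α + (((i : ℤ) - 1 : ℤ) : ℚ) + 1 by
      push_cast; ring]

end Regimes

/-! ### Non-vanishing and distinctness at `δ = 2`, `δ̃ = 1`. -/

section Nonvanishing

theorem positivePart_lower_ne_zero (i : ℕ) : (positivePart lowerSeries i 2 1).coeff 1 ≠ 0 := by
  cases i with
  | zero =>
    rw [positivePart_lower_zero]
    exact one_ne_zero
  | succ i =>
    rw [positivePart_lower_succ]
    exact mul_ne_zero (by norm_num) (pow_ne_zero _ (by norm_num))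

/-- From index one on, the coefficients form a geometric progression of ratio `32`; the coefficient
at index zero lies outside it, hence the shift. -/
theorem positivePart_lower_injective {i j : ℕ} (h : (positivePart lowerSeries (i + 1) 2 1).coeff 1 =
    (positivePart lowerSeries (j + 1) 2 1).coeff 1) : i = j := by
  rw [positivePart_lower_succ, positivePart_lower_succ] at h
  have h' : (32 : ℂ) ^ i = 32 ^ j := mul_left_cancel₀ (by norm_num) h
  exact Nat.pow_right_injective (le_refl 32 |>.trans' (by norm_num)) (by exact_mod_cast h')

theorem positivePart_upper_ne_zero (i : ℕ) : (positivePart upperSeries i 2 1).coeff 1 ≠ 0 := by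
  cases i with
  | zero =>
    rw [positivePart_upper_zero]
    norm_num
  | succ i =>
    rw [positivePart_upper_succ]
    exact mul_ne_zero (by norm_num) (pow_ne_zero _ (by norm_num))

theorem positivePart_upper_injective {i j : ℕ} (h : (positivePart upperSeries (i + 1) 2 1).coeff 1 =
    (positivePart upperSeries (j + 1) 2 1).coeff 1) : i = j := by
  rw [positivePart_upper_succ, positivePart_upper_succ, one_div_pow, one_div_pow] at h
  have h' : (32 : ℂ) ^ i = 32 ^ j := by
    simpa using mul_left_cancel₀ (by norm_num) h
  exact Nat.pow_right_injective (le_refl 32 |>.trans' (by norm_num)) (by exact_mod_cast h')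

/-- A cancellation between the resonant and the universal contribution would require `1 = 2 · 32 ^
i`, which fails by parity. -/
theorem positivePart_add_zeroPart_upper_ne_zero (i : ℕ) :
    (positivePart upperSeries (i + 1) 2 1 + zeroPart upperSeries 2 1).coeff 1 ≠ 0 := by
  rw [Polynomial.coeff_add, positivePart_upper_succ, zeroPart_upper_one, one_div_pow]
  intro h
  have h0 : (32 : ℂ) ^ i ≠ 0 := pow_ne_zero _ (by norm_num)
  field_simp at h
  have h1 : (1 : ℂ) = 2 * 32 ^ i := by linear_combination h / 32
  have h2 : 1 = 2 * 32 ^ i := by exact_mod_cast h1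
  lia

end Nonvanishing

end W3

open W3 in
theorem mainTheorem7
    (w : ℚ → ℝ → Puiseux)
    (hw : ∀ (α : ℚ) (δ : ℝ), 0 < α → δ ≠ 0 →
      w α δ ^ 2 = semiDegenerateCharge (cPow 1) (HahnSeries.C (δ : ℂ) * cPow α)) :
    -- the leading behaviour of the spin-3 charge
    (∀ (α : ℚ) (δ : ℝ), 0 < α → δ ≠ 0 →
      (α < 1 → (w α δ ^ 2).order = -(2 * α) ∧
        (w α δ ^ 2).leadingCoeff = -(δ : ℂ) ^ 2 / 5) ∧
      (1 < α → (w α δ ^ 2).order = -(3 * α - 1) ∧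
        (w α δ ^ 2).leadingCoeff = 32 * (δ : ℂ) ^ 3 / 5)) ∧
    -- the case `0 < α < 1`
    ((∀ M : ℕ, 1 ≤ M → ∀ α ∈ lowerInterval M,
        (∀ δ δt : ℝ, δ ≠ 0 → δt ≠ 0 →
          classicalBlock w α δ δt =
            ∑ m ∈ Finset.Icc 1 M,
              term (coeffFun w α (m * α - m + 1) δ δt) (m * α - m + 1) +
            term (coeffFun w α 0 δ δt) 0) ∧
        (∀ m ∈ Finset.Icc 1 M, ¬ SameFun (coeffFun w α (m * α - m + 1)) 0) ∧
        ¬ SameFun (coeffFun w α 0) 0) ∧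
      (∀ M M' : ℕ, 1 ≤ M → 1 ≤ M' → ∀ α ∈ lowerInterval M, ∀ α' ∈ lowerInterval M',
        ∀ m : ℕ, 1 ≤ m → m ≤ M → m ≤ M' →
          SameFun (coeffFun w α (m * α - m + 1)) (coeffFun w α' (m * α' - m + 1))) ∧
      (∀ M M' : ℕ, 1 ≤ M → 1 ≤ M' → ∀ α ∈ lowerRegular M, ∀ α' ∈ lowerRegular M',
        SameFun (coeffFun w α 0) (coeffFun w α' 0)) ∧
      (∀ M M' : ℕ, 1 ≤ M → 1 ≤ M' → M ≠ M' →
        ¬ SameFun (coeffFun w (M / (M + 1)) 0) (coeffFun w (M' / (M' + 1)) 0)) ∧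
      (∀ M M' : ℕ, 1 ≤ M → 1 ≤ M' → ∀ α ∈ lowerRegular M',
        ¬ SameFun (coeffFun w (M / (M + 1)) 0) (coeffFun w α 0))) ∧
    -- the case `α > 1`
    ((∀ N : ℕ, 1 ≤ N → ∀ α ∈ upperInterval N,
        (∀ δ δt : ℝ, δ ≠ 0 → δt ≠ 0 →
          classicalBlock w α δ δt =
            ∑ n ∈ Finset.Icc (-1 : ℤ) (N - 1),
              term (coeffFun w α (-n * α + n + 1) δ δt) (-n * α + n + 1) +
            term (coeffFun w α 0 δ δt) 0) ∧
        (∀ n ∈ Finset.Icc (-1 : ℤ) (N - 1), ¬ SameFun (coeffFun w α (-n * α + n + 1)) 0) ∧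
        ¬ SameFun (coeffFun w α 0) 0) ∧
      (∀ N N' : ℕ, 1 ≤ N → 1 ≤ N' → ∀ α ∈ upperInterval N, ∀ α' ∈ upperInterval N',
        ∀ n : ℤ, -1 ≤ n → n ≤ N - 1 → n ≤ N' - 1 →
          SameFun (coeffFun w α (-n * α + n + 1)) (coeffFun w α' (-n * α' + n + 1))) ∧
      (∀ N N' : ℕ, 1 ≤ N → 1 ≤ N' → ∀ α ∈ upperRegular N, ∀ α' ∈ upperRegular N',
        SameFun (coeffFun w α 0) (coeffFun w α' 0)) ∧
      (∀ N N' : ℕ, 1 ≤ N → 1 ≤ N' → N ≠ N' →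
        ¬ SameFun (coeffFun w ((N + 1) / N) 0) (coeffFun w ((N' + 1) / N') 0)) ∧
      (∀ N N' : ℕ, 1 ≤ N → 1 ≤ N' → ∀ α ∈ upperRegular N',
        ¬ SameFun (coeffFun w ((N + 1) / N) 0) (coeffFun w α 0))) := by
  refine ⟨fun α δ hα hδ => ⟨fun h1 => ?_, fun h1 => ?_⟩,
    ⟨fun M hM α hα => ⟨fun δ δt hδ hδt => ?_, fun m hm => ?_, ?_⟩,
      fun M M' hM hM' α hα α' hα' m h1 hm hm' δ δt hδ hδt => ?_,
      fun M M' hM hM' α hα α' hα' δ δt hδ hδt => ?_,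
      fun M M' hM hM' hne h => ?_, fun M M' hM hM' α hα h => ?_⟩,
    ⟨fun N hN α hα => ⟨fun δ δt hδ hδt => ?_, fun m hm => ?_, ?_⟩,
      fun N N' hN hN' α hα α' hα' m h1 hm hm' δ δt hδ hδt => ?_,
      fun N N' hN hN' α hα α' hα' δ δt hδ hδt => ?_,
      fun N N' hN hN' hne h => ?_, fun N N' hN hN' α hα h => ?_⟩⟩
  · exact order_semiDegenerateCharge_of_lt_one hα h1 (by exact_mod_cast hδ) (hw α δ hα hδ)
  · exact order_semiDegenerateCharge_of_one_lt h1 (by exact_mod_cast hδ) (hw α δ hα hδ)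
  · exact classicalBlock_lower hw hM hα hδ hδt
  · rw [Finset.mem_Icc] at hm
    refine not_sameFun_of_coeff (k := 1) ?_
    rw [coeffFun_lower hw hM hα hm.1 hm.2 two_ne_zero one_ne_zero]
    exact positivePart_lower_ne_zero _
  · rcases lowerInterval_cases hα with rfl | hα'
    · refine not_sameFun_of_coeff (k := 1) ?_
      rw [coeffFun_zero_lowerExceptional hw hM two_ne_zero one_ne_zero, Polynomial.coeff_add,
        zeroPart_lower_one, add_zero]
      exact positivePart_lower_ne_zero _
    -- Away from the exceptional points the `z` coefficient of the `c^0` function vanishes at `(2,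
    -- 1)`, so the `z²` coefficient is used.
    · refine not_sameFun_of_coeff (k := 2) ?_
      rw [coeffFun_zero_lowerRegular hw hM hα' two_ne_zero one_ne_zero, zeroPart_lower_two]
      norm_num
  · rw [coeffFun_lower hw hM hα h1 hm hδ hδt, coeffFun_lower hw hM' hα' h1 hm' hδ hδt]
  · rw [coeffFun_zero_lowerRegular hw hM hα hδ hδt, coeffFun_zero_lowerRegular hw hM' hα' hδ hδt]
  · refine not_sameFun_of_coeff (k := 1) (fun h' => hne ?_) h
    rw [coeffFun_zero_lowerExceptional hw hM two_ne_zero one_ne_zero,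
      coeffFun_zero_lowerExceptional hw hM' two_ne_zero one_ne_zero, Polynomial.coeff_add,
      Polynomial.coeff_add, add_left_inj] at h'
    -- At `α = M / (M + 1)` the resonant index is `M` itself, so `M ≥ 1` is used to enter the
    -- geometric part of the series. In the range above `1` the resonant index is `N + 1` and no
    -- such shift is needed.
    obtain ⟨i, rfl⟩ := Nat.exists_eq_add_of_le' hM
    obtain ⟨j, rfl⟩ := Nat.exists_eq_add_of_le' hM'
    rw [positivePart_lower_injective h']
  · refine not_sameFun_of_coeff (k := 1) ?_ h
    rw [coeffFun_zero_lowerExceptional hw hM two_ne_zero one_ne_zero,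
      coeffFun_zero_lowerRegular hw hM' hα two_ne_zero one_ne_zero, Polynomial.coeff_add, ne_eq,
      add_eq_right]
    exact positivePart_lower_ne_zero _
  · exact classicalBlock_upper hw hN hα hδ hδt
  · rw [Finset.mem_Icc] at hm
    refine not_sameFun_of_coeff (k := 1) ?_
    rw [coeffFun_upper hw hN hα hm.1 hm.2 two_ne_zero one_ne_zero]
    exact positivePart_upper_ne_zero _
  · rcases upperInterval_cases hα with rfl | hα'
    · refine not_sameFun_of_coeff (k := 1) ?_
      rw [coeffFun_zero_upperExceptional hw hN two_ne_zero one_ne_zero]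
      exact positivePart_add_zeroPart_upper_ne_zero _
    · refine not_sameFun_of_coeff (k := 1) ?_
      rw [coeffFun_zero_upperRegular hw hN hα' two_ne_zero one_ne_zero, zeroPart_upper_one]
      norm_num
  · rw [coeffFun_upper hw hN hα h1 hm hδ hδt, coeffFun_upper hw hN' hα' h1 hm' hδ hδt]
  · rw [coeffFun_zero_upperRegular hw hN hα hδ hδt, coeffFun_zero_upperRegular hw hN' hα' hδ hδt]
  · refine not_sameFun_of_coeff (k := 1) (fun h' => hne ?_) h
    rw [coeffFun_zero_upperExceptional hw hN two_ne_zero one_ne_zero,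
      coeffFun_zero_upperExceptional hw hN' two_ne_zero one_ne_zero, Polynomial.coeff_add,
      Polynomial.coeff_add, add_left_inj] at h'
    exact positivePart_upper_injective h'
  -- The universal part is common to both sides, so the difference is exactly the resonant
  -- contribution.
  · refine not_sameFun_of_coeff (k := 1) ?_ h
    rw [coeffFun_zero_upperExceptional hw hN two_ne_zero one_ne_zero,
      coeffFun_zero_upperRegular hw hN' hα two_ne_zero one_ne_zero, Polynomial.coeff_add, ne_eq,
      add_eq_right]
    exact positivePart_upper_ne_zero _
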